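/- Let $\sigma_c,\sigma_s,\sigma_m>0$ and $0<r_i<r_e$ satisfy the neutrality condition $$(2\sigma_s+\sigma_c)(\sigma_m-\sigma_s)+\Big(\frac{r_i}{r_e}\Big)^3(\sigma_s-\sigma_c)(2\sigma_s+\sigma_m)=0 .$$ Let $W^{2,\infty}(S^2)$ be the space of functions $h$ on the unit sphere $S^2\subset\mathbb R^3$ (represented by their continuous representatives) with $\|h\|_{2,\infty}:=\|h\|_\infty+\|\nabla_T h\|_\infty+\|\nabla_T^2h\|_\infty<\infty$, where $\nabla_T,\nabla_T^2$ are the (weak) tangential gradient and Hessian, and let $W_6$ be the six-dimensional space of functions on $S^2$ spanned by $$\tfrac1{\sqrt{15}},\quad \hat x_1\hat x_2,\quad \hat x_2\hat x_3,\quad \tfrac1{2\sqrt3}(-\hat x_1^2-\hat x_2^2+2\hat x_3^2),\quad \hat x_1\hat x_3,\quad \tfrac12(\hat x_1^2-\hat x_2^2),$$ that is, by the spherical harmonics of degrees $0$ and $2$. For functions $h,b$ on $S^2$ let $$D_h=\{t\omega:\omega\in S^2,\ 0\le t<r_i+h(\omega)\},\qquad \Omega_b=\{t\omega:\omega\in S^2,\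 0\le t<r_e+b(\omega)\}.$$ For $D\subset\Omega$ let $\sigma=\sigma_c$ in $D$, $\sigma=\sigma_s$ in $\Omega\setminus D$ and $\sigma=\sigma_m$ in $\mathbb R^3\setminus\Omega$. The polarization tensor of $(D,\Omega)$ is the $3\times3$ matrix $M(D,\Omega)$ such that, for every unit vector $a\in\mathbb R^3$, the weak solution $u\in H^1_{\mathrm{loc}}(\mathbb R^3)$ of $\nabla\cdot\sigma\nabla u=0$ in $\mathbb R^3$ with $u(x)-a\cdot x=O(|x|^{-2})$ as $|x|\to\infty$ satisfies $$u(x)-a\cdot x=\frac1{4\pi}\frac{\langle Ma,x\rangle}{|x|^3}+O(|x|^{-3}),\qquad |x|\to\infty .$$ **Theorem.** There are $\varepsilon>0$ and a map $h\mapsto b(h)\in W_6$, defined for all $h\in W^{2,\infty}(S^2)$ with $\|h\|_{2,\infty}<\varepsilon$, such that for every such $h$ one has $r_i+h>0$ on $S^2$, $\overline{D_h}\subset\Omega_{b(h)}$, and $$M(D_h,\Omega_{b(h)})=0 .$$ The map $h\mapsto b(h)$ is continuous from the $\|\cdot\|_{2,\infty}$-ball of radius $\varepsilon$ into the finite-dimensional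 space $W_6$. -/

import Mathlib

open MeasureTheory Metric
open scoped ENNReal

noncomputable section

namespace CoreShell

/-- Three-dimensional Euclidean space. -/
abbrev E3 : Type := EuclideanSpace ℝ (Fin 3)

/-- The unit sphere `S²`. -/
abbrev S2 : Type := sphere (0 : E3) 1

/-- The surface measure on `S²`. -/
def surfaceMeasure : Measure S2 := (volume : Measure E3).toSphere

/-- `F'` is the weak (distributional) derivative of `F` on the open set `U`:
`∫ (∂_v φ) F = - ∫ φ F' v` for all test functions `φ ∈ C_c^∞(U)` and all directions `v`. -/
def HasWeakFDerivOn {V : Type*} [NormedAddCommGroup V] [NormedSpace ℝ V]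
    (U : Set E3) (F : E3 → V) (F' : E3 → E3 →L[ℝ] V) : Prop :=
  LocallyIntegrableOn F U volume ∧ LocallyIntegrableOn F' U volume ∧
    ∀ φ : E3 → ℝ, ContDiff ℝ (⊤ : ℕ∞) φ → HasCompactSupport φ → tsupport φ ⊆ U →
      ∀ v : E3, ∫ x, (fderiv ℝ φ x v) • F x = - ∫ x, φ x • F' x v

/-! ### The space `W^{2,∞}(S²)` -/

open Classical in
/-- The extension `x ↦ f (x / |x|)` of a function on `S²`, homogeneous of degree `0`
(with the irrelevant value `0` at the origin). -/
def radialExt {V : Type*} [Zero V] (f : S2 → V) (x : E3) : V :=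
  if hx : x = 0 then 0
  else f ⟨‖x‖⁻¹ • x, by
    rw [mem_sphere_zero_iff_norm, norm_smul, norm_inv, norm_norm,
      inv_mul_cancel₀ (norm_ne_zero_iff.mpr hx)]⟩

/-- The orthogonal projection of the ambient space onto the tangent plane of `S²` at `ω`. -/
def tangentProj (ω : S2) : E3 →L[ℝ] E3 := (Submodule.span ℝ {(ω : E3)})ᗮ.starProjection

/-- The functions `g` and `k` on `S²` are the first and second weak derivatives along `S²` of the
extension of `f` that is constant in the normal direction. As that extension is homogeneous of
degree `0`, its derivatives at `x` are `|x|⁻¹ g(x / |x|)` and `|x|⁻² k(x / |x|)`. -/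
def HasSphereWeakDerivs (f : S2 → ℝ) (g : S2 → E3 →L[ℝ] ℝ) (k : S2 → E3 →L[ℝ] E3 →L[ℝ] ℝ) :
    Prop :=
  HasWeakFDerivOn {0}ᶜ (radialExt f) (fun x => ‖x‖⁻¹ • radialExt g x) ∧
    HasWeakFDerivOn {0}ᶜ (fun x => ‖x‖⁻¹ • radialExt g x)
      (fun x => (‖x‖ ^ 2)⁻¹ • radialExt k x)

/-- The norm `‖f‖_{2,∞} = ‖f‖_∞ + ‖∇_T f‖_∞ + ‖∇_T² f‖_∞` with values in `[0, ∞]`; it is `∞` when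
`f` does not have weak derivatives of order at most two. The tangential gradient and the tangential
Hessian are the restrictions of the first two derivatives of the normally constant extension to the
tangent planes. The weak derivatives are unique up to null sets, so the infimum merely selects
them. -/
def normW2 (f : S2 → ℝ) : ℝ≥0∞ :=
  ⨅ (g : S2 → E3 →L[ℝ] ℝ) (k : S2 → E3 →L[ℝ] E3 →L[ℝ] ℝ) (_ : HasSphereWeakDerivs f g k),
    eLpNorm f ∞ surfaceMeasure
      + eLpNorm (fun ω => (g ω).comp (tangentProj ω)) ∞ surfaceMeasure
      + eLpNorm (fun ω => (k ω).bilinearComp (tangentProj ω) (tangentProj ω)) ∞ surfaceMeasure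

/-- Membership in `W^{2,∞}(S²)`; each class is represented by its continuous representative. -/
def MemW2 (f : S2 → ℝ) : Prop := Continuous f ∧ normW2 f < ∞

/-! ### The spherical harmonics of degree zero and two -/

/-- The functions `Y_1, …, Y_6` on `S²`. -/
def Y : Fin 6 → S2 → ℝ :=
  ![fun _ => 1 / √15,
    fun ω => ω.1 0 * ω.1 1,
    fun ω => ω.1 1 * ω.1 2,
    fun ω => 1 / (2 * √3) * (-(ω.1 0) ^ 2 - (ω.1 1) ^ 2 + 2 * (ω.1 2) ^ 2),
    fun ω => ω.1 0 * ω.1 2,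
    fun ω => 1 / 2 * ((ω.1 0) ^ 2 - (ω.1 1) ^ 2)]

/-- The space `W₆` spanned by `Y_1, …, Y_6`. -/
def W6 : Submodule ℝ (S2 → ℝ) := Submodule.span ℝ (Set.range Y)

/-! ### Core-shell inclusions and their polarization tensor -/

/-- The star-shaped domain whose boundary is `{(r + f(ω)) ω : ω ∈ S²}` (for `r + f > 0`). -/
def perturbedBall (r : ℝ) (f : S2 → ℝ) : Set E3 :=
  {x | ∃ (ω : S2) (t : ℝ), 0 ≤ t ∧ t < r + f ω ∧ x = t • (ω : E3)}

open Classical in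
/-- The conductivity distribution: `σc` in the core `D`, `σs` in the shell `Ω \ D`, and `σm` in the
matrix outside `Ω`. -/
def conductivity (D Ω : Set E3) (σc σs σm : ℝ) (x : E3) : ℝ :=
  if x ∈ D then σc else if x ∈ Ω then σs else σm

/-- `u` is a weak solution in `H¹_loc(ℝ³)`, with weak derivative `u'`, of `∇ · (σ ∇u) = 0` in `ℝ³`.
The number `u' x (∇φ(x))` is `∇u(x) · ∇φ(x)`. -/
def IsWeakSolution (σ : E3 → ℝ) (u : E3 → ℝ) : Prop :=
  ∃ u' : E3 → E3 →L[ℝ] ℝ, HasWeakFDerivOn Set.univ u u' ∧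
    (∀ K : Set E3, IsCompact K →
      MemLp u 2 (volume.restrict K) ∧ MemLp u' 2 (volume.restrict K)) ∧
    ∀ φ : E3 → ℝ, ContDiff ℝ (⊤ : ℕ∞) φ → HasCompactSupport φ →
      ∫ x, σ x * u' x (gradient φ x) = 0

/-- The filter of neighbourhoods of infinity in `ℝ³` up to null sets: a property holds eventually
if for some `R` it holds for almost all `x` with `|x| ≥ R`. -/
def aeInfinity : Filter E3 := Bornology.cobounded E3 ⊓ ae volume

/-- `u` solves the conductivity problem with background uniform field `a`:
`∇ · (σ ∇u) = 0` in `ℝ³` and `u(x) - a · x = O(|x|⁻²)` as `|x| → ∞`. -/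
def IsConductivitySolution (σ : E3 → ℝ) (a : E3) (u : E3 → ℝ) : Prop :=
  IsWeakSolution σ u ∧
    (fun x => u x - inner ℝ a x) =O[aeInfinity] (fun x => (‖x‖ ^ 2)⁻¹)

/-- The matrix `M` is the polarization tensor of the core-shell inclusion `(D, Ω)`: for every unit
vector `a` the conductivity problem is solvable, and its solution has the dipole expansion
`u(x) - a · x = (1 / 4π) ⟨M a, x⟩ / |x|³ + O(|x|⁻³)`, where `4π` is the area of `S²`. -/
def IsPolarizationTensor (D Ω : Set E3) (σc σs σm : ℝ) (M : Matrix (Fin 3) (Fin 3) ℝ) : Prop :=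
  ∀ a : E3, ‖a‖ = 1 →
    (∃ u, IsConductivitySolution (conductivity D Ω σc σs σm) a u) ∧
    ∀ u, IsConductivitySolution (conductivity D Ω σc σs σm) a u →
      (fun x => u x - inner ℝ a x
          - 1 / (4 * Real.pi) * (inner ℝ (Matrix.toEuclideanLin M a) x / ‖x‖ ^ 3))
        =O[aeInfinity] (fun x => (‖x‖ ^ 3)⁻¹)

end CoreShell

end

open CoreShell

noncomputable section

namespace CoreShell

/-! ### Correctors: the variational problem in an abstract Hilbert space -/

section


section Corrector

variable {H : Type*} [NormedAddCommGroup H] [InnerProductSpace ℝ H]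

/-! The solution with background field `a` has the form `a · x + w`, and its corrector `p = ∇w`
solves a coercive problem in `gradSpace`, the L² closure of the gradients of test functions. Let `N`
be multiplication by the contrast `σ - σm`, which has compact support, and let `v` be `a` cut off
outside a large ball. The equation is `⟪σm p + N (v + p), q⟫ = 0` for all `q` in `gradSpace`. The
form `⟪N (v_a + p_a), v_c⟫` is the dipole moment up to normalization. If it vanishes, the source of
`w` has mean zero and a comparison with the Newtonian kernel gives `w = O(|x|⁻³)`. A Caccioppoli
estimate shows that every other admissible solution has the same gradient. This is
`conductivity_solution_of_corrector`; it reduces the theorem to the vanishing of a symmetric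
bilinear form on `ℝ³`, that is, to six scalar equations.

For concentric balls the neutrality condition makes the form vanish: the corrector is explicit and
the perturbation of the flux is a curl (`neutral_corrector`).

The outer boundary is moved by the radial diffeomorphism `x ↦ x + g(|x|²)⟪Qx, x⟫ x` with `Q`
symmetric. It fixes pointwise a ball containing all cores and carries the sphere of radius `re` to
the surface `re + ⟪Qω, ω⟫`, so that the boundary perturbation lies in `W6` and there are six
unknowns. The polarization form is invariant under this change of variables, because its diagonal is
a minimal energy (`polarization_pullback`). Hence the outer boundary can be kept fixed, at the price
of the coefficient `pullbackMatrix`, which is smooth in `Q`. At the neutral configuration the first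
variation in `Q` is `κ₁ tr Q ⟪a, c⟫ - κ₂ ⟪Qa, c⟫` (`shape_derivative`), which is invertible when `σs
≠ σm`. When `σs = σm`, neutrality forces `σc = σs`; the medium is homogeneous and `b = 0` works.

The core enters in a less regular way: moving an interface changes the conductivity by a fixed
amount on a thin set, so media with different cores are not close in operator norm. Two facts
replace norm closeness. The difference of two polarization forms is exactly `⟪(N₁ - N₂)(v + p₁), w +
p₂⟫` (`IsCorrector.polarization_sub`), and the difference of two correctors is bounded by the action
of `N₁ - N₂` on a single field (`IsCorrector.norm_sub_le`). So the dependence on `Q` stays close to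
its linearization for all cores that look close to the ball to the three unperturbed fields
(`exists_newton`), and `Q ↦ Q - shapeInv (polOp D Q)` is a contraction, uniformly in such cores. Its
fixed point defines `b` (`exists_compensation`).

Continuity comes from the same estimate: `‖Q - Q'‖` is bounded by the effect of the change of core
on the fields of the first core, and this tends to zero because the two cores differ only in a thin
shell (`eventually_norm_op_sub_apply_le`). Of the norm of `h`, only the supremum part is used. -/

/-- `p ∈ G` solves the variational problem `⟪s p + N (v + p), q⟫ = 0` for all `q ∈ G`. -/
def IsCorrector (G : Submodule ℝ H) (s : ℝ) (N : H →L[ℝ] H) (v p : H) : Prop :=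
  p ∈ G ∧ ∀ q ∈ G, inner ℝ (s • p + N (v + p)) q = 0

/-- `s + N` is coercive on `G` with constant `lam`. -/
def IsCoerciveOn (G : Submodule ℝ H) (s lam : ℝ) (N : H →L[ℝ] H) : Prop :=
  ∀ p ∈ G, lam * ‖p‖ ^ 2 ≤ s * ‖p‖ ^ 2 + inner ℝ (N p) p

/-- The energy whose minimizer over `G` is the corrector. -/
def energy (s : ℝ) (N : H →L[ℝ] H) (v q : H) : ℝ :=
  inner ℝ (N (v + q)) (v + q) + s * ‖q‖ ^ 2

variable {G : Submodule ℝ H} {s lam : ℝ} {N N₁ N₂ : H →L[ℝ] H} {v w p p₁ p₂ q : H}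

/-- Lax–Milgram on the complete space `G`, for the form `⟪(s + N) p, q⟫` and the functional `q ↦ -⟪N
v, q⟫`. Symmetry of `N` is not needed. -/
theorem IsCoerciveOn.exists_isCorrector [CompleteSpace H] (hG : IsClosed (G : Set H))
    (hlam : 0 < lam) (hN : IsCoerciveOn G s lam N) (v : H) : ∃ p, IsCorrector G s N v p := by
  have : CompleteSpace G := hG.completeSpace_coe
  let B : G →L[ℝ] G →L[ℝ] ℝ :=
    ((innerSL ℝ : H →L[ℝ] H →L[ℝ] ℝ).bilinearComp
      ((s • ContinuousLinearMap.id ℝ H + N).comp G.subtypeL) G.subtypeL)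
  have hB : ∀ p q : G, B p q = inner ℝ (s • (p : H) + N p) (q : H) := fun p q => by
    simp [B, inner_add_left, real_inner_smul_left]
  have hc : IsCoercive B := by
    refine ⟨lam, hlam, fun u => ?_⟩
    have := hN u u.2
    rw [hB, inner_add_left, real_inner_smul_left, real_inner_self_eq_norm_sq, mul_assoc, ← sq]
    exact this
  let f : G := (InnerProductSpace.toDual ℝ G).symm
    (((innerSL ℝ : H →L[ℝ] H →L[ℝ] ℝ) (-(N v))).comp G.subtypeL)
  have hf : ∀ q : G, inner ℝ f q = inner ℝ (-(N v)) (q : H) := fun q => by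
    simp [f]
  let p := (hc.continuousLinearEquivOfBilin).symm
  obtain ⟨p, hp⟩ : ∃ p : G, ∀ q : G, B p q = inner ℝ f q :=
    ⟨(hc.continuousLinearEquivOfBilin).symm f, fun q => by
      rw [← hc.continuousLinearEquivOfBilin_apply, ContinuousLinearEquiv.apply_symm_apply]⟩
  refine ⟨p, p.2, fun q hq => ?_⟩
  have := hp ⟨q, hq⟩
  rw [hB, hf] at this
  simp only [inner_add_left, inner_neg_left, map_add] at this ⊢
  linarith

/-- Subtract the two equations and test with `p₁ - p₂`; only the first medium has to be coercive.
The bound involves `N₁ - N₂` at the single field `v + p₂` and not its operator norm. This is what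
makes perturbations of the core tractable. -/
theorem IsCorrector.norm_sub_le (hlam : 0 < lam) (hN : IsCoerciveOn G s lam N₁)
    (h₁ : IsCorrector G s N₁ v p₁) (h₂ : IsCorrector G s N₂ v p₂) :
    ‖p₁ - p₂‖ ≤ lam⁻¹ * ‖(N₁ - N₂) (v + p₂)‖ := by
  have hd := G.sub_mem h₁.1 h₂.1
  have e₁ := h₁.2 _ hd
  have e₂ := h₂.2 _ hd
  have e : inner ℝ (s • (p₁ - p₂) + N₁ (p₁ - p₂) + (N₁ - N₂) (v + p₂)) (p₁ - p₂) = 0 := by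
    rw [← sub_eq_zero.mpr (e₁.trans e₂.symm), ← inner_sub_left]
    congr 1
    simp only [sub_apply, map_add, map_sub, smul_sub]
    abel
  have hc := hN _ hd
  rw [inner_add_left, inner_add_left, real_inner_smul_left, real_inner_self_eq_norm_sq] at e
  have := neg_le_of_abs_le (abs_real_inner_le_norm ((N₁ - N₂) (v + p₂)) (p₁ - p₂))
  rw [inv_mul_eq_div, le_div_iff₀ hlam]
  rcases (norm_nonneg (p₁ - p₂)).eq_or_lt with h0 | h0
  · rw [← h0]; simp
  · nlinarith

theorem IsCorrector.unique (hlam : 0 < lam) (hN : IsCoerciveOn G s lam N)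
    (h₁ : IsCorrector G s N v p₁) (h₂ : IsCorrector G s N v p₂) : p₁ = p₂ := by
  have := h₁.norm_sub_le hlam hN h₂
  rw [sub_self] at this
  simpa [sub_eq_zero] using this

theorem IsCorrector.norm_le (hlam : 0 < lam) (hN : IsCoerciveOn G s lam N)
    (h : IsCorrector G s N v p) : ‖p‖ ≤ lam⁻¹ * ‖N v‖ := by
  have h0 : IsCorrector G s (0 : H →L[ℝ] H) v 0 := ⟨G.zero_mem, by simp⟩
  simpa using h.norm_sub_le hlam hN h0

theorem IsCorrector.add (h₁ : IsCorrector G s N v p₁) (h₂ : IsCorrector G s N w p₂) :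
    IsCorrector G s N (v + w) (p₁ + p₂) := by
  refine ⟨G.add_mem h₁.1 h₂.1, fun q hq => ?_⟩
  rw [← add_zero (0 : ℝ)]
  nth_rw 1 [← h₁.2 q hq]
  rw [← h₂.2 q hq, ← inner_add_left]
  congr 1
  simp only [map_add, smul_add]
  abel

/-- The difference of the polarization forms of two media. -/
theorem IsCorrector.polarization_sub (hN₂ : ∀ x y, inner ℝ (N₂ x) y = inner ℝ x (N₂ y))
    (h₁ : IsCorrector G s N₁ v p₁) (h₂ : IsCorrector G s N₂ w p₂) :
    inner ℝ (N₁ (v + p₁)) w - inner ℝ (N₂ (w + p₂)) v =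
      inner ℝ ((N₁ - N₂) (v + p₁)) (w + p₂) := by
  have e₁ := h₁.2 _ h₂.1
  have e₂ := h₂.2 _ h₁.1
  rw [inner_add_left, real_inner_smul_left] at e₁ e₂
  rw [sub_apply, inner_sub_left, hN₂ (v + p₁), inner_add_right,
    real_inner_comm _ (v + p₁), inner_add_right, real_inner_comm p₁ p₂] at *
  linarith

theorem IsCorrector.polarization_symm (hN : ∀ x y, inner ℝ (N x) y = inner ℝ x (N y))
    (h₁ : IsCorrector G s N v p₁) (h₂ : IsCorrector G s N w p₂) :
    inner ℝ (N (v + p₁)) w = inner ℝ (N (w + p₂)) v := by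
  have := h₁.polarization_sub hN h₂
  simpa [sub_eq_zero] using this

theorem IsCorrector.energy_eq (h : IsCorrector G s N v p) :
    energy s N v p = inner ℝ (N (v + p)) v := by
  have e := h.2 _ h.1
  rw [inner_add_left, real_inner_smul_left, real_inner_self_eq_norm_sq] at e
  rw [energy, inner_add_right]
  linarith

/-- Expanding the energy around `p`, the linear term vanishes by the corrector equation and the
quadratic term is nonnegative by coercivity. Together with `energy_eq`, the diagonal of the
polarization form is a minimum of energies, which can be compared between different media. -/
theorem IsCorrector.le_energy (hlam : 0 ≤ lam) (hc : IsCoerciveOn G s lam N)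
    (hN : ∀ x y, inner ℝ (N x) y = inner ℝ x (N y))
    (h : IsCorrector G s N v p) (hq : q ∈ G) :
    inner ℝ (N (v + p)) v ≤ energy s N v q := by
  obtain ⟨d, rfl⟩ : ∃ d, q = p + d := ⟨q - p, by abel⟩
  have hd : d ∈ G := by simpa using G.sub_mem hq h.1
  have e := h.2 _ hd
  have c := hc _ hd
  have e₃ : energy s N v (p + d) = energy s N v p + 2 * inner ℝ (s • p + N (v + p)) d
      + (s * ‖d‖ ^ 2 + inner ℝ (N d) d) := by
    simp only [energy, ← add_assoc, map_add N (v + p) d, norm_add_sq_real]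
    rw [inner_add_left (N (v + p)), inner_add_right (N (v + p)), inner_add_right (N d), hN d,
      real_inner_comm _ d, inner_add_left (s • p), real_inner_smul_left]
    ring
  rw [← h.energy_eq, e₃, e]
  linarith [mul_nonneg hlam (sq_nonneg ‖d‖)]

end Corrector

end

/-! ### Square integrable gradients and multiplication operators -/

section


/-- The Hilbert space of square integrable vector fields on `ℝ³`. -/
abbrev L2Field : Type := Lp E3 2 (volume : Measure E3)

/-- Smooth functions with compact support. -/
def IsTest (φ : E3 → ℝ) : Prop := ContDiff ℝ (⊤ : ℕ∞) φ ∧ HasCompactSupport φ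

theorem gradient_eq (φ : E3 → ℝ) :
    gradient φ = fun x => (InnerProductSpace.toDual ℝ E3).symm (fderiv ℝ φ x) := rfl

namespace IsTest

variable {φ ψ : E3 → ℝ}

theorem add (hφ : IsTest φ) (hψ : IsTest ψ) : IsTest (φ + ψ) :=
  ⟨hφ.1.add hψ.1, hφ.2.add hψ.2⟩

theorem const_smul (hφ : IsTest φ) (c : ℝ) : IsTest (c • φ) :=
  ⟨hφ.1.const_smul c, hφ.2.smul_left (f := fun _ => c)⟩

theorem neg (hφ : IsTest φ) : IsTest (-φ) := ⟨hφ.1.neg, hφ.2.neg⟩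

theorem sub (hφ : IsTest φ) (hψ : IsTest ψ) : IsTest (φ - ψ) := by
  rw [sub_eq_add_neg]; exact hφ.add hψ.neg

theorem zero : IsTest (0 : E3 → ℝ) := ⟨contDiff_const, HasCompactSupport.zero⟩

theorem mul_left (hψ : IsTest ψ) (hφ : ContDiff ℝ (⊤ : ℕ∞) φ) : IsTest (φ * ψ) :=
  ⟨hφ.mul hψ.1, hψ.2.mul_left⟩

theorem differentiable (hφ : IsTest φ) : Differentiable ℝ φ := hφ.1.differentiable (by simp)

theorem fderiv_apply (hφ : IsTest φ) (v : E3) : IsTest (fun x => fderiv ℝ φ x v) :=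
  ⟨(hφ.1.fderiv_right (m := (⊤ : ℕ∞)) (by simp)).clm_apply contDiff_const,
    (hφ.2.fderiv_apply ℝ v)⟩

theorem continuous_gradient (hφ : IsTest φ) : Continuous (gradient φ) :=
  (LinearIsometryEquiv.continuous _).comp (hφ.1.continuous_fderiv (by simp))

theorem hasCompactSupport_gradient (hφ : IsTest φ) : HasCompactSupport (gradient φ) :=
  (hφ.2.fderiv ℝ).comp_left (g := (InnerProductSpace.toDual ℝ E3).symm) (map_zero _)

theorem memLp_gradient (hφ : IsTest φ) {p : ℝ≥0∞} : MemLp (gradient φ) p volume :=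
  hφ.continuous_gradient.memLp_of_hasCompactSupport hφ.hasCompactSupport_gradient

theorem gradient_add (hφ : IsTest φ) (hψ : IsTest ψ) :
    gradient (φ + ψ) = gradient φ + gradient ψ := by
  ext1 x
  simp only [gradient_eq, Pi.add_apply]
  rw [fderiv_add (hφ.differentiable x) (hψ.differentiable x), map_add]

theorem gradient_const_smul (hφ : IsTest φ) (c : ℝ) : gradient (c • φ) = c • gradient φ := by
  ext1 x
  simp only [gradient_eq, Pi.smul_apply]
  rw [fderiv_const_smul (hφ.differentiable x), map_smul]

theorem integrable (hφ : IsTest φ) : Integrable φ :=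
  hφ.1.continuous.integrable_of_hasCompactSupport hφ.2

theorem integral_fderiv (hφ : IsTest φ) (v : E3) : ∫ x, fderiv ℝ φ x v = 0 := by
  have h₁ : Integrable (fun x => (1 : ℝ) * fderiv ℝ φ x v) := by
    simpa using (hφ.fderiv_apply v).integrable
  have h₂ : Integrable (fun x => (1 : ℝ) * φ x) := by simpa using hφ.integrable
  simpa using integral_mul_fderiv_eq_neg_fderiv_mul_of_integrable (f := fun _ : E3 => (1 : ℝ))
    (g := φ) (v := v) (μ := volume) (by simp) h₁ h₂ (by simp)
    (fun x _ => hφ.differentiable x)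

theorem integral_inner_gradient (hφ : IsTest φ) (a : E3) :
    ∫ x, inner ℝ a (gradient φ x) = 0 := by
  simp_rw [real_inner_comm _ a, inner_gradient_left]
  exact hφ.integral_fderiv a

end IsTest

/-- The square integrable gradients of test functions. -/
def testGradients : Submodule ℝ L2Field where
  carrier := {f | ∃ φ, IsTest φ ∧ f =ᵐ[volume] gradient φ}
  add_mem' := by
    rintro f g ⟨φ, hφ, h⟩ ⟨ψ, hψ, h'⟩
    exact ⟨φ + ψ, hφ.add hψ, by
      rw [hφ.gradient_add hψ]; exact (Lp.coeFn_add f g).trans (h.add h')⟩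
  zero_mem' := ⟨0, .zero, by
    have : gradient (0 : E3 → ℝ) = 0 := by ext1 x; simp [gradient_eq]
    rw [this]; exact Lp.coeFn_zero _ _ _⟩
  smul_mem' := by
    rintro c f ⟨φ, hφ, h⟩
    exact ⟨c • φ, hφ.const_smul c, by
      rw [hφ.gradient_const_smul]; exact (Lp.coeFn_smul c f).trans (h.const_smul c)⟩

/-- The closed subspace of `L²` spanned by the gradients of test functions. -/
def gradSpace : Submodule ℝ L2Field := testGradients.topologicalClosure

theorem isClosed_gradSpace : IsClosed (gradSpace : Set L2Field) :=
  testGradients.isClosed_topologicalClosure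

/-- The gradient of a test function as an element of `L²`. -/
def IsTest.gradLp {φ : E3 → ℝ} (hφ : IsTest φ) : L2Field := hφ.memLp_gradient.toLp _

theorem IsTest.coeFn_gradLp {φ : E3 → ℝ} (hφ : IsTest φ) : hφ.gradLp =ᵐ[volume] gradient φ :=
  MemLp.coeFn_toLp _

theorem IsTest.gradLp_mem_testGradients {φ : E3 → ℝ} (hφ : IsTest φ) :
    hφ.gradLp ∈ testGradients := ⟨φ, hφ, hφ.coeFn_gradLp⟩

theorem IsTest.gradLp_mem {φ : E3 → ℝ} (hφ : IsTest φ) : hφ.gradLp ∈ gradSpace :=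
  testGradients.le_topologicalClosure hφ.gradLp_mem_testGradients

theorem exists_gradLp_eq {f : L2Field} (hf : f ∈ testGradients) :
    ∃ (φ : E3 → ℝ) (hφ : IsTest φ), f = hφ.gradLp := by
  obtain ⟨φ, hφ, h⟩ := hf
  exact ⟨φ, hφ, Lp.ext (h.trans hφ.coeFn_gradLp.symm)⟩

theorem exists_seq_gradLp {p : L2Field} (hp : p ∈ gradSpace) :
    ∃ (φ : ℕ → E3 → ℝ) (hφ : ∀ n, IsTest (φ n)),
      Filter.Tendsto (fun n => (hφ n).gradLp) Filter.atTop (nhds p) := by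
  obtain ⟨f, hf, hlim⟩ := mem_closure_iff_seq_limit.mp
    (show p ∈ closure (testGradients : Set L2Field) from hp)
  choose φ hφ h using fun n => exists_gradLp_eq (hf n)
  exact ⟨φ, hφ, by simpa only [← h] using hlim⟩

theorem inner_eq_integral {u v : L2Field} {f g : E3 → E3} (hu : u =ᵐ[volume] f)
    (hv : v =ᵐ[volume] g) : inner ℝ u v = ∫ x, inner ℝ (f x) (g x) := by
  rw [L2.inner_def]
  exact integral_congr_ae (by filter_upwards [hu, hv] with x h h'; rw [h, h'])

/-! ### Multiplication operators -/

/-- Multiplication by an essentially bounded matrix field. -/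
def mulOp {A : E3 → E3 →L[ℝ] E3} (hA : MemLp A ∞ volume) : L2Field →L[ℝ] L2Field :=
  (ContinuousLinearMap.id ℝ (E3 →L[ℝ] E3)).holderL volume ∞ 2 2 (hA.toLp A)

variable {A B : E3 → E3 →L[ℝ] E3}

theorem coeFn_mulOp (hA : MemLp A ∞ volume) (v : L2Field) :
    mulOp hA v =ᵐ[volume] fun x => A x (v x) := by
  filter_upwards [(ContinuousLinearMap.id ℝ (E3 →L[ℝ] E3)).coeFn_holder (r := 2) (hA.toLp A) v,
    hA.coeFn_toLp] with x h h'
  rw [← h']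
  exact h

theorem mulOp_sub (hA : MemLp A ∞ volume) (hB : MemLp B ∞ volume) :
    mulOp hA - mulOp hB = mulOp (hA.sub hB) := by
  rw [mulOp, mulOp, mulOp, MemLp.toLp_sub hA hB, map_sub]

theorem norm_mulOp_le (hA : MemLp A ∞ volume) {C : ℝ} (hC : 0 ≤ C) (h : ∀ x, ‖A x‖ ≤ C) :
    ‖mulOp hA‖ ≤ C := by
  refine ContinuousLinearMap.opNorm_le_bound _ hC fun v => ?_
  refine Lp.norm_le_mul_norm_of_ae_le_mul ?_
  filter_upwards [coeFn_mulOp hA v] with x hx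
  rw [hx]
  exact (A x).le_of_opNorm_le (h x) _

theorem mulOp_symm (hA : MemLp A ∞ volume)
    (h : ∀ x y z, inner ℝ (A x y) z = inner ℝ y (A x z)) (u v : L2Field) :
    inner ℝ (mulOp hA u) v = inner ℝ u (mulOp hA v) := by
  rw [inner_eq_integral (coeFn_mulOp hA u) (ae_eq_refl v),
    inner_eq_integral (ae_eq_refl u) (coeFn_mulOp hA v)]
  simp_rw [h]

/-- The field `a` cut off outside the ball of radius `R`. -/
def ballField (R : ℝ) (a : E3) : L2Field :=
  indicatorConstLp 2 measurableSet_ball (measure_ball_lt_top (x := (0 : E3)) (r := R)).ne a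

theorem coeFn_ballField (R : ℝ) (a : E3) :
    ballField R a =ᵐ[volume] (ball (0 : E3) R).indicator fun _ => a := indicatorConstLp_coeFn

theorem ballField_add (R : ℝ) (a b : E3) : ballField R (a + b) = ballField R a + ballField R b := by
  refine Lp.ext ?_
  filter_upwards [coeFn_ballField R (a + b), Lp.coeFn_add (ballField R a) (ballField R b),
    coeFn_ballField R a, coeFn_ballField R b] with x h₁ h₂ h₃ h₄
  rw [h₁, h₂, Pi.add_apply, h₃, h₄]
  by_cases hx : x ∈ ball (0 : E3) R <;> simp [hx]

theorem ballField_smul (R : ℝ) (c : ℝ) (a : E3) : ballField R (c • a) = c • ballField R a := by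
  refine Lp.ext ?_
  filter_upwards [coeFn_ballField R (c • a), Lp.coeFn_smul c (ballField R a),
    coeFn_ballField R a] with x h₁ h₂ h₃
  rw [h₁, h₂, Pi.smul_apply, h₃]
  by_cases hx : x ∈ ball (0 : E3) R <;> simp [hx]

/-- The cut-off makes the uniform field square integrable, and it is invisible here because the
contrast vanishes outside the ball. -/
theorem coeFn_mulOp_ballField_add {R : ℝ} (hA : MemLp A ∞ volume) (hR : ∀ x ∉ ball (0 : E3) R, A x = 0)
    (a : E3) {p : L2Field} {f : E3 → E3} (hp : p =ᵐ[volume] f) :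
    mulOp hA (ballField R a + p) =ᵐ[volume] fun x => A x (a + f x) := by
  filter_upwards [coeFn_mulOp hA (ballField R a + p), Lp.coeFn_add (ballField R a) p,
    coeFn_ballField R a, hp] with x h₁ h₂ h₃ h₄
  rw [h₁, h₂, Pi.add_apply, h₃, h₄]
  by_cases hx : x ∈ ball (0 : E3) R
  · simp [hx]
  · simp [hR x hx]

theorem inner_mulOp_ballField {R : ℝ} (hA : MemLp A ∞ volume)
    (hR : ∀ x ∉ ball (0 : E3) R, A x = 0) (a c : E3) {p q : L2Field} {f g : E3 → E3}
    (hp : p =ᵐ[volume] f) (hq : q =ᵐ[volume] g) :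
    inner ℝ (mulOp hA (ballField R a + p)) (ballField R c + q) =
      ∫ x, inner ℝ (A x (a + f x)) (c + g x) := by
  rw [L2.inner_def]
  refine integral_congr_ae ?_
  filter_upwards [coeFn_mulOp_ballField_add hA hR a hp, Lp.coeFn_add (ballField R c) q,
    coeFn_ballField R c, hq] with x h₁ h₂ h₃ h₄
  rw [h₁, h₂, Pi.add_apply, h₃, h₄]
  by_cases hx : x ∈ ball (0 : E3) R
  · simp [hx]
  · simp [hR x hx]

end

/-! ### Mollification and approximation by test functions -/

section


open Filter Topology Convolution ContinuousLinearMap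

/-- Translations act continuously on L². The value at `t = 0` is the limit needed for mollification.
-/
theorem continuous_integral_translate_mul {g ψ : E3 → ℝ} (hg : MemLp g 2 volume)
    (hψ : MemLp ψ 2 volume) : Continuous fun t => ∫ x, g (x + t) * ψ x := by
  have hmp : ∀ t : E3, MeasurePreserving (fun x => x + t) (volume : Measure E3) volume :=
    fun t => measurePreserving_add_right volume t
  let T : E3 → C(E3, E3) := fun t => ⟨fun x => x + t, by fun_prop⟩
  have hT : Continuous T := by
    have : Continuous (ContinuousMap.curry (⟨fun p : E3 × E3 => p.2 + p.1, by fun_prop⟩ :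
      C(E3 × E3, E3))) := map_continuous _
    exact this
  have key : Continuous fun t => inner ℝ (hψ.toLp ψ)
      (Lp.compMeasurePreserving (fun x => x + t) (hmp t) (hg.toLp g)) := by
    refine continuous_const.inner ?_
    rw [continuous_iff_continuousAt]
    intro t₀
    exact Filter.Tendsto.compMeasurePreservingLp (X := E3) (Y := E3) (l := 𝓝 t₀)
      (f := fun _ => hg.toLp g) (g := T) (g₀ := T t₀) tendsto_const_nhds hT.continuousAt
      hmp (hmp t₀) (by simp)
  convert key using 2 with t
  rw [L2.inner_def]
  refine integral_congr_ae ?_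
  filter_upwards [hψ.coeFn_toLp, Lp.coeFn_compMeasurePreserving (hg.toLp g) (hmp t),
    (hmp t).quasiMeasurePreserving.ae_eq_comp hg.coeFn_toLp] with x h₁ h₂ h₃
  rw [h₁, h₂, h₃]
  simp [Function.comp]

theorem MemLp.integrable_mul_prod_translate {ρ g ψ : E3 → ℝ} (hρ : Integrable ρ)
    (hg : MemLp g 2 volume) (hψ : MemLp ψ 2 volume) :
    Integrable (fun p : E3 × E3 => ρ p.2 * g (p.1 - p.2) * ψ p.1) (volume.prod volume) := by
  -- The product is dominated through `2 |g ψ| ≤ g² + ψ²`, which leaves an L¹ convolution integrand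
  -- and a plain product.
  have h₁ := hρ.norm.convolution_integrand (lsmul ℝ ℝ) hg.integrable_sq
  have h₂ := hψ.integrable_sq.mul_prod hρ.norm
  refine (h₁.add h₂).mono ?_ ?_
  · exact (hρ.aestronglyMeasurable.comp_snd.mul
      (hg.1.comp_quasiMeasurePreserving (quasiMeasurePreserving_sub volume volume))).mul
      hψ.1.comp_fst
  · refine ae_of_all _ fun p => ?_
    simp only [Pi.add_apply, lsmul_apply, smul_eq_mul, norm_mul, Real.norm_eq_abs]
    rw [abs_of_nonneg (a := |ρ p.2| * _ + _) (by positivity)]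
    have := two_mul_le_add_sq |g (p.1 - p.2)| |ψ p.1|
    rw [sq_abs, sq_abs] at this
    nlinarith [abs_nonneg (ρ p.2), mul_nonneg (abs_nonneg (g (p.1 - p.2))) (abs_nonneg (ψ p.1))]

/-- A sequence of mollifiers. -/
def mollifier (n : ℕ) : ContDiffBump (0 : E3) where
  rIn := 1 / (2 * (n + 1))
  rOut := 1 / (n + 1)
  rIn_pos := by positivity
  rIn_lt_rOut := by
    apply one_div_lt_one_div_of_lt <;> linarith [(Nat.cast_nonneg n : (0 : ℝ) ≤ n)]

theorem mollifier_rOut_le_one (n : ℕ) : (mollifier n).rOut ≤ 1 := by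
  simp only [mollifier]
  exact div_le_one_of_le₀ (by linarith [(Nat.cast_nonneg n : (0 : ℝ) ≤ n)]) (by positivity)

/-- The mollifications of `g`. -/
def mollify (g : E3 → ℝ) (n : ℕ) : E3 → ℝ :=
  (mollifier n).normed volume ⋆[lsmul ℝ ℝ, volume] g

theorem mollify_apply (g : E3 → ℝ) (n : ℕ) (x : E3) :
    mollify g n x = ∫ t, (mollifier n).normed volume t * g (x - t) := rfl

/-- By Fubini the pairing is an average, against the mollifier, of the continuous function of the
previous lemma. Only weak convergence is obtained, and only weak convergence is used below. -/
theorem tendsto_integral_mollify_mul {g ψ : E3 → ℝ} (hg : MemLp g 2 volume)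
    (hψ : MemLp ψ 2 volume) :
    Tendsto (fun n => ∫ x, mollify g n x * ψ x) atTop (𝓝 (∫ x, g x * ψ x)) := by
  have hc := ContDiffBump.convolution_tendsto_right_of_continuous (φ := mollifier) (μ := volume)
    (l := atTop) (tendsto_one_div_add_atTop_nhds_zero_nat (𝕜 := ℝ))
    (continuous_integral_translate_mul hg hψ) 0
  simp only [add_zero] at hc
  refine hc.congr fun n => ?_
  have hρ : Integrable ((mollifier n).normed (volume : Measure E3)) :=
    (mollifier n).integrable_normed
  rw [convolution_def]
  simp only [mollify_apply, ← integral_mul_const, lsmul_apply, smul_eq_mul, zero_sub,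
    ← sub_eq_add_neg, ← integral_const_mul]
  have := integral_integral_swap (f := fun x t => (mollifier n).normed volume t * g (x - t) * ψ x)
    (MemLp.integrable_mul_prod_translate hρ hg hψ)
  rw [this]
  simp only [mul_assoc]

/-- Integration by parts against all test functions in all directions. -/
theorem HasWeakFDerivOn.integral_eq {u : E3 → ℝ} {u' : E3 → E3 →L[ℝ] ℝ}
    (h : HasWeakFDerivOn Set.univ u u') {φ : E3 → ℝ} (hφ : IsTest φ) (v : E3) :
    ∫ x, fderiv ℝ φ x v * u x = -∫ x, φ x * u' x v :=
  h.2.2 φ hφ.1 hφ.2 (Set.subset_univ _) v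

theorem isTest_mollify {w : E3 → ℝ} (hw : LocallyIntegrable w volume) (hc : HasCompactSupport w)
    (n : ℕ) : IsTest (mollify w n) :=
  ⟨HasCompactSupport.contDiff_convolution_left _ (mollifier n).hasCompactSupport_normed
    (mollifier n).contDiff_normed hw, HasCompactSupport.convolution _
    (mollifier n).hasCompactSupport_normed hc⟩

/-- The definition of the weak derivative is applied to the test function `y ↦ ρ (x - y)`. -/
theorem fderiv_mollify {w : E3 → ℝ} {w' : E3 → E3 →L[ℝ] ℝ}
    (h : HasWeakFDerivOn Set.univ w w') (n : ℕ) (x v : E3) :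
    fderiv ℝ (mollify w n) x v = mollify (fun y => w' y v) n x := by
  set ρ := (mollifier n).normed (volume : Measure E3) with hρ
  have hρs : ContDiff ℝ (⊤ : ℕ∞) ρ := (mollifier n).contDiff_normed
  have hρc : HasCompactSupport ρ := (mollifier n).hasCompactSupport_normed
  have hw : LocallyIntegrable w volume := locallyIntegrableOn_univ.mp h.1
  have hd := (HasCompactSupport.hasFDerivAt_convolution_left (μ := volume) (lsmul ℝ ℝ) hρc
    (hρs.of_le (by exact_mod_cast le_top)) hw x).fderiv
  have ht : IsTest fun y => ρ (x - y) :=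
    ⟨hρs.comp (contDiff_const.sub contDiff_id), hρc.comp_homeomorph (Homeomorph.subLeft x)⟩
  have hd' : ∀ y, fderiv ℝ (fun y => ρ (x - y)) y v = -fderiv ℝ ρ (x - y) v := fun y => by
    have h1 : HasFDerivAt (fun y : E3 => x - y) (-(ContinuousLinearMap.id ℝ E3)) y := by
      simpa using (hasFDerivAt_id y).const_sub x
    have := (hρs.differentiable (by simp) (x - y)).hasFDerivAt.comp y h1
    have e := this.fderiv
    simp only [Function.comp_def] at e
    rw [e]; simp
  have key := h.integral_eq ht v
  simp only [hd', neg_mul, integral_neg, neg_inj] at key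
  have hint : ConvolutionExistsAt (fderiv ℝ ρ) w x (ContinuousLinearMap.precompL E3 (lsmul ℝ ℝ))
      volume := (hρc.fderiv ℝ).convolutionExists_left _ (hρs.continuous_fderiv (by simp)) hw x
  rw [show mollify w n = ρ ⋆[lsmul ℝ ℝ, volume] w from rfl, hd, convolution_def,
    ContinuousLinearMap.integral_apply hint, mollify_apply, ← hρ]
  rw [← integral_sub_left_eq_self (fun t => ρ t * w' (x - t) v) volume x]
  simp only [sub_sub_cancel]
  rw [← key, ← integral_sub_left_eq_self _ volume x]
  simp [ContinuousLinearMap.precompL_apply]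

theorem mollify_eq_zero {w : E3 → ℝ} {r : ℝ} (hr : ∀ x ∉ closedBall (0 : E3) r, w x = 0) (n : ℕ)
    {x : E3} (hx : x ∉ closedBall (0 : E3) (r + 1)) : mollify w n x = 0 := by
  rw [mollify_apply]
  refine integral_eq_zero_of_ae (ae_of_all _ fun t => ?_)
  by_cases ht : t ∈ ball (0 : E3) (mollifier n).rOut
  · have : x - t ∉ closedBall (0 : E3) r := fun h => hx (by
      rw [mem_closedBall_zero_iff] at h ⊢
      rw [mem_ball_zero_iff] at ht
      have := norm_le_norm_sub_add x t
      linarith [mollifier_rOut_le_one n])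
    simp [hr _ this]
  · have : t ∉ Function.support ((mollifier n).normed (volume : Measure E3)) := by
      rwa [(mollifier n).support_normed_eq]
    simp [Function.notMem_support.mp this]

/-- The product of a weakly differentiable function with a test function. -/
theorem HasWeakFDerivOn.mul_test {u : E3 → ℝ} {u' : E3 → E3 →L[ℝ] ℝ}
    (h : HasWeakFDerivOn Set.univ u u') {χ : E3 → ℝ} (hχ : IsTest χ) :
    HasWeakFDerivOn Set.univ (fun x => χ x * u x)
      (fun x => χ x • u' x + u x • fderiv ℝ χ x) := by
  have hu : LocallyIntegrable u volume := locallyIntegrableOn_univ.mp h.1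
  have hu' : LocallyIntegrable u' volume := locallyIntegrableOn_univ.mp h.2.1
  have hχ' : Continuous (fderiv ℝ χ) := hχ.1.continuous_fderiv (by simp)
  refine ⟨locallyIntegrableOn_univ.mpr ?_, locallyIntegrableOn_univ.mpr ?_, ?_⟩
  · exact hu.continuous_smul hχ.1.continuous
  · refine (hu'.continuous_smul hχ.1.continuous).add ?_
    rw [← locallyIntegrableOn_univ] at hu ⊢
    exact hu.smul_continuousOn isOpen_univ.isLocallyClosed hχ'.continuousOn
  · intro φ hφ hφc _ v
    have hφ : IsTest φ := ⟨hφ, hφc⟩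
    have key := h.integral_eq (hφ.mul_left hχ.1) v
    have hd : ∀ x, fderiv ℝ (χ * φ) x v = χ x * fderiv ℝ φ x v + φ x * fderiv ℝ χ x v := fun x => by
      rw [fderiv_mul (hχ.differentiable x) (hφ.differentiable x)]; simp
    simp only [hd, add_mul, Pi.mul_apply] at key
    have i : ∀ ψ : E3 → ℝ, IsTest ψ → Integrable fun x => ψ x * u x := fun ψ hψ =>
      hu.integrable_smul_left_of_hasCompactSupport hψ.1.continuous hψ.2
    have i' : ∀ ψ : E3 → ℝ, IsTest ψ → Integrable fun x => ψ x * u' x v := fun ψ hψ =>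
      (hu'.integrable_smul_left_of_hasCompactSupport hψ.1.continuous hψ.2).apply_continuousLinearMap v
    have i₁ : Integrable fun x => χ x * fderiv ℝ φ x v * u x := i _ ((hφ.fderiv_apply v).mul_left hχ.1)
    have i₂ : Integrable fun x => φ x * fderiv ℝ χ x v * u x := i _ ((hχ.fderiv_apply v).mul_left hφ.1)
    have i₃ : Integrable fun x => χ x * φ x * u' x v := i' _ (hφ.mul_left hχ.1)
    rw [integral_add i₁ i₂] at key
    have e : ∀ x, φ x * (χ x * u' x v + u x * fderiv ℝ χ x v) =
      χ x * φ x * u' x v + φ x * fderiv ℝ χ x v * u x := fun x => by ring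
    have e' : ∀ x, fderiv ℝ φ x v * (χ x * u x) = χ x * fderiv ℝ φ x v * u x := fun x => by ring
    simp only [add_apply, FunLike.coe_smul, Pi.smul_apply, smul_eq_mul, e, e']
    rw [integral_add i₃ i₂]
    linarith

/-- The components of a vector field, dual to `u' x (basis vector)`. -/
theorem inner_gradient_eq_sum (φ : E3 → ℝ) (x y : E3) :
    inner ℝ y (gradient φ x) = ∑ i, fderiv ℝ φ x (EuclideanSpace.single i 1) * y i := by
  rw [real_inner_comm, inner_gradient_left]
  conv_lhs => rw [show y = ∑ i, y i • EuclideanSpace.single i (1 : ℝ) from by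
    ext j; simp [Finset.sum_apply, Pi.single_apply]]
  simp [mul_comm]

theorem clm_eq_sum (L : E3 →L[ℝ] ℝ) (y : E3) :
    L y = ∑ i, L (EuclideanSpace.single i 1) * y i := by
  conv_lhs => rw [show y = ∑ i, y i • EuclideanSpace.single i (1 : ℝ) from by
    ext j; simp [Finset.sum_apply, Pi.single_apply]]
  simp [mul_comm]

theorem MemLp.coord {f : E3 → E3} {p : ℝ≥0∞} (hf : MemLp f p volume) (i : Fin 3) :
    MemLp (fun x => f x i) p volume :=
  (EuclideanSpace.proj i : E3 →L[ℝ] ℝ).comp_memLp' hf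

/-- A square integrable function with square integrable weak derivative and compact support is the
weak limit of test functions in `H¹`. -/
theorem HasWeakFDerivOn.exists_seq_tests {w : E3 → ℝ} {w' : E3 → E3 →L[ℝ] ℝ}
    (h : HasWeakFDerivOn Set.univ w w') (hw : MemLp w 2 volume) (hw' : MemLp w' 2 volume) {r : ℝ}
    (hr : ∀ x ∉ closedBall (0 : E3) r, w x = 0) :
    ∃ φ : ℕ → E3 → ℝ, (∀ n, IsTest (φ n)) ∧
      (∀ n, ∀ x ∉ closedBall (0 : E3) (r + 1), φ n x = 0 ∧ gradient (φ n) x = 0) ∧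
      (∀ ψ : E3 → ℝ, MemLp ψ 2 volume →
        Tendsto (fun n => ∫ x, φ n x * ψ x) atTop (𝓝 (∫ x, w x * ψ x))) ∧
      ∀ ψ : E3 → E3, MemLp ψ 2 volume →
        Tendsto (fun n => ∫ x, inner ℝ (ψ x) (gradient (φ n) x)) atTop
          (𝓝 (∫ x, w' x (ψ x))) := by
  have ht := isTest_mollify (locallyIntegrableOn_univ.mp h.1)
    (HasCompactSupport.intro (isCompact_closedBall 0 r) hr)
  refine ⟨mollify w, ht, fun n x hx => ⟨mollify_eq_zero hr n hx, ?_⟩,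
    fun ψ hψ => tendsto_integral_mollify_mul hw hψ, fun ψ hψ => ?_⟩
  · have : mollify w n =ᶠ[𝓝 x] fun _ => 0 := by
      filter_upwards [isClosed_closedBall.isOpen_compl.mem_nhds hx] with y hy
      exact mollify_eq_zero hr n hy
    rw [gradient_eq]
    simp [this.fderiv_eq]
  · rw [show (fun x => w' x (ψ x)) = fun x => ∑ i, w' x (EuclideanSpace.single i 1) * ψ x i from
      funext fun x => clm_eq_sum _ _]
    simp_rw [inner_gradient_eq_sum, fderiv_mollify h]
    have hi : ∀ i, MemLp (fun x => w' x (EuclideanSpace.single i 1)) 2 volume := fun i =>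
      (ContinuousLinearMap.apply ℝ ℝ (EuclideanSpace.single i (1 : ℝ) : E3)).comp_memLp' hw'
    have hm : ∀ n i, MemLp (mollify (fun y => w' y (EuclideanSpace.single i 1)) n) 2 volume := by
      intro n i
      have := (ht n).fderiv_apply (EuclideanSpace.single i 1)
      simp only [fderiv_mollify h] at this
      exact this.1.continuous.memLp_of_hasCompactSupport this.2
    have e₀ : ∫ x, ∑ i, w' x (EuclideanSpace.single i 1) * ψ x i =
        ∑ i, ∫ x, w' x (EuclideanSpace.single i 1) * ψ x i :=
      integral_finsetSum Finset.univ fun i _ => (hi i).integrable_mul (MemLp.coord hψ i)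
    have e : ∀ n, ∫ x, ∑ i, mollify (fun y => w' y (EuclideanSpace.single i 1)) n x * ψ x i =
        ∑ i, ∫ x, mollify (fun y => w' y (EuclideanSpace.single i 1)) n x * ψ x i := fun n =>
      integral_finsetSum Finset.univ fun i _ => (hm n i).integrable_mul (MemLp.coord hψ i)
    simp_rw [e₀, e]
    exact tendsto_finsetSum _ fun i _ => tendsto_integral_mollify_mul (hi i) (MemLp.coord hψ i)

/-- Gradients of compactly supported `H¹` functions belong to the gradient space. -/
theorem HasWeakFDerivOn.mem_gradSpace {w : E3 → ℝ} {w' : E3 → E3 →L[ℝ] ℝ}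
    (h : HasWeakFDerivOn Set.univ w w') (hw : MemLp w 2 volume) (hw' : MemLp w' 2 volume) {r : ℝ}
    (hr : ∀ x ∉ closedBall (0 : E3) r, w x = 0) {p : L2Field}
    (hp : ∀ᵐ x, ∀ y, inner ℝ (p x) y = w' x y) : p ∈ gradSpace := by
  obtain ⟨φ, hφ, -, -, hlim⟩ := h.exists_seq_tests hw hw' hr
  have : CompleteSpace gradSpace := isClosed_gradSpace.completeSpace_coe
  -- A closed subspace is its own double orthogonal complement, so it is enough to pair with fields
  -- orthogonal to all gradients, and weak convergence of the mollified gradients suffices.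
  rw [← Submodule.orthogonal_orthogonal gradSpace, Submodule.mem_orthogonal]
  intro q hq
  have hz := hlim q (Lp.memLp q)
  have : ∀ n, ∫ x, inner ℝ (q x) (gradient (φ n) x) = 0 := fun n => by
    rw [← inner_eq_integral (ae_eq_refl q) (hφ n).coeFn_gradLp]
    exact Submodule.inner_left_of_mem_orthogonal (hφ n).gradLp_mem hq
  simp only [this] at hz
  rw [L2.inner_def, tendsto_nhds_unique tendsto_const_nhds hz]
  refine integral_congr_ae ?_
  filter_upwards [hp] with x hx
  rw [real_inner_comm, hx]

end

section


open Filter Topology ContinuousLinearMap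

/-! ### Potentials of elements of the gradient space -/

theorem norm_gradient (φ : E3 → ℝ) (x : E3) : ‖gradient φ x‖ = ‖fderiv ℝ φ x‖ :=
  LinearIsometryEquiv.norm_map _ _

theorem IsTest.memLp {φ : E3 → ℝ} (hφ : IsTest φ) {p : ℝ≥0∞} : MemLp φ p volume :=
  hφ.1.continuous.memLp_of_hasCompactSupport hφ.2

/-- Gagliardo–Nirenberg–Sobolev in dimension three: `1/6 = 1/2 - 1/3`. -/
theorem exists_sobolev_const : ∃ C : NNReal, ∀ φ : E3 → ℝ, IsTest φ →
    eLpNorm φ 6 volume ≤ C * eLpNorm (gradient φ) 2 volume := by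
  refine ⟨SNormLESNormFDerivOfEqConst ℝ (volume : Measure E3) 2, fun φ hφ => ?_⟩
  have := eLpNorm_le_eLpNorm_fderiv_of_eq (volume : Measure E3) (u := φ) (p := 2) (p' := 6)
    (hφ.1.of_le (by exact_mod_cast le_top)) hφ.2 (by norm_num) (by simp) (by
      rw [finrank_euclideanSpace_fin]; norm_num)
  rw [eLpNorm_congr_norm_ae (g := gradient φ) (ae_of_all _ fun x => (norm_gradient φ x).symm)] at this
  exact_mod_cast this

theorem tendsto_integral_mul_of_tendsto_toLp {p q : ℝ≥0∞} [Fact (1 ≤ p)] [Fact (1 ≤ q)]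
    [p.HolderConjugate q] {φ : ℕ → E3 → ℝ} (hφ : ∀ n, MemLp (φ n) q volume)
    {F : Lp ℝ q (volume : Measure E3)} (h : Tendsto (fun n => (hφ n).toLp (φ n)) atTop (𝓝 F))
    {ψ : E3 → ℝ} (hψ : MemLp ψ p volume) :
    Tendsto (fun n => ∫ x, ψ x * φ n x) atTop (𝓝 (∫ x, ψ x * F x)) := by
  have := ((ContinuousLinearMap.mul ℝ ℝ).lpPairing volume p q (hψ.toLp ψ)).continuous.tendsto F
  have := this.comp h
  convert this using 1
  · ext n
    simp only [Function.comp, lpPairing_eq_integral]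
    refine integral_congr_ae ?_
    filter_upwards [hψ.coeFn_toLp, (hφ n).coeFn_toLp] with x h₁ h₂
    simp [h₁, h₂]
  · congr 1
    rw [lpPairing_eq_integral]
    refine integral_congr_ae ?_
    filter_upwards [hψ.coeFn_toLp] with x h₁
    simp [h₁]

/-- By the Sobolev inequality, convergence of the gradients in L² makes the test functions Cauchy in
L⁶. Membership in L⁶ is also the normalization at infinity: it is used below to show that the
potential vanishes there in the mean. -/
theorem exists_potential {p : L2Field} (hp : p ∈ gradSpace) :
    ∃ w : E3 → ℝ, MemLp w 6 volume ∧ HasWeakFDerivOn Set.univ w (fun x => innerSL ℝ (p x)) := by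
  obtain ⟨C, hC⟩ := exists_sobolev_const
  obtain ⟨φ, hφ, hlim⟩ := exists_seq_gradLp hp
  have : Fact ((1 : ℝ≥0∞) ≤ 6) := ⟨by norm_num⟩
  let f : ℕ → Lp ℝ 6 (volume : Measure E3) := fun n => (hφ n).memLp.toLp (φ n)
  have hle : ∀ m n, dist (f m) (f n) ≤ C * dist (hφ m).gradLp (hφ n).gradLp := fun m n => by
    rw [Lp.dist_def, Lp.dist_def, ← ENNReal.coe_toReal C, ← ENNReal.toReal_mul]
    refine ENNReal.toReal_mono (ENNReal.mul_ne_top (by simp) (Lp.eLpNorm_ne_top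
      ((hφ m).gradLp - (hφ n).gradLp) |> fun h => ?_)) ?_
    · rwa [eLpNorm_congr_ae (Lp.coeFn_sub _ _)] at h
    · have h₁ : (f m : E3 → ℝ) - (f n : E3 → ℝ) =ᵐ[volume] φ m - φ n :=
        (hφ m).memLp.coeFn_toLp.sub (hφ n).memLp.coeFn_toLp
      have h₂ : ((hφ m).gradLp : E3 → E3) - ((hφ n).gradLp : E3 → E3) =ᵐ[volume] gradient (φ m - φ n) := by
        have : gradient (φ m - φ n) = gradient (φ m) - gradient (φ n) := by
          rw [sub_eq_add_neg, ← neg_one_smul ℝ (φ n), (hφ m).gradient_add ((hφ n).const_smul _),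
            (hφ n).gradient_const_smul, neg_one_smul, ← sub_eq_add_neg]
        rw [this]
        exact (hφ m).coeFn_gradLp.sub (hφ n).coeFn_gradLp
      rw [eLpNorm_congr_ae h₁, eLpNorm_congr_ae h₂]
      exact hC _ ((hφ m).sub (hφ n))
  have hcau : CauchySeq f := by
    have h0 := hlim.cauchySeq
    rw [cauchySeq_iff_tendsto_dist_atTop_0] at h0 ⊢
    have := h0.const_mul (C : ℝ)
    rw [mul_zero] at this
    exact squeeze_zero (fun _ => dist_nonneg) (fun n => hle n.1 n.2) this
  obtain ⟨F, hF⟩ := cauchySeq_tendsto_of_complete hcau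
  have h16 : (1 : ℝ≥0∞) ≤ 6 := by norm_num
  refine ⟨F, Lp.memLp F, locallyIntegrableOn_univ.mpr ((Lp.memLp F).locallyIntegrable h16),
    locallyIntegrableOn_univ.mpr ?_, fun ψ hψ hψc _ v => ?_⟩
  · exact ((innerSL ℝ : E3 →L[ℝ] E3 →L[ℝ] ℝ).comp_memLp' (Lp.memLp p)).locallyIntegrable
      (by norm_num)
  · have hψ : IsTest ψ := ⟨hψ, hψc⟩
    have : Fact ((1 : ℝ≥0∞) ≤ ENNReal.conjExponent 6) := ⟨by simp [ENNReal.conjExponent]⟩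
    have : (ENNReal.conjExponent 6).HolderConjugate 6 :=
      (ENNReal.HolderConjugate.conjExponent h16).symm
    have l₁ := tendsto_integral_mul_of_tendsto_toLp (p := ENNReal.conjExponent 6)
      (fun n => (hφ n).memLp) hF (hψ.fderiv_apply v).memLp
    have hv : MemLp (fun x => ψ x • v) 2 volume :=
      (hψ.1.continuous.smul continuous_const).memLp_of_hasCompactSupport hψ.2.smul_right
    have l₂ : Tendsto (fun n => ∫ x, ψ x * fderiv ℝ (φ n) x v) atTop
        (𝓝 (∫ x, ψ x * inner ℝ (p x) v)) := by
      have := (hlim.inner (𝕜 := ℝ) (tendsto_const_nhds (x := hv.toLp _)))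
      convert this using 2 with n
      · rw [inner_eq_integral (hφ n).coeFn_gradLp hv.coeFn_toLp]
        simp [inner_gradient_left]
      · rw [inner_eq_integral (ae_eq_refl p) hv.coeFn_toLp]
        simp [real_inner_smul_right]
    have e : ∀ n, ∫ x, fderiv ℝ ψ x v * φ n x = -∫ x, ψ x * fderiv ℝ (φ n) x v := fun n => by
      rw [integral_mul_fderiv_eq_neg_fderiv_mul_of_integrable (v := v) (f := ψ) (g := φ n), neg_neg]
      · exact ((hφ n).mul_left (hψ.fderiv_apply v).1).integrable
      · exact (((hφ n).fderiv_apply v).mul_left hψ.1).integrable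
      · exact ((hφ n).mul_left hψ.1).integrable
      · exact fun x _ => hψ.differentiable x
      · exact fun x _ => (hφ n).differentiable x
    simp only [e] at l₁
    simpa using tendsto_nhds_unique l₁ l₂.neg

/-! ### Vanishing means and behaviour at infinity -/

/-- The mean of `|w|` over large balls tends to zero. -/
def HasVanishingMeans (w : E3 → ℝ) : Prop :=
  ∀ x : E3, Tendsto (fun S : ℝ => (S ^ 3)⁻¹ * ∫ y in ball x S, |w y|) atTop (𝓝 0)

/-- Hölder bounds the integral of `|w|` over a ball of radius `S` by a multiple of `(S³)^(5/6)`,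
which is of lower order than `S³`. -/
theorem MemLp.hasVanishingMeans {w : E3 → ℝ} (hw : MemLp w 6 volume) : HasVanishingMeans w := by
  intro x
  set V := (volume (ball (0 : E3) 1)).toReal with hV
  set c := (eLpNorm w 6 volume).toReal * V ^ (5 / 6 : ℝ) with hc
  have hvol : ∀ S : ℝ, 0 < S → volume (ball x S) = ENNReal.ofReal (S ^ 3 * V) := fun S hS => by
    rw [Measure.addHaar_ball _ _ hS.le, finrank_euclideanSpace_fin, ENNReal.ofReal_mul (by positivity),
      ENNReal.ofReal_toReal measure_ball_lt_top.ne]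
  have hb : ∀ S : ℝ, 0 < S → ∫ y in ball x S, |w y| ≤ c * (S ^ (3 : ℕ)) ^ (5 / 6 : ℝ) := by
    intro S hS
    have hw1 := (hw.restrict (ball x S))
    have h1 := eLpNorm_le_eLpNorm_mul_rpow_measure_univ (p := 1) (q := 6) (by norm_num)
      hw1.1
    have h2 : ∫ y in ball x S, |w y| = (eLpNorm w 1 (volume.restrict (ball x S))).toReal := by
      rw [eLpNorm_one_eq_lintegral_enorm, ← integral_norm_eq_lintegral_enorm hw1.1]
      rfl
    have h3 : eLpNorm w 6 (volume.restrict (ball x S)) ≤ eLpNorm w 6 volume :=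
      eLpNorm_mono_measure _ Measure.restrict_le_self
    rw [h2, hc]
    rw [Measure.restrict_apply_univ, hvol S hS, ENNReal.ofReal_rpow_of_nonneg (by positivity)
      (by norm_num)] at h1
    have h4 := ENNReal.toReal_mono (ENNReal.mul_ne_top hw.2.ne ENNReal.ofReal_ne_top)
      (h1.trans (mul_le_mul_left h3 _))
    rw [ENNReal.toReal_mul, ENNReal.toReal_ofReal (by positivity)] at h4
    refine h4.trans (le_of_eq ?_)
    have : (1 / ENNReal.toReal 1 - 1 / ENNReal.toReal 6 : ℝ) = 5 / 6 := by norm_num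
    rw [this, Real.mul_rpow (by positivity) (by positivity)]
    ring
  have hz : Tendsto (fun S : ℝ => c * (S ^ 3) ^ (-(1 / 6) : ℝ)) atTop (𝓝 0) := by
    rw [← mul_zero c]
    exact ((tendsto_rpow_neg_atTop (by norm_num)).comp
      (tendsto_pow_atTop (by norm_num))).const_mul c
  refine tendsto_of_tendsto_of_tendsto_of_le_of_le' tendsto_const_nhds hz ?_ ?_
  · filter_upwards [eventually_gt_atTop 0] with S hS
    have : 0 ≤ ∫ y in ball x S, |w y| := integral_nonneg fun _ => abs_nonneg _
    positivity
  · filter_upwards [eventually_gt_atTop 0] with S hS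
    have hS3 : (0 : ℝ) < S ^ 3 := by positivity
    calc (S ^ 3)⁻¹ * ∫ y in ball x S, |w y| ≤ (S ^ 3)⁻¹ * (c * (S ^ (3 : ℕ)) ^ (5 / 6 : ℝ)) := by
          gcongr; exact hb S hS
      _ = c * ((S ^ 3) ^ (-1 : ℝ) * (S ^ 3) ^ (5 / 6 : ℝ)) := by
          rw [Real.rpow_neg_one]; ring
      _ = c * (S ^ 3) ^ (-(1 / 6) : ℝ) := by
          rw [← Real.rpow_add hS3]; norm_num

theorem eventually_aeInfinity {P : E3 → Prop} :
    (∀ᶠ x in aeInfinity, P x) ↔ ∃ R : ℝ, ∀ᵐ x, R ≤ ‖x‖ → P x := by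
  rw [aeInfinity, Filter.eventually_iff, Filter.mem_inf_iff_superset]
  constructor
  · rintro ⟨s, hs, t, ht, h⟩
    obtain ⟨R, -, hR⟩ := hasBasis_cobounded_norm.mem_iff.mp hs
    refine ⟨R, ?_⟩
    filter_upwards [ht] with x hx hRx
    exact h ⟨hR hRx, hx⟩
  · rintro ⟨R, hR⟩
    exact ⟨_, hasBasis_cobounded_norm.mem_of_mem (i := R) trivial, _, hR, fun x hx => hx.2 hx.1⟩

theorem isBigO_aeInfinity {f g : E3 → ℝ} :
    f =O[aeInfinity] g ↔ ∃ C R : ℝ, ∀ᵐ x, R ≤ ‖x‖ → |f x| ≤ C * |g x| := by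
  simp only [Asymptotics.isBigO_iff, eventually_aeInfinity, Real.norm_eq_abs]

/-- Outside a large fixed ball `|w|` is below any prescribed `η`, while the integral over that ball
is a constant, which is negligible against `S³`. This serves for `u - a · x` with `u` an arbitrary
solution. -/
theorem hasVanishingMeans_of_isBigO {w : E3 → ℝ} (hw : LocallyIntegrable w volume)
    (h : w =O[aeInfinity] fun x => (‖x‖ ^ 2)⁻¹) : HasVanishingMeans w := by
  obtain ⟨C, R, hC⟩ := isBigO_aeInfinity.mp h
  intro x
  set V := (volume (ball (0 : E3) 1)).toReal with hV
  have hV0 : 0 ≤ V := ENNReal.toReal_nonneg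
  have hvol : ∀ S : ℝ, 0 < S → volume.real (ball x S) = S ^ 3 * V := fun S hS => by
    rw [measureReal_def, Measure.addHaar_ball _ _ hS.le, finrank_euclideanSpace_fin,
      ENNReal.toReal_mul, ENNReal.toReal_ofReal (by positivity)]
  rw [Metric.tendsto_nhds]
  intro ε hε
  set η := ε / (2 * (V + 1)) with hη
  have hη0 : 0 < η := by positivity
  obtain ⟨ρ, hρ1, hρR, hρ⟩ : ∃ ρ : ℝ, 0 < ρ ∧ R ≤ ρ ∧ |C| / η ≤ ρ ^ 2 := by
    have h1 : Tendsto (fun ρ : ℝ => ρ ^ 2) atTop atTop := tendsto_pow_atTop (by norm_num)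
    exact ((eventually_gt_atTop 0).and ((eventually_ge_atTop R).and
      (h1.eventually_ge_atTop _))).exists
  have hpt : ∀ᵐ y, |w y| ≤ (ball (0 : E3) ρ).indicator (fun y => |w y|) y + η := by
    filter_upwards [hC] with y hy
    by_cases hyρ : y ∈ ball (0 : E3) ρ
    · simp [hyρ, hη0.le]
    · rw [Set.indicator_of_notMem hyρ, zero_add]
      rw [mem_ball_zero_iff, not_lt] at hyρ
      have hy0 : 0 < ‖y‖ := hρ1.trans_le hyρ
      refine (hy (hρR.trans hyρ)).trans ?_
      rw [abs_of_pos (by positivity), ← div_eq_mul_inv, div_le_iff₀ (by positivity)]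
      rw [div_le_iff₀ hη0] at hρ
      have := pow_le_pow_left₀ hρ1.le hyρ 2
      nlinarith [le_abs_self C]
  have hi : ∀ r (z : E3), IntegrableOn (fun y => |w y|) (ball z r) := fun r z =>
    (hw.integrableOn_isCompact (isCompact_closedBall z r)).mono_set ball_subset_closedBall |>.abs
  set K := ∫ y in ball (0 : E3) ρ, |w y| with hK
  have hb : ∀ S : ℝ, 0 < S → ∫ y in ball x S, |w y| ≤ K + η * (S ^ 3 * V) := by
    intro S hS
    have hind : Integrable ((ball (0 : E3) ρ).indicator (fun y => |w y|)) :=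
      (hi ρ 0).integrable_indicator measurableSet_ball
    have hcst : IntegrableOn (fun _ : E3 => η) (ball x S) :=
      integrableOn_const measure_ball_lt_top.ne
    calc ∫ y in ball x S, |w y|
        ≤ ∫ y in ball x S, ((ball (0 : E3) ρ).indicator (fun y => |w y|) y + η) :=
          integral_mono_ae (hi S x) (hind.integrableOn.add hcst) (ae_restrict_of_ae hpt)
      _ = (∫ y in ball x S, (ball (0 : E3) ρ).indicator (fun y => |w y|) y) + η * (S ^ 3 * V) := by
          rw [integral_add hind.integrableOn hcst, setIntegral_const, hvol S hS, smul_eq_mul]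
          ring
      _ ≤ K + η * (S ^ 3 * V) := by
          gcongr
          rw [hK, ← integral_indicator (s := ball (0 : E3) ρ) measurableSet_ball]
          exact setIntegral_le_integral hind
            (ae_of_all _ fun y => Set.indicator_nonneg (fun _ _ => abs_nonneg _) _)
  have hz : Tendsto (fun S : ℝ => (S ^ 3)⁻¹ * K) atTop (𝓝 0) := by
    rw [← zero_mul K]
    exact ((tendsto_pow_atTop (α := ℝ) (n := 3) (by norm_num)).inv_tendsto_atTop).mul_const K
  filter_upwards [eventually_gt_atTop 0, hz.eventually_lt_const (half_pos hε)] with S hS hS'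
  have h0 : 0 ≤ ∫ y in ball x S, |w y| := integral_nonneg fun _ => abs_nonneg _
  have hS3 : (0 : ℝ) < S ^ 3 := by positivity
  rw [Real.dist_eq, sub_zero, abs_of_nonneg (by positivity)]
  calc (S ^ 3)⁻¹ * ∫ y in ball x S, |w y| ≤ (S ^ 3)⁻¹ * (K + η * (S ^ 3 * V)) := by
        gcongr; exact hb S hS
    _ = (S ^ 3)⁻¹ * K + η * V := by field_simp
    _ < ε / 2 + ε / 2 := by
        have : η * V ≤ ε / 2 := by
          rw [hη, div_mul_eq_mul_div, div_le_div_iff₀ (by positivity) (by norm_num)]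
          nlinarith
        linarith
    _ = ε := by ring

end

section


open Filter Topology ContinuousLinearMap

/-! ### A regularized Newtonian kernel -/

/-- A smooth function on the line which equals `t ↦ t ^ (-1/2)` for `t ≥ 1`. -/
def newtonProfile (t : ℝ) : ℝ := Real.smoothTransition (2 * t - 1) * t ^ (-(1 / 2) : ℝ)

theorem contDiff_newtonProfile : ContDiff ℝ (⊤ : ℕ∞) newtonProfile := by
  rw [contDiff_iff_contDiffAt]
  intro t
  rcases lt_or_ge 0 t with ht | ht
  · refine ContDiffAt.mul ?_ (Real.contDiffAt_rpow_const_of_ne ht.ne')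
    exact (Real.smoothTransition.contDiff.comp
      ((contDiff_const.mul contDiff_id).sub contDiff_const)).contDiffAt
  · have : newtonProfile =ᶠ[𝓝 t] fun _ => 0 := by
      filter_upwards [gt_mem_nhds (show t < 1 / 2 by linarith)] with y hy
      rw [newtonProfile, Real.smoothTransition.zero_of_nonpos (by linarith), zero_mul]
    exact contDiffAt_const.congr_of_eventuallyEq this

theorem newtonProfile_eq {t : ℝ} (ht : 1 ≤ t) : newtonProfile t = t ^ (-(1 / 2) : ℝ) := by
  rw [newtonProfile, Real.smoothTransition.one_of_one_le (by linarith), one_mul]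

theorem contDiff_deriv_newtonProfile : ContDiff ℝ (⊤ : ℕ∞) (deriv newtonProfile) :=
  (contDiff_infty_iff_deriv.mp contDiff_newtonProfile).2

theorem contDiff_deriv_deriv_newtonProfile : ContDiff ℝ (⊤ : ℕ∞) (deriv (deriv newtonProfile)) :=
  (contDiff_infty_iff_deriv.mp contDiff_deriv_newtonProfile).2

/-- Near `t = 1` the explicit formula for the profile holds on one side only; its derivatives at the
endpoint are obtained by continuity. -/
theorem eq_of_eq_Ioi {f g : ℝ → ℝ} (hf : ContinuousAt f 1) (hg : ContinuousAt g 1)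
    (h : ∀ t, 1 < t → f t = g t) {t : ℝ} (ht : 1 ≤ t) : f t = g t := by
  rcases ht.eq_or_lt with rfl | ht
  · have h₁ : Tendsto f (𝓝[>] 1) (𝓝 (f 1)) := hf.mono_left nhdsWithin_le_nhds
    have h₂ : Tendsto g (𝓝[>] 1) (𝓝 (g 1)) := hg.mono_left nhdsWithin_le_nhds
    refine tendsto_nhds_unique h₁ (h₂.congr' ?_)
    filter_upwards [self_mem_nhdsWithin] with t ht using (h t ht).symm
  · exact h t ht

theorem deriv_newtonProfile_eq {t : ℝ} (ht : 1 ≤ t) :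
    deriv newtonProfile t = -(1 / 2) * t ^ (-(3 / 2) : ℝ) := by
  refine eq_of_eq_Ioi (g := fun t => -(1 / 2) * t ^ (-(3 / 2) : ℝ))
    contDiff_deriv_newtonProfile.continuous.continuousAt
    (continuousAt_const.mul (Real.continuousAt_rpow_const _ _ (Or.inl one_ne_zero)))
    (fun t ht => ?_) ht
  have : newtonProfile =ᶠ[𝓝 t] fun t => t ^ (-(1 / 2) : ℝ) := by
    filter_upwards [lt_mem_nhds ht] with y hy using newtonProfile_eq hy.le
  rw [this.deriv_eq, (Real.hasDerivAt_rpow_const (Or.inl (by linarith))).deriv]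
  norm_num

theorem deriv_deriv_newtonProfile_eq {t : ℝ} (ht : 1 ≤ t) :
    deriv (deriv newtonProfile) t = 3 / 4 * t ^ (-(5 / 2) : ℝ) := by
  refine eq_of_eq_Ioi (g := fun t => 3 / 4 * t ^ (-(5 / 2) : ℝ))
    contDiff_deriv_deriv_newtonProfile.continuous.continuousAt
    (continuousAt_const.mul (Real.continuousAt_rpow_const _ _ (Or.inl one_ne_zero)))
    (fun t ht => ?_) ht
  have : deriv newtonProfile =ᶠ[𝓝 t] fun t => -(1 / 2) * t ^ (-(3 / 2) : ℝ) := by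
    filter_upwards [lt_mem_nhds ht] with y hy using deriv_newtonProfile_eq hy.le
  rw [this.deriv_eq, deriv_const_mul_field,
    (Real.hasDerivAt_rpow_const (Or.inl (by linarith))).deriv]
  norm_num
  ring

/-- The Laplacian of `y ↦ newtonProfile (|y|²)` is `newtonLaplacian (|y|²)`. -/
def newtonLaplacian (t : ℝ) : ℝ :=
  6 * deriv newtonProfile t + 4 * t * deriv (deriv newtonProfile) t

theorem continuous_newtonLaplacian : Continuous newtonLaplacian :=
  (continuous_const.mul contDiff_deriv_newtonProfile.continuous).add
    ((continuous_const.mul continuous_id).mul contDiff_deriv_deriv_newtonProfile.continuous)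

/-- This is the harmonicity of `|y|⁻¹` away from the origin: `6 · (-1/2) + 4 · (3/4) = 0`. -/
theorem newtonLaplacian_eq_zero {t : ℝ} (ht : 1 ≤ t) : newtonLaplacian t = 0 := by
  rw [newtonLaplacian, deriv_newtonProfile_eq ht, deriv_deriv_newtonProfile_eq ht]
  have : t * t ^ (-(5 / 2) : ℝ) = t ^ (-(3 / 2) : ℝ) := by
    nth_rw 1 [← Real.rpow_one t]
    rw [← Real.rpow_add (by linarith)]; norm_num
  linear_combination 3 * this

/-- The kernel `|y|⁻¹` regularized at scale `δ`. -/
def newtonKernel (δ : ℝ) (y : E3) : ℝ := δ⁻¹ * newtonProfile (‖y‖ ^ 2 / δ ^ 2)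

variable {δ : ℝ} (x y v : E3)

theorem contDiff_newtonKernel (δ : ℝ) : ContDiff ℝ (⊤ : ℕ∞) (newtonKernel δ) :=
  contDiff_const.mul (contDiff_newtonProfile.comp ((contDiff_norm_sq ℝ).div_const _))

/-- Beyond both scales each kernel is `|y|⁻¹`. Hence the difference of two regularized kernels has
compact support and can be used as a test function. -/
theorem newtonKernel_eq {δ' : ℝ} (hδ : 0 < δ) (hδ' : 0 < δ') {y : E3} (h : δ ≤ ‖y‖)
    (h' : δ' ≤ ‖y‖) : newtonKernel δ y = newtonKernel δ' y := by
  have key : ∀ δ : ℝ, 0 < δ → δ ≤ ‖y‖ → newtonKernel δ y = ‖y‖⁻¹ := fun δ hδ h => by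
    have hy : 0 < ‖y‖ := hδ.trans_le h
    rw [newtonKernel, newtonProfile_eq ((one_le_div (by positivity)).mpr (by gcongr)), ← div_pow,
      Real.rpow_neg (by positivity), ← Real.sqrt_eq_rpow, Real.sqrt_sq (by positivity)]
    field_simp
  rw [key δ hδ h, key δ' hδ' h']

theorem hasFDerivAt_scaled_norm_sq (δ : ℝ) (y : E3) :
    HasFDerivAt (fun y : E3 => ‖y‖ ^ 2 / δ ^ 2) ((2 / δ ^ 2) • innerSL ℝ y) y := by
  have := ((hasStrictFDerivAt_norm_sq y).hasFDerivAt (𝕜 := ℝ)).mul_const ((δ ^ 2)⁻¹)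
  simp only [div_eq_mul_inv]
  refine this.congr_fderiv ?_
  ext z
  simp
  ring

theorem fderiv_newtonKernel :
    fderiv ℝ (newtonKernel δ) y v =
      2 * (δ ^ 3)⁻¹ * deriv newtonProfile (‖y‖ ^ 2 / δ ^ 2) * inner ℝ y v := by
  have h1 := ((contDiff_newtonProfile.differentiable (by simp)
    (‖y‖ ^ 2 / δ ^ 2)).hasDerivAt.comp_hasFDerivAt y (hasFDerivAt_scaled_norm_sq δ y)).const_mul δ⁻¹
  have h2 : HasFDerivAt (newtonKernel δ) _ y := h1
  rw [h2.fderiv]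
  simp only [FunLike.coe_smul, Pi.smul_apply, smul_eq_mul, innerSL_apply_apply]
  ring

theorem fderiv_fderiv_newtonKernel :
    fderiv ℝ (fun y => fderiv ℝ (newtonKernel δ) y v) y v =
      (δ ^ 3)⁻¹ * (2 * deriv newtonProfile (‖y‖ ^ 2 / δ ^ 2) * ‖v‖ ^ 2 +
        4 * deriv (deriv newtonProfile) (‖y‖ ^ 2 / δ ^ 2) * (inner ℝ y v) ^ 2 / δ ^ 2) := by
  simp only [fderiv_newtonKernel]
  have h1 := ((contDiff_deriv_newtonProfile.differentiable (by simp)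
    (‖y‖ ^ 2 / δ ^ 2)).hasDerivAt.comp_hasFDerivAt y (hasFDerivAt_scaled_norm_sq δ y)).const_mul
      (2 * (δ ^ 3)⁻¹)
  have h2 : HasFDerivAt (fun y : E3 => inner ℝ y v) (innerSL ℝ v) y := by
    have := (innerSL ℝ v : E3 →L[ℝ] ℝ).hasFDerivAt (x := y)
    simp only [real_inner_comm v]
    exact this
  have h3 := h1.mul h2
  have h4 : HasFDerivAt (fun y : E3 => 2 * (δ ^ 3)⁻¹ * deriv newtonProfile (‖y‖ ^ 2 / δ ^ 2)
    * inner ℝ y v) _ y := h3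
  rw [h4.fderiv]
  simp only [FunLike.coe_smul, Pi.smul_apply, smul_eq_mul, innerSL_apply_apply, add_apply,
    Function.comp, real_inner_self_eq_norm_sq]
  ring

/-- The coordinate Laplacian. -/
def lap (φ : E3 → ℝ) (x : E3) : ℝ :=
  ∑ i : Fin 3, fderiv ℝ (fun y => fderiv ℝ φ y (EuclideanSpace.single i 1)) x
    (EuclideanSpace.single i 1)

theorem lap_newtonKernel :
    lap (newtonKernel δ) y = (δ ^ 3)⁻¹ * newtonLaplacian (‖y‖ ^ 2 / δ ^ 2) := by
  simp only [lap, fderiv_fderiv_newtonKernel]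
  rw [← Finset.mul_sum]
  congr 1
  have h : ∑ i : Fin 3, (y i) ^ 2 = ‖y‖ ^ 2 := (EuclideanSpace.real_norm_sq_eq y).symm
  rw [Fin.sum_univ_three] at h ⊢
  simp only [PiLp.norm_single, EuclideanSpace.inner_single_right, newtonLaplacian]
  rw [← h]
  simp
  ring

theorem fderiv_newtonKernel_of_le (hδ : 0 < δ) {y : E3} (h : δ ≤ ‖y‖) :
    fderiv ℝ (newtonKernel δ) y v = -(‖y‖ ^ 3)⁻¹ * inner ℝ y v := by
  have hy : 0 < ‖y‖ := hδ.trans_le h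
  rw [fderiv_newtonKernel, deriv_newtonProfile_eq ((one_le_div (by positivity)).mpr (by gcongr)),
    ← div_pow]
  have : ((‖y‖ / δ) ^ 2) ^ (-(3 / 2) : ℝ) = ((‖y‖ / δ) ^ 3)⁻¹ := by
    rw [← Real.rpow_natCast, ← Real.rpow_mul (by positivity), ← Real.rpow_natCast _ 3,
      ← Real.rpow_neg (by positivity)]
    norm_num
  rw [this]
  field_simp

/-- The integral of the Laplacian of the regularized kernel. -/
def newtonConst : ℝ := ∫ y : E3, newtonLaplacian (‖y‖ ^ 2)

/-- In polar coordinates the integrand `r² newtonLaplacian (r²)` is the derivative of `2 r³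
newtonProfile'(r²)`, which vanishes at `0` and equals `-1` at `1`. The constant is therefore minus
the area of the unit sphere, but only its being nonzero matters. -/
theorem newtonConst_ne_zero : newtonConst ≠ 0 := by
  have h := integral_fun_norm_addHaar (volume : Measure E3) (fun r => newtonLaplacian (r ^ 2))
  have h1 : ∫ r in Set.Ioi (0 : ℝ), r ^ 2 * newtonLaplacian (r ^ 2) = -1 := by
    have hd : ∀ r : ℝ, HasDerivAt (fun r => 2 * r ^ 3 * deriv newtonProfile (r ^ 2))
        (r ^ 2 * newtonLaplacian (r ^ 2)) r := fun r => by
      have h1 := ((hasDerivAt_id r).pow 3).const_mul 2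
      have h2 := (contDiff_deriv_newtonProfile.differentiable (by simp) (r ^ 2)).hasDerivAt.comp r
        ((hasDerivAt_id r).pow 2)
      have h3 := h1.mul h2
      refine HasDerivAt.congr_deriv h3 ?_
      simp [newtonLaplacian]
      ring
    have h2 : ∫ r in (0 : ℝ)..1, r ^ 2 * newtonLaplacian (r ^ 2) = -1 := by
      rw [intervalIntegral.integral_eq_sub_of_hasDerivAt (fun r _ => hd r)
        (((continuous_pow 2).mul (continuous_newtonLaplacian.comp
          (continuous_pow 2))).intervalIntegrable _ _)]
      rw [deriv_newtonProfile_eq (by norm_num)]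
      norm_num
    rw [← h2, intervalIntegral.integral_of_le zero_le_one]
    refine setIntegral_eq_of_subset_of_forall_sdiff_eq_zero measurableSet_Ioi
      Set.Ioc_subset_Ioi_self (fun r hr => ?_)
    have : 1 < r := by
      by_contra h
      exact hr.2 ⟨hr.1, not_lt.mp h⟩
    rw [newtonLaplacian_eq_zero (one_le_pow₀ this.le), mul_zero]
  rw [newtonConst, h, finrank_euclideanSpace_fin]
  simp only [smul_eq_mul, Nat.add_one_sub_one]
  rw [h1]
  have : 0 < (volume : Measure E3).real (ball 0 1) :=
    ENNReal.toReal_pos (measure_ball_pos _ _ one_pos).ne' measure_ball_lt_top.ne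
  simp [this.ne']

end

section


open Filter Topology ContinuousLinearMap

/-! ### Decay of functions that are harmonic outside a ball -/

theorem gradient_apply (φ : E3 → ℝ) (x : E3) (i : Fin 3) :
    gradient φ x i = fderiv ℝ φ x (EuclideanSpace.single i 1) := by
  rw [← inner_gradient_left, EuclideanSpace.inner_single_right]
  simp

theorem HasWeakFDerivOn.integral_lap_mul {w : E3 → ℝ} {w' : E3 → E3 →L[ℝ] ℝ}
    (h : HasWeakFDerivOn Set.univ w w') {φ : E3 → ℝ} (hφ : IsTest φ) :
    ∫ x, lap φ x * w x = -∫ x, w' x (gradient φ x) := by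
  have hw : LocallyIntegrable w volume := locallyIntegrableOn_univ.mp h.1
  have hw' : LocallyIntegrable w' volume := locallyIntegrableOn_univ.mp h.2.1
  have e₁ : ∀ x, w' x (gradient φ x) = ∑ i : Fin 3, fderiv ℝ φ x (EuclideanSpace.single i 1) *
      w' x (EuclideanSpace.single i 1) := fun x => by
    rw [clm_eq_sum]
    exact Finset.sum_congr rfl fun i _ => by rw [gradient_apply, mul_comm]
  have i₁ : ∀ i : Fin 3, Integrable fun x => fderiv ℝ φ x (EuclideanSpace.single i 1) *
      w' x (EuclideanSpace.single i 1) := fun i =>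
    (hw'.integrable_smul_left_of_hasCompactSupport (hφ.fderiv_apply _).1.continuous
      (hφ.fderiv_apply _).2).apply_continuousLinearMap _
  have i₂ : ∀ i : Fin 3, Integrable fun x => fderiv ℝ (fun y => fderiv ℝ φ y
      (EuclideanSpace.single i 1)) x (EuclideanSpace.single i 1) * w x := fun i =>
    hw.integrable_smul_left_of_hasCompactSupport
      ((hφ.fderiv_apply _).fderiv_apply _).1.continuous ((hφ.fderiv_apply _).fderiv_apply _).2
  simp_rw [e₁, lap, Finset.sum_mul]
  rw [integral_finsetSum _ fun i _ => i₁ i, integral_finsetSum _ fun i _ => i₂ i,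
    ← Finset.sum_neg_distrib]
  exact Finset.sum_congr rfl fun i _ => h.integral_eq (hφ.fderiv_apply _) _

theorem exists_bound_newtonLaplacian : ∃ C, 0 ≤ C ∧ ∀ t, 0 ≤ t → |newtonLaplacian t| ≤ C := by
  obtain ⟨C, hC⟩ := (isCompact_Icc (a := (0 : ℝ)) (b := 1)).exists_bound_of_continuousOn
    continuous_newtonLaplacian.continuousOn
  refine ⟨C, (norm_nonneg _).trans (hC 0 (by simp)), fun t ht => ?_⟩
  rcases le_total t 1 with h | h
  · exact hC t ⟨ht, h⟩
  · rw [newtonLaplacian_eq_zero h, abs_zero]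
    exact (norm_nonneg _).trans (hC 0 (by simp))

/-- The approximate identity at scale `δ` (up to the factor `newtonConst`) centered at `x`. -/
def newtonBump (δ : ℝ) (x y : E3) : ℝ := (δ ^ 3)⁻¹ * newtonLaplacian (‖y - x‖ ^ 2 / δ ^ 2)

theorem newtonBump_eq_zero {δ : ℝ} (hδ : 0 < δ) {x y : E3} (h : y ∉ ball x δ) :
    newtonBump δ x y = 0 := by
  rw [mem_ball, dist_eq_norm, not_lt] at h
  rw [newtonBump, newtonLaplacian_eq_zero ((one_le_div (by positivity)).mpr (by gcongr)), mul_zero]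

theorem continuous_newtonBump (δ : ℝ) (x : E3) : Continuous (newtonBump δ x) :=
  continuous_const.mul (continuous_newtonLaplacian.comp (by fun_prop))

theorem integrable_newtonBump_mul {δ : ℝ} (hδ : 0 < δ) (x : E3) {w : E3 → ℝ}
    (hw : LocallyIntegrable w volume) : Integrable fun y => newtonBump δ x y * w y :=
  hw.integrable_smul_left_of_hasCompactSupport (continuous_newtonBump δ x)
    (HasCompactSupport.intro (isCompact_closedBall x δ) fun _ hy =>
      newtonBump_eq_zero hδ fun h => hy (ball_subset_closedBall h))

theorem integral_newtonBump {δ : ℝ} (hδ : 0 < δ) (x : E3) :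
    ∫ y, newtonBump δ x y = newtonConst := by
  have h1 := integral_sub_right_eq_self (μ := (volume : Measure E3)) (fun y => newtonBump δ 0 y) x
  have h2 := Measure.integral_comp_smul (volume : Measure E3)
    (fun y => newtonLaplacian (‖y‖ ^ 2)) δ⁻¹
  rw [finrank_euclideanSpace_fin] at h2
  have h3 : ∀ y : E3, newtonBump δ 0 y = (δ ^ 3)⁻¹ * newtonLaplacian (‖δ⁻¹ • y‖ ^ 2) := fun y => by
    rw [newtonBump, sub_zero, norm_smul, norm_inv, Real.norm_of_nonneg hδ.le, mul_pow, inv_pow,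
      div_eq_inv_mul]
  have h4 : ∀ y : E3, newtonBump δ 0 (y - x) = newtonBump δ x y := fun y => by
    rw [newtonBump, newtonBump, sub_zero]
  simp only [h4] at h1
  rw [h1]
  simp only [h3]
  rw [integral_const_mul, h2, smul_eq_mul, newtonConst, ← mul_assoc]
  have : (δ ^ 3)⁻¹ * |((δ⁻¹ ^ 3)⁻¹)| = 1 := by
    rw [abs_of_pos (by positivity)]; field_simp
  rw [this, one_mul]

theorem abs_integral_newtonBump_mul_le {C : ℝ}
    (hC : ∀ t, 0 ≤ t → |newtonLaplacian t| ≤ C) {δ : ℝ} (hδ : 0 < δ) (x : E3) {w : E3 → ℝ}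
    (hw : LocallyIntegrable w volume) :
    |∫ y, newtonBump δ x y * w y| ≤ C * ((δ ^ 3)⁻¹ * ∫ y in ball x δ, |w y|) := by
  have hi : IntegrableOn (fun y => |w y|) (ball x δ) :=
    ((hw.integrableOn_isCompact (isCompact_closedBall x δ)).mono_set ball_subset_closedBall).abs
  rw [← mul_assoc, ← integral_const_mul, ← integral_indicator measurableSet_ball]
  refine abs_integral_le_integral_abs.trans (integral_mono
    (integrable_newtonBump_mul hδ x hw).abs
    (IntegrableOn.integrable_indicator (hi.const_mul (C * (δ ^ 3)⁻¹)) measurableSet_ball) fun y => ?_)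
  by_cases hy : y ∈ ball x δ
  · rw [Set.indicator_of_mem hy]
    simp only [abs_mul, newtonBump]
    rw [abs_of_pos (show 0 < (δ ^ 3)⁻¹ by positivity), mul_comm C]
    have := hC (‖y - x‖ ^ 2 / δ ^ 2) (by positivity)
    gcongr
  · rw [Set.indicator_of_notMem hy]
    simp [newtonBump_eq_zero hδ hy]

/-- Convergence at Lebesgue points of `w`: the bump lives in a ball of radius `δ`, is bounded by a
multiple of `δ⁻³` and has the fixed integral `newtonConst`. -/
theorem ae_tendsto_integral_newtonBump_mul {w : E3 → ℝ} (hw : LocallyIntegrable w volume) :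
    ∀ᵐ x, Tendsto (fun δ => ∫ y, newtonBump δ x y * w y) (𝓝[>] 0) (𝓝 (newtonConst * w x)) := by
  obtain ⟨C, hC0, hC⟩ := exists_bound_newtonLaplacian
  filter_upwards [(Besicovitch.vitaliFamily (volume : Measure E3)).ae_tendsto_average_norm_sub hw]
    with x hx
  have h1 := hx.comp (Besicovitch.tendsto_filterAt (volume : Measure E3) x)
  set V := volume.real (ball (0 : E3) 1) with hV
  have h2 : Tendsto (fun δ => C * V * ⨍ y in closedBall x δ, ‖w y - w x‖) (𝓝[>] 0) (𝓝 0) := by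
    have h := h1.const_mul (C * V)
    rw [mul_zero] at h
    exact h
  rw [tendsto_iff_norm_sub_tendsto_zero]
  refine squeeze_zero' (Eventually.of_forall fun _ => norm_nonneg _) ?_ h2
  filter_upwards [self_mem_nhdsWithin] with δ (hδ : 0 < δ)
  have hw' : LocallyIntegrable (fun y => w y - w x) volume := hw.sub (locallyIntegrable_const _)
  have e : (∫ y, newtonBump δ x y * w y) - newtonConst * w x =
      ∫ y, newtonBump δ x y * (w y - w x) := by
    simp_rw [mul_sub]
    rw [integral_sub (integrable_newtonBump_mul hδ x hw)
      (integrable_newtonBump_mul hδ x (locallyIntegrable_const _)), integral_mul_const,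
      integral_newtonBump hδ]
  rw [e, Real.norm_eq_abs]
  refine (abs_integral_newtonBump_mul_le hC hδ x hw').trans ?_
  rw [mul_assoc]
  refine mul_le_mul_of_nonneg_left ?_ hC0
  have hvol : volume.real (closedBall x δ) = δ ^ 3 * V := by
    rw [Measure.addHaar_real_closedBall _ _ hδ.le, finrank_euclideanSpace_fin]
  have hVpos : 0 < V := ENNReal.toReal_pos (measure_ball_pos _ _ one_pos).ne' measure_ball_lt_top.ne
  rw [setAverage_eq, hvol, smul_eq_mul, mul_inv]
  have : V * ((δ ^ 3)⁻¹ * V⁻¹ * ∫ y in closedBall x δ, ‖w y - w x‖) =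
      (δ ^ 3)⁻¹ * ∫ y in closedBall x δ, ‖w y - w x‖ := by field_simp
  rw [this]
  gcongr
  refine setIntegral_mono_set ?_ (ae_of_all _ fun y => abs_nonneg (w y - w x))
    ball_subset_closedBall.eventuallyLE
  exact (hw'.integrableOn_isCompact (isCompact_closedBall x δ)).norm

theorem isTest_newtonKernel_sub {δ S : ℝ} (hδ : 0 < δ) (hS : δ ≤ S) (x : E3) :
    IsTest fun y => newtonKernel δ (y - x) - newtonKernel S (y - x) := by
  refine ⟨((contDiff_newtonKernel δ).comp (contDiff_id.sub contDiff_const)).sub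
    ((contDiff_newtonKernel S).comp (contDiff_id.sub contDiff_const)),
    HasCompactSupport.intro (isCompact_closedBall x S) fun y hy => ?_⟩
  rw [mem_closedBall, dist_eq_norm, not_le] at hy
  rw [newtonKernel_eq hδ (hδ.trans_le hS) (hS.trans hy.le) hy.le, sub_self]

theorem fderiv_newtonKernel_sub (δ S : ℝ) (x y v : E3) :
    fderiv ℝ (fun y => newtonKernel δ (y - x) - newtonKernel S (y - x)) y v =
      fderiv ℝ (newtonKernel δ) (y - x) v - fderiv ℝ (newtonKernel S) (y - x) v := by
  have hd : ∀ δ : ℝ, DifferentiableAt ℝ (fun y => newtonKernel δ (y - x)) y := fun δ =>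
    (((contDiff_newtonKernel δ).comp (contDiff_id.sub contDiff_const)).differentiable (by simp)) y
  rw [fderiv_fun_sub (hd δ) (hd S), fderiv_comp_sub, fderiv_comp_sub, sub_apply]

theorem lap_newtonKernel_sub (δ S : ℝ) (x y : E3) :
    lap (fun y => newtonKernel δ (y - x) - newtonKernel S (y - x)) y =
      newtonBump δ x y - newtonBump S x y := by
  simp only [newtonBump, ← lap_newtonKernel, lap, fderiv_newtonKernel_sub, ← Finset.sum_sub_distrib]
  refine Finset.sum_congr rfl fun i _ => ?_
  have hd : ∀ δ : ℝ, Differentiable ℝ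
      (fun y => fderiv ℝ (newtonKernel δ) y (EuclideanSpace.single i 1)) := fun δ =>
    (((contDiff_newtonKernel δ).fderiv_right (m := (⊤ : ℕ∞)) (by simp)).clm_apply
      contDiff_const).differentiable (by simp)
  have hd' : ∀ δ : ℝ, DifferentiableAt ℝ
      (fun y => fderiv ℝ (newtonKernel δ) (y - x) (EuclideanSpace.single i 1)) y := fun δ =>
    (hd δ).comp (differentiable_id.sub_const x) y
  rw [fderiv_fun_sub (hd' δ) (hd' S), sub_apply]
  have e := fun δ => fderiv_comp_sub (𝕜 := ℝ)
    (f := fun y => fderiv ℝ (newtonKernel δ) y (EuclideanSpace.single i 1)) (x := y) x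
  rw [e, e]

theorem norm_fderiv_newtonKernel_le : ∃ C, 0 ≤ C ∧ ∀ S : ℝ, 0 < S → ∀ y : E3, ‖y‖ ≤ S → ∀ v,
    |fderiv ℝ (newtonKernel S) y v| ≤ C * (S ^ 3)⁻¹ * ‖y‖ * ‖v‖ := by
  obtain ⟨C, hC⟩ := (isCompact_Icc (a := (0 : ℝ)) (b := 1)).exists_bound_of_continuousOn
    contDiff_deriv_newtonProfile.continuous.continuousOn
  refine ⟨2 * C, by linarith [(norm_nonneg _).trans (hC 0 (by simp))], fun S hS y hy v => ?_⟩
  rw [fderiv_newtonKernel, abs_mul, abs_mul, abs_of_pos (show 0 < 2 * (S ^ 3)⁻¹ by positivity)]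
  have h1 := hC (‖y‖ ^ 2 / S ^ 2) ⟨by positivity, div_le_one_of_le₀ (by gcongr) (by positivity)⟩
  have h2 := abs_real_inner_le_norm y v
  calc 2 * (S ^ 3)⁻¹ * |deriv newtonProfile (‖y‖ ^ 2 / S ^ 2)| * |inner ℝ y v|
      ≤ 2 * (S ^ 3)⁻¹ * C * (‖y‖ * ‖v‖) := by
        have : 0 ≤ C := (norm_nonneg _).trans h1
        rw [Real.norm_eq_abs] at h1
        gcongr
    _ = _ := by ring

/-- The dipole field `z / |z|³` varies by at most `O(|y| / |x|³)` between `x` and `x - y`. -/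
theorem norm_dipole_sub_le {R : ℝ} {x y : E3} (hy : ‖y‖ ≤ R) (hR : 0 < R) (hx : 2 * R ≤ ‖x‖) :
    ‖(‖y - x‖ ^ 3)⁻¹ • (y - x) + (‖x‖ ^ 3)⁻¹ • x‖ ≤ 48 * R * (‖x‖ ^ 3)⁻¹ := by
  set r := ‖x‖ with hr
  set z := ‖y - x‖ with hz
  have hr0 : 0 < r := by linarith
  have hz1 : r / 2 ≤ z := by
    have := norm_sub_norm_le x y
    rw [norm_sub_rev] at this
    linarith
  have hz2 : z ≤ 3 / 2 * r := by
    have := norm_sub_le y x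
    linarith
  have hz0 : 0 < z := by linarith
  have hzr : |r - z| ≤ R := by
    have := abs_norm_sub_norm_le x (x - y)
    rw [norm_sub_rev x y, sub_sub_cancel] at this
    exact this.trans hy
  have e : (z ^ 3)⁻¹ • (y - x) + (r ^ 3)⁻¹ • x = (z ^ 3)⁻¹ • y + ((r ^ 3)⁻¹ - (z ^ 3)⁻¹) • x := by
    rw [smul_sub, sub_smul]; abel
  have h1 : (z ^ 3)⁻¹ ≤ 8 * (r ^ 3)⁻¹ := by
    rw [← div_eq_mul_inv, inv_le_comm₀ (by positivity) (by positivity), inv_div]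
    calc r ^ 3 / 8 = (r / 2) ^ 3 := by ring
      _ ≤ z ^ 3 := by gcongr
  have h2 : |(r ^ 3)⁻¹ - (z ^ 3)⁻¹| * r ≤ 40 * R * (r ^ 3)⁻¹ := by
    have e2 : (r ^ 3)⁻¹ - (z ^ 3)⁻¹ = -((r - z) * (r ^ 2 + r * z + z ^ 2)) * (r ^ 3)⁻¹ * (z ^ 3)⁻¹ := by
      field_simp; ring
    rw [e2, abs_mul, abs_mul, abs_neg, abs_mul, abs_of_pos (show 0 < (r ^ 3)⁻¹ by positivity),
      abs_of_pos (show 0 < (z ^ 3)⁻¹ by positivity),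
      abs_of_pos (show 0 < r ^ 2 + r * z + z ^ 2 by positivity)]
    have h3 : r ^ 2 + r * z + z ^ 2 ≤ 5 * r ^ 2 := by nlinarith
    calc |r - z| * (r ^ 2 + r * z + z ^ 2) * (r ^ 3)⁻¹ * (z ^ 3)⁻¹ * r
        ≤ R * (5 * r ^ 2) * (r ^ 3)⁻¹ * (8 * (r ^ 3)⁻¹) * r := by gcongr
      _ = 40 * R * (r ^ 3)⁻¹ := by field_simp; ring
  rw [e]
  refine (norm_add_le _ _).trans ?_
  rw [norm_smul, norm_smul, Real.norm_of_nonneg (by positivity), Real.norm_eq_abs, ← hr]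
  calc (z ^ 3)⁻¹ * ‖y‖ + |(r ^ 3)⁻¹ - (z ^ 3)⁻¹| * r ≤ 8 * (r ^ 3)⁻¹ * R + 40 * R * (r ^ 3)⁻¹ := by
        gcongr
    _ = _ := by ring

/-- The identity of Green for the regularized Newtonian kernel. -/
theorem integral_newtonBump_mul_eq {w : E3 → ℝ} {w' : E3 → E3 →L[ℝ] ℝ} {f : E3 → E3} {R : ℝ}
    (hw : HasWeakFDerivOn Set.univ w w') (hmean : HasVanishingMeans w) (hf : Integrable f)
    (hfR : ∀ x ∉ ball (0 : E3) R, f x = 0)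
    (heq : ∀ φ, IsTest φ → ∫ x, w' x (gradient φ x) = -∫ x, inner ℝ (f x) (gradient φ x))
    {δ : ℝ} (hδ : 0 < δ) (x : E3) :
    ∫ y, newtonBump δ x y * w y = ∫ y, fderiv ℝ (newtonKernel δ) (y - x) (f y) := by
  have hwl : LocallyIntegrable w volume := locallyIntegrableOn_univ.mp hw.1
  obtain ⟨C, hC0, hC⟩ := exists_bound_newtonLaplacian
  obtain ⟨C', hC'0, hC'⟩ := norm_fderiv_newtonKernel_le
  have hcont : ∀ S : ℝ, Continuous fun y => fderiv ℝ (newtonKernel S) (y - x) := fun S =>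
    ((contDiff_newtonKernel S).continuous_fderiv (by simp)).comp (by fun_prop)
  have hint : ∀ S : ℝ, Integrable fun y => fderiv ℝ (newtonKernel S) (y - x) (f y) := by
    intro S
    obtain ⟨K, hK⟩ := (isCompact_closedBall (0 : E3) R).exists_bound_of_continuousOn
      (hcont S).continuousOn
    have h0 : AEStronglyMeasurable (fun y => fderiv ℝ (newtonKernel S) (y - x) (f y)) volume :=
      (ContinuousLinearMap.id ℝ (E3 →L[ℝ] ℝ)).aestronglyMeasurable_comp₂
        (hcont S).aestronglyMeasurable hf.1
    refine (hf.norm.const_mul K).mono' h0 (ae_of_all _ fun y => ?_)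
    by_cases hy : y ∈ ball (0 : E3) R
    · exact ContinuousLinearMap.le_of_opNorm_le _ (hK y (ball_subset_closedBall hy)) _
    · simp [hfR y hy]
  -- Testing the equation with the difference of the kernels at scales `δ` and `S` shows that the
  -- defect of the identity is the same at both scales. As `S → ∞` its first part vanishes because
  -- the means of `w` do, and its second because the gradient of the kernel on the support of `f` is
  -- `O(S⁻³)`.
  have key : ∀ S, δ ≤ S → (∫ y, newtonBump δ x y * w y) -
      (∫ y, fderiv ℝ (newtonKernel δ) (y - x) (f y)) = (∫ y, newtonBump S x y * w y) -
      ∫ y, fderiv ℝ (newtonKernel S) (y - x) (f y) := by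
    intro S hS
    have ht := isTest_newtonKernel_sub hδ hS x
    have h1 := hw.integral_lap_mul ht
    rw [heq _ ht, neg_neg] at h1
    simp only [lap_newtonKernel_sub, real_inner_comm (gradient _ _) (f _), inner_gradient_left,
      fderiv_newtonKernel_sub, sub_mul] at h1
    rw [integral_sub (integrable_newtonBump_mul hδ x hwl)
      (integrable_newtonBump_mul (hδ.trans_le hS) x hwl), integral_sub (hint _) (hint _)] at h1
    linarith
  have l₁ : Tendsto (fun S => ∫ y, newtonBump S x y * w y) atTop (𝓝 0) := by
    rw [tendsto_zero_iff_abs_tendsto_zero]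
    have := (hmean x).const_mul C
    rw [mul_zero] at this
    refine squeeze_zero' (Eventually.of_forall fun _ => abs_nonneg _) ?_ this
    filter_upwards [eventually_gt_atTop 0] with S hS
    exact abs_integral_newtonBump_mul_le hC hS x hwl
  have l₂ : Tendsto (fun S => ∫ y, fderiv ℝ (newtonKernel S) (y - x) (f y)) atTop (𝓝 0) := by
    rw [tendsto_zero_iff_abs_tendsto_zero]
    have h3 : Tendsto (fun S : ℝ => (S ^ 3)⁻¹ * (C' * (|R| + ‖x‖) * ∫ y, ‖f y‖)) atTop (𝓝 0) := by
      rw [← zero_mul (C' * (|R| + ‖x‖) * ∫ y, ‖f y‖)]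
      exact ((tendsto_pow_atTop (α := ℝ) (n := 3) (by norm_num)).inv_tendsto_atTop).mul_const _
    refine squeeze_zero' (Eventually.of_forall fun _ => abs_nonneg _) ?_ h3
    filter_upwards [eventually_gt_atTop 0, eventually_ge_atTop (|R| + ‖x‖)] with S hS hS'
    rw [← mul_assoc, ← integral_const_mul]
    refine abs_integral_le_integral_abs.trans (integral_mono (hint S).abs (hf.norm.const_mul _)
      fun y => ?_)
    by_cases hy : y ∈ ball (0 : E3) R
    · have hyx : ‖y - x‖ ≤ |R| + ‖x‖ := (norm_sub_le y x).trans (by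
        rw [mem_ball_zero_iff] at hy
        linarith [le_abs_self R])
      refine (hC' S hS _ (hyx.trans hS') _).trans ?_
      calc C' * (S ^ 3)⁻¹ * ‖y - x‖ * ‖f y‖ ≤ C' * (S ^ 3)⁻¹ * (|R| + ‖x‖) * ‖f y‖ := by gcongr
        _ = (S ^ 3)⁻¹ * (C' * (|R| + ‖x‖)) * ‖f y‖ := by ring
    · simp [hfR y hy]
  have l₃ := l₁.sub l₂
  rw [sub_zero] at l₃
  exact sub_eq_zero.mp (tendsto_nhds_unique (tendsto_const_nhds.congr' (by
    filter_upwards [eventually_ge_atTop δ] with S hS using key S hS)) l₃)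

/-- A function whose Laplacian is minus the divergence of a compactly supported field of mean zero,
and which vanishes at infinity in the mean, decays like `|x|⁻³`. -/
theorem isBigO_of_source {w : E3 → ℝ} {w' : E3 → E3 →L[ℝ] ℝ} {f : E3 → E3} {R : ℝ}
    (hw : HasWeakFDerivOn Set.univ w w') (hmean : HasVanishingMeans w) (hf : Integrable f)
    (hR : 0 < R) (hfR : ∀ x ∉ ball (0 : E3) R, f x = 0) (hf0 : ∫ x, f x = 0)
    (heq : ∀ φ, IsTest φ → ∫ x, w' x (gradient φ x) = -∫ x, inner ℝ (f x) (gradient φ x)) :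
    w =O[aeInfinity] fun x => (‖x‖ ^ 3)⁻¹ := by
  have hwl : LocallyIntegrable w volume := locallyIntegrableOn_univ.mp hw.1
  refine isBigO_aeInfinity.mpr ⟨|newtonConst|⁻¹ * (48 * R * ∫ y, ‖f y‖), 2 * R, ?_⟩
  filter_upwards [ae_tendsto_integral_newtonBump_mul hwl] with x hx hxR
  have hr0 : 0 < ‖x‖ := by linarith
  -- For `|x| ≥ 2R` and `δ ≤ R` the regularization is not felt on the support of `f`. Since `f` has
  -- mean zero, the constant vector `x / |x|³` can be added to the kernel, which cancels the term of
  -- order `|x|⁻²`.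
  have hdip : ∀ δ : ℝ, 0 < δ → δ ≤ R → ∫ y, newtonBump δ x y * w y =
      -∫ y, inner ℝ ((‖y - x‖ ^ 3)⁻¹ • (y - x) + (‖x‖ ^ 3)⁻¹ • x) (f y) := by
    intro δ hδ hδR
    rw [integral_newtonBump_mul_eq hw hmean hf hfR heq hδ, ← integral_neg]
    have h0 : ∫ y, inner ℝ ((‖x‖ ^ 3)⁻¹ • x) (f y) = 0 := by
      have := integral_inner (𝕜 := ℝ) hf ((‖x‖ ^ 3)⁻¹ • x)
      rw [this, hf0, inner_zero_right]
    have hi : Integrable fun y => inner ℝ ((‖x‖ ^ 3)⁻¹ • x) (f y) := hf.const_inner _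
    have e : ∀ y, -(inner ℝ ((‖y - x‖ ^ 3)⁻¹ • (y - x) + (‖x‖ ^ 3)⁻¹ • x) (f y)) =
        fderiv ℝ (newtonKernel δ) (y - x) (f y) - inner ℝ ((‖x‖ ^ 3)⁻¹ • x) (f y) := by
      intro y
      by_cases hy : y ∈ ball (0 : E3) R
      · rw [mem_ball_zero_iff] at hy
        rw [fderiv_newtonKernel_of_le _ hδ, inner_add_left, real_inner_smul_left]
        · ring
        · have := norm_sub_norm_le x y
          rw [norm_sub_rev] at this
          linarith
      · simp [hfR y hy]
    simp_rw [e]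
    -- If the integrand were not integrable, both integrals would be zero by convention, so no
    -- integrability proof is required.
    by_cases hI : Integrable fun y => fderiv ℝ (newtonKernel δ) (y - x) (f y)
    · rw [integral_sub hI hi, h0, sub_zero]
    · rw [integral_undef hI, integral_undef]
      intro h
      refine hI ((h.add hi).congr (ae_of_all _ fun y => ?_))
      simp
  have hlim := tendsto_nhds_unique (hx.congr' (by
    filter_upwards [Ioc_mem_nhdsGT hR] with δ hδ using hdip δ hδ.1 hδ.2)) tendsto_const_nhds
  have hb : |newtonConst * w x| ≤ 48 * R * (‖x‖ ^ 3)⁻¹ * ∫ y, ‖f y‖ := by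
    rw [hlim, abs_neg, ← integral_const_mul]
    refine abs_integral_le_integral_abs.trans (integral_mono_of_nonneg
      (ae_of_all _ fun _ => abs_nonneg _) (hf.norm.const_mul _) (ae_of_all _ fun y => ?_))
    by_cases hy : y ∈ ball (0 : E3) R
    · rw [mem_ball_zero_iff] at hy
      refine (abs_real_inner_le_norm _ _).trans ?_
      have := norm_dipole_sub_le hy.le hR hxR
      simp only
      gcongr
    · simp [hfR y hy]
  rw [abs_mul, mul_comm, ← le_div_iff₀ (abs_pos.mpr newtonConst_ne_zero)] at hb
  refine hb.trans (le_of_eq ?_)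
  rw [abs_of_pos (show 0 < (‖x‖ ^ 3)⁻¹ by positivity)]
  ring

end

section


open Filter Topology ContinuousLinearMap

/-! ### Uniqueness of decaying weak solutions -/

theorem HasWeakFDerivOn.sub {u v : E3 → ℝ} {u' v' : E3 → E3 →L[ℝ] ℝ}
    (hu : HasWeakFDerivOn Set.univ u u') (hv : HasWeakFDerivOn Set.univ v v') :
    HasWeakFDerivOn Set.univ (fun x => u x - v x) (fun x => u' x - v' x) := by
  refine ⟨hu.1.sub hv.1, hu.2.1.sub hv.2.1, fun φ hφ hφc _ e => ?_⟩
  have hφ : IsTest φ := ⟨hφ, hφc⟩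
  have i : ∀ {u : E3 → ℝ}, LocallyIntegrableOn u Set.univ volume →
      Integrable fun x => fderiv ℝ φ x e * u x := fun hu =>
    (locallyIntegrableOn_univ.mp hu).integrable_smul_left_of_hasCompactSupport
      (hφ.fderiv_apply e).1.continuous (hφ.fderiv_apply e).2
  have i' : ∀ {u : E3 → E3 →L[ℝ] ℝ}, LocallyIntegrableOn u Set.univ volume →
      Integrable fun x => φ x * u x e := fun hu =>
    ((locallyIntegrableOn_univ.mp hu).integrable_smul_left_of_hasCompactSupport
      hφ.1.continuous hφ.2).apply_continuousLinearMap e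
  simp only [smul_eq_mul, mul_sub, sub_apply]
  rw [integral_sub (i hu.1) (i hv.1), integral_sub (i' hu.2.1) (i' hv.2.1), hu.integral_eq hφ,
    hv.integral_eq hφ]
  ring

theorem hasWeakFDerivOn_inner (a : E3) :
    HasWeakFDerivOn Set.univ (fun x => inner ℝ a x) (fun _ => innerSL ℝ a) := by
  refine ⟨(continuous_const.inner continuous_id).locallyIntegrable.locallyIntegrableOn _,
    continuous_const.locallyIntegrable.locallyIntegrableOn _, fun φ hφ hφc _ v => ?_⟩
  have hφ : IsTest φ := ⟨hφ, hφc⟩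
  have hs : ContDiff ℝ (⊤ : ℕ∞) (fun x : E3 => inner ℝ a x) := (innerSL ℝ a).contDiff
  have hd : ∀ x, fderiv ℝ (fun x : E3 => inner ℝ a x) x = innerSL ℝ a := fun x =>
    (innerSL ℝ a).fderiv
  have := integral_mul_fderiv_eq_neg_fderiv_mul_of_integrable (μ := (volume : Measure E3))
    (f := fun x : E3 => inner ℝ a x) (g := φ) (v := v) ?_ ?_ ?_ ?_ ?_
  · simp only [hd, innerSL_apply_apply] at this
    simp only [smul_eq_mul, innerSL_apply_apply, mul_comm _ (inner ℝ a _)]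
    exact this
  · simp only [hd]
    exact (hφ.mul_left (φ := fun _ => innerSL ℝ a v) contDiff_const).integrable
  · exact ((hφ.fderiv_apply v).mul_left hs).integrable
  · exact (hφ.mul_left hs).integrable
  · exact fun x _ => hs.differentiable (by simp) x
  · exact fun x _ => hφ.differentiable x

theorem HasWeakFDerivOn.congr_ae {u : E3 → ℝ} {u' v' : E3 → E3 →L[ℝ] ℝ}
    (hu : HasWeakFDerivOn Set.univ u u') (h : u' =ᵐ[volume] v') :
    HasWeakFDerivOn Set.univ u v' := by
  refine ⟨hu.1, ?_, fun φ hφ hφc hs v => ?_⟩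
  · rw [locallyIntegrableOn_univ]
    exact (locallyIntegrable_congr h).mp (locallyIntegrableOn_univ.mp hu.2.1)
  · rw [hu.2.2 φ hφ hφc hs v]
    congr 1
    exact integral_congr_ae (by filter_upwards [h] with x hx; rw [hx])

/-- The vector representing a functional. -/
def vec (L : E3 →L[ℝ] ℝ) : E3 := (InnerProductSpace.toDual ℝ E3).symm L

theorem inner_vec (L : E3 →L[ℝ] ℝ) (y : E3) : inner ℝ (vec L) y = L y :=
  InnerProductSpace.toDual_symm_apply

theorem norm_vec (L : E3 →L[ℝ] ℝ) : ‖vec L‖ = ‖L‖ := LinearIsometryEquiv.norm_map _ _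

theorem MemLp.vec {μ : Measure E3} {u' : E3 → E3 →L[ℝ] ℝ} {p : ℝ≥0∞} (h : MemLp u' p μ) :
    MemLp (fun x => vec (u' x)) p μ :=
  h.congr_norm ((LinearIsometryEquiv.continuous _).comp_aestronglyMeasurable h.1)
    (ae_of_all _ fun x => (norm_vec (u' x)).symm)

theorem memLp_fun_add {F : Type*} [NormedAddCommGroup F] {f g : E3 → F} {p : ℝ≥0∞}
    {μ : Measure E3} (hf : MemLp f p μ) (hg : MemLp g p μ) : MemLp (fun x => f x + g x) p μ :=
  hf.add hg

theorem memLp_of_norm_le {F F' : Type*} [NormedAddCommGroup F] [NormedAddCommGroup F']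
    {f : E3 → F} {g : E3 → F'} {r : ℝ} (hg : MemLp g 2 (volume.restrict (closedBall 0 r)))
    (hf : AEStronglyMeasurable f volume) {C : ℝ} (hle : ∀ x, ‖f x‖ ≤ C * ‖g x‖)
    (h0 : ∀ x ∉ closedBall (0 : E3) r, f x = 0) : MemLp f 2 volume := by
  have e : (closedBall (0 : E3) r).indicator f = f :=
    Set.indicator_eq_self.mpr fun x hx => by_contra fun h => hx (h0 x h)
  rw [← e, memLp_indicator_iff_restrict measurableSet_closedBall]
  exact hg.of_le_mul hf.restrict (ae_of_all _ hle)

theorem HasWeakFDerivOn.memLp_mul_test {d : E3 → ℝ} {d' : E3 → E3 →L[ℝ] ℝ}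
    (hd : HasWeakFDerivOn Set.univ d d') (hd2 : ∀ K : Set E3, IsCompact K →
      MemLp d 2 (volume.restrict K) ∧ MemLp d' 2 (volume.restrict K)) {χ : E3 → ℝ}
    (hχ : IsTest χ) : MemLp (fun x => χ x * d x) 2 volume ∧
      MemLp (fun x => χ x • d' x) 2 volume ∧ MemLp (fun x => d x • fderiv ℝ χ x) 2 volume ∧
      MemLp (fun x => χ x • d' x + d x • fderiv ℝ χ x) 2 volume := by
  obtain ⟨r, hr⟩ : ∃ r, tsupport χ ⊆ closedBall (0 : E3) r :=
    hχ.2.isCompact.isBounded.subset_closedBall 0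
  have hχr : ∀ x ∉ closedBall (0 : E3) r, χ x = 0 := fun x hx =>
    image_eq_zero_of_notMem_tsupport fun h => hx (hr h)
  have hχr' : ∀ x ∉ closedBall (0 : E3) r, fderiv ℝ χ x = 0 := fun x hx =>
    image_eq_zero_of_notMem_tsupport fun h => hx (hr (tsupport_fderiv_subset ℝ h))
  have hχc : Continuous χ := hχ.1.continuous
  have hχc' : Continuous (fderiv ℝ χ) := hχ.1.continuous_fderiv (by simp)
  obtain ⟨Cχ, hCχ⟩ := hχc.bounded_above_of_compact_support hχ.2
  obtain ⟨Cχ', hCχ'⟩ := hχc'.bounded_above_of_compact_support (hχ.2.fderiv ℝ)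
  have dm : AEStronglyMeasurable d volume := (locallyIntegrableOn_univ.mp hd.1).aestronglyMeasurable
  have dm' : AEStronglyMeasurable d' volume :=
    (locallyIntegrableOn_univ.mp hd.2.1).aestronglyMeasurable
  have m₁ : MemLp (fun x => χ x • d' x) 2 volume :=
    memLp_of_norm_le (hd2 _ (isCompact_closedBall 0 r)).2 (hχc.aestronglyMeasurable.smul dm')
      (C := Cχ) (fun x => by rw [norm_smul]; gcongr; exact hCχ x) fun x hx => by simp [hχr x hx]
  have m₂ : MemLp (fun x => d x • fderiv ℝ χ x) 2 volume :=
    memLp_of_norm_le (hd2 _ (isCompact_closedBall 0 r)).1 (dm.smul hχc'.aestronglyMeasurable)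
      (C := Cχ') (fun x => by rw [norm_smul, mul_comm]; gcongr; exact hCχ' x)
      fun x hx => by simp [hχr' x hx]
  refine ⟨?_, m₁, m₂, memLp_fun_add m₁ m₂⟩
  exact memLp_of_norm_le (hd2 _ (isCompact_closedBall 0 r)).1 (hχc.aestronglyMeasurable.mul dm)
    (C := Cχ) (fun x => by rw [norm_mul]; gcongr; exact hCχ x) fun x hx => by simp [hχr x hx]

/-- The functional on the right is the derivative of `χ² d`. The cross term is absorbed by Young's
inequality: half of `χ² ‖L‖²` is spent, which the factor `2` restores. -/
theorem caccioppoli_pointwise {s : ℝ} (hs : 0 ≤ s) (χ d : ℝ) (T L : E3 →L[ℝ] ℝ) :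
    s * (χ ^ 2 * ‖L‖ ^ 2) ≤ 2 * ((χ * χ) • L + d • ((2 * χ) • T)) (s • vec L) +
      4 * (s * (d ^ 2 * ‖T‖ ^ 2)) := by
  have h1 : L (vec L) = ‖L‖ ^ 2 := by
    rw [← inner_vec, real_inner_self_eq_norm_sq, norm_vec]
  have h2 : |T (vec L)| ≤ ‖T‖ * ‖L‖ := by
    rw [← norm_vec L]
    exact T.le_opNorm _
  simp only [map_smul, add_apply, FunLike.coe_smul, Pi.smul_apply, smul_eq_mul, h1]
  have h3 := mul_le_mul_of_nonneg_left h2 (mul_nonneg (abs_nonneg χ) (abs_nonneg d))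
  rw [← abs_mul, ← abs_mul] at h3
  have h4 := neg_le_of_abs_le h3
  have h5 : 2 * (|χ * d| * (‖T‖ * ‖L‖)) ≤ χ ^ 2 * ‖L‖ ^ 2 / 2 + 2 * (d ^ 2 * ‖T‖ ^ 2) := by
    have := sq_nonneg (|χ| * ‖L‖ - 2 * (|d| * ‖T‖))
    rw [abs_mul]
    nlinarith [sq_abs χ, sq_abs d]
  have h6 := mul_le_mul_of_nonneg_left
    (show χ ^ 2 * ‖L‖ ^ 2 / 2 - 2 * (d ^ 2 * ‖T‖ ^ 2) ≤
      χ ^ 2 * ‖L‖ ^ 2 + 2 * (χ * d * T (vec L)) by linarith) hs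
  linarith

/-- The equation is tested with `χ² d`. This function is not smooth, but its mollifications are test
functions supported in a fixed ball `K`. Since `σ ∇d` restricted to `K` is square integrable, their
weak convergence suffices. -/
theorem caccioppoli {σ d : E3 → ℝ} {d' : E3 → E3 →L[ℝ] ℝ} {σ₁ : ℝ} (hσ : Measurable σ)
    (hσ0 : ∀ x, 0 ≤ σ x) (hσ1 : ∀ x, σ x ≤ σ₁) (hd : HasWeakFDerivOn Set.univ d d')
    (hd2 : ∀ K : Set E3, IsCompact K →
      MemLp d 2 (volume.restrict K) ∧ MemLp d' 2 (volume.restrict K))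
    (heq : ∀ φ, IsTest φ → ∫ x, σ x * d' x (gradient φ x) = 0) {χ : E3 → ℝ} (hχ : IsTest χ) :
    Integrable (fun x => σ x * (χ x ^ 2 * ‖d' x‖ ^ 2)) ∧
    ∫ x, σ x * (χ x ^ 2 * ‖d' x‖ ^ 2) ≤ 4 * ∫ x, σ x * (d x ^ 2 * ‖fderiv ℝ χ x‖ ^ 2) := by
  obtain ⟨r, hr⟩ : ∃ r, tsupport χ ⊆ closedBall (0 : E3) r :=
    hχ.2.isCompact.isBounded.subset_closedBall 0
  have hχr : ∀ x ∉ closedBall (0 : E3) r, χ x = 0 := fun x hx =>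
    image_eq_zero_of_notMem_tsupport fun h => hx (hr h)
  have hχr' : ∀ x ∉ closedBall (0 : E3) r, fderiv ℝ χ x = 0 := fun x hx =>
    image_eq_zero_of_notMem_tsupport fun h => hx (hr (tsupport_fderiv_subset ℝ h))
  have hχc : Continuous χ := hχ.1.continuous
  have hχc' : Continuous (fderiv ℝ χ) := hχ.1.continuous_fderiv (by simp)
  have hσabs : ∀ x, ‖σ x‖ ≤ σ₁ := fun x => by
    rw [Real.norm_eq_abs, abs_of_nonneg (hσ0 x)]; exact hσ1 x
  have hσ₁ : 0 ≤ σ₁ := (hσ0 0).trans (hσ1 0)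
  have dm : AEStronglyMeasurable d volume := (locallyIntegrableOn_univ.mp hd.1).aestronglyMeasurable
  have dm' : AEStronglyMeasurable d' volume :=
    (locallyIntegrableOn_univ.mp hd.2.1).aestronglyMeasurable
  obtain ⟨-, m₁, m₂, -⟩ := hd.memLp_mul_test hd2 hχ
  have hχ2 : IsTest (χ * χ) := hχ.mul_left hχ.1
  have hχ2' : ∀ x, fderiv ℝ (χ * χ) x = (2 * χ x) • fderiv ℝ χ x := fun x => by
    rw [fderiv_mul (hχ.differentiable x) (hχ.differentiable x), ← add_smul, two_mul]
  have hw := hd.mul_test hχ2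
  obtain ⟨mw, -, -, mw'⟩ := hd.memLp_mul_test hd2 hχ2
  obtain ⟨φ, hφ, hφK, -, hlim⟩ := hw.exists_seq_tests mw mw' (r := r)
    fun x hx => by simp [hχr x hx]
  set K := closedBall (0 : E3) (r + 1) with hK
  have mψ : MemLp (K.indicator fun x => σ x • vec (d' x)) 2 volume := by
    rw [memLp_indicator_iff_restrict measurableSet_closedBall]
    exact (MemLp.vec (hd2 K (isCompact_closedBall _ _)).2).of_le_mul (c := σ₁)
      (hσ.aestronglyMeasurable.smul (MemLp.vec (hd2 K (isCompact_closedBall _ _)).2).1)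
      (ae_of_all _ fun x => by
        rw [norm_smul]
        exact mul_le_mul_of_nonneg_right (hσabs x) (norm_nonneg _))
  have hz := hlim _ mψ
  have e0 : ∀ n, ∫ x, inner ℝ (K.indicator (fun x => σ x • vec (d' x)) x) (gradient (φ n) x) = 0 :=
    fun n => by
      rw [← heq _ (hφ n)]
      refine integral_congr_ae (ae_of_all _ fun x => ?_)
      by_cases hx : x ∈ K
      · simp only [Set.indicator_of_mem hx, real_inner_smul_left, inner_vec]
      · simp [hx, (hφK n x hx).2]
  simp only [e0] at hz
  have hz := tendsto_nhds_unique hz tendsto_const_nhds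
  have i₀ := mw'.norm.integrable_mul mψ.norm
  have i₁ : Integrable fun x => (((χ * χ) x • d' x + d x • fderiv ℝ (χ * χ) x) :
      E3 →L[ℝ] ℝ) (K.indicator (fun x => σ x • vec (d' x)) x) :=
    i₀.mono' ((ContinuousLinearMap.id ℝ (E3 →L[ℝ] ℝ)).aestronglyMeasurable_comp₂ mw'.1 mψ.1)
      (ae_of_all _ fun x => ContinuousLinearMap.le_opNorm _ _)
  have i₂ : Integrable fun x => σ x * (χ x ^ 2 * ‖d' x‖ ^ 2) := by
    have h : Integrable fun x => ‖χ x • d' x‖ ^ 2 := m₁.norm.integrable_sq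
    have h' : Integrable fun x => σ x * ‖χ x • d' x‖ ^ 2 :=
      h.bdd_mul hσ.aestronglyMeasurable (ae_of_all _ hσabs)
    simpa only [norm_smul, mul_pow, Real.norm_eq_abs, sq_abs] using h'
  have i₃ : Integrable fun x => σ x * (d x ^ 2 * ‖fderiv ℝ χ x‖ ^ 2) := by
    have h : Integrable fun x => ‖d x • fderiv ℝ χ x‖ ^ 2 := m₂.norm.integrable_sq
    have h' : Integrable fun x => σ x * ‖d x • fderiv ℝ χ x‖ ^ 2 :=
      h.bdd_mul hσ.aestronglyMeasurable (ae_of_all _ hσabs)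
    simpa only [norm_smul, mul_pow, Real.norm_eq_abs, sq_abs] using h'
  obtain ⟨F, hF⟩ : ∃ F : E3 → ℝ, F = fun x => (((χ * χ) x • d' x + d x • fderiv ℝ (χ * χ) x) :
      E3 →L[ℝ] ℝ) (K.indicator (fun x => σ x • vec (d' x)) x) := ⟨_, rfl⟩
  rw [← hF] at i₁ hz
  refine ⟨i₂, ?_⟩
  have hle : ∀ x, σ x * (χ x ^ 2 * ‖d' x‖ ^ 2) ≤
      2 * F x + 4 * (σ x * (d x ^ 2 * ‖fderiv ℝ χ x‖ ^ 2)) := fun x => by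
    rw [hF]
    by_cases hx : x ∈ K
    · simp only [Set.indicator_of_mem hx, hχ2']
      exact caccioppoli_pointwise (hσ0 x) _ _ _ _
    · have hx' : x ∉ closedBall (0 : E3) r := fun h =>
        hx (closedBall_subset_closedBall (by linarith) h)
      simp [hx, hχr x hx', hχr' x hx']
  calc ∫ x, σ x * (χ x ^ 2 * ‖d' x‖ ^ 2)
      ≤ ∫ x, (2 * F x + 4 * (σ x * (d x ^ 2 * ‖fderiv ℝ χ x‖ ^ 2))) :=
        integral_mono i₂ ((i₁.const_mul 2).add (i₃.const_mul 4)) hle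
    _ = 2 * (∫ x, F x) + 4 * ∫ x, σ x * (d x ^ 2 * ‖fderiv ℝ χ x‖ ^ 2) := by
        rw [integral_add (i₁.const_mul 2) (i₃.const_mul 4), integral_const_mul, integral_const_mul]
    _ = _ := by rw [hz, mul_zero, zero_add]

end

/-! ### Cut-off functions and the vanishing of decaying solutions -/

section


open Filter Topology ContinuousLinearMap

theorem integrable_inner_of_memLp {f g : E3 → E3} (hf : MemLp f 2 volume)
    (hg : MemLp g 2 volume) : Integrable fun x => inner ℝ (f x) (g x) :=
  (hf.norm.integrable_mul hg.norm).mono' (hf.1.inner hg.1)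
    (ae_of_all _ fun x => norm_inner_le_norm (f x) (g x))

/-- A fixed smooth cut-off function. -/
def cutoffBump : ContDiffBump (0 : E3) := ⟨1, 2, one_pos, one_lt_two⟩

/-- The cut-off function at scale `S`. -/
def cutoff (S : ℝ) (x : E3) : ℝ := cutoffBump (S⁻¹ • x)

theorem isTest_cutoff {S : ℝ} (hS : 0 < S) : IsTest (cutoff S) := by
  refine ⟨cutoffBump.contDiff.comp (contDiff_const_smul _), ?_⟩
  refine HasCompactSupport.intro (isCompact_closedBall 0 (2 * S)) fun x hx => ?_
  rw [mem_closedBall_zero_iff, not_le] at hx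
  refine cutoffBump.zero_of_le_dist ?_
  rw [dist_zero_right, norm_smul, norm_inv, Real.norm_of_nonneg hS.le, inv_mul_eq_div,
    le_div_iff₀ hS]
  exact hx.le

theorem cutoff_eq_one {S : ℝ} (hS : 0 < S) {x : E3} (hx : ‖x‖ ≤ S) : cutoff S x = 1 := by
  refine cutoffBump.one_of_mem_closedBall ?_
  rw [mem_closedBall_zero_iff, norm_smul, norm_inv, Real.norm_of_nonneg hS.le, inv_mul_eq_div,
    div_le_iff₀ hS, show cutoffBump.rIn = 1 from rfl, one_mul]
  exact hx

theorem fderiv_cutoff (S : ℝ) (x : E3) :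
    fderiv ℝ (cutoff S) x = S⁻¹ • fderiv ℝ cutoffBump (S⁻¹ • x) :=
  fderiv_comp_smul (f := cutoffBump) S⁻¹

theorem exists_norm_fderiv_cutoff_le : ∃ C, ∀ S : ℝ, 0 < S → ∀ x,
    ‖fderiv ℝ (cutoff S) x‖ ≤ C * S⁻¹ := by
  obtain ⟨C, hC⟩ := ((cutoffBump.contDiff (n := 1)).continuous_fderiv
    (by simp)).bounded_above_of_compact_support (cutoffBump.hasCompactSupport.fderiv ℝ)
  refine ⟨C, fun S hS x => ?_⟩
  rw [fderiv_cutoff, norm_smul, norm_inv, Real.norm_of_nonneg hS.le, mul_comm]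
  gcongr
  exact hC _

theorem fderiv_cutoff_eq_zero {S : ℝ} (hS : 0 < S) {x : E3} (hx : ‖x‖ < S ∨ 2 * S < ‖x‖) :
    fderiv ℝ (cutoff S) x = 0 := by
  rcases hx with hx | hx
  · have : cutoff S =ᶠ[𝓝 x] fun _ => 1 := by
      filter_upwards [isOpen_ball.mem_nhds (mem_ball_zero_iff.mpr hx)] with y hy
      exact cutoff_eq_one hS (mem_ball_zero_iff.mp hy).le
    simp [this.fderiv_eq]
  · have : cutoff S =ᶠ[𝓝 x] fun _ => 0 := by
      filter_upwards [isClosed_closedBall.isOpen_compl.mem_nhds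
        (show x ∈ (closedBall (0 : E3) (2 * S))ᶜ by simpa using hx)] with y hy
      rw [Set.mem_compl_iff, mem_closedBall_zero_iff, not_le] at hy
      refine cutoffBump.zero_of_le_dist ?_
      rw [dist_zero_right, norm_smul, norm_inv, Real.norm_of_nonneg hS.le, inv_mul_eq_div,
        le_div_iff₀ hS]
      exact hy.le
    simp [this.fderiv_eq]

/-- A weak solution of size `O(|x|⁻²)` has vanishing gradient. -/
theorem ae_eq_zero_of_weak_solution {σ d : E3 → ℝ} {d' : E3 → E3 →L[ℝ] ℝ} {σ₀ σ₁ : ℝ}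
    (hσ : Measurable σ) (hσ₀ : 0 < σ₀) (hσ0 : ∀ x, σ₀ ≤ σ x) (hσ1 : ∀ x, σ x ≤ σ₁)
    (hd : HasWeakFDerivOn Set.univ d d') (hd2 : ∀ K : Set E3, IsCompact K →
      MemLp d 2 (volume.restrict K) ∧ MemLp d' 2 (volume.restrict K))
    (heq : ∀ φ, IsTest φ → ∫ x, σ x * d' x (gradient φ x) = 0)
    (hO : d =O[aeInfinity] fun x => (‖x‖ ^ 2)⁻¹) : d' =ᵐ[volume] 0 := by
  obtain ⟨C, R, hC⟩ := isBigO_aeInfinity.mp hO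
  obtain ⟨C', hC'⟩ := exists_norm_fderiv_cutoff_le
  set V := volume.real (ball (0 : E3) 1) with hV
  have hσpos : ∀ x, 0 ≤ σ x := fun x => hσ₀.le.trans (hσ0 x)
  have hσ₁ : 0 ≤ σ₁ := (hσpos 0).trans (hσ1 0)
  -- On the annulus `S ≤ |x| ≤ 2S` one has `d² ≲ S⁻⁴` and `|∇χ|² ≲ S⁻²`, against a volume of order
  -- `S³`; the total is `S⁻³`. The constant `32` is the `4` of `caccioppoli` times `2³` from the
  -- radius `2S`.
  have hball : ∀ ρ S : ℝ, 0 < S → ρ ≤ S → R ≤ S →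
      σ₀ * ∫ x in ball (0 : E3) ρ, ‖d' x‖ ^ 2 ≤ (S ^ 3)⁻¹ * (32 * σ₁ * C ^ 2 * C' ^ 2 * V) := by
    intro ρ S hS hρ hRS
    obtain ⟨hi, hle⟩ := caccioppoli hσ hσpos hσ1 hd hd2 heq (isTest_cutoff hS)
    have hi' : IntegrableOn (fun x => σ₀ * ‖d' x‖ ^ 2) (ball (0 : E3) ρ) :=
      (((hd2 _ (isCompact_closedBall 0 ρ)).2.mono_measure
        (Measure.restrict_mono ball_subset_closedBall le_rfl)).norm.integrable_sq).const_mul σ₀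
    have h1 : σ₀ * ∫ x in ball (0 : E3) ρ, ‖d' x‖ ^ 2 ≤
        ∫ x, σ x * (cutoff S x ^ 2 * ‖d' x‖ ^ 2) := by
      rw [← integral_const_mul, ← integral_indicator measurableSet_ball]
      refine integral_mono (IntegrableOn.integrable_indicator hi' measurableSet_ball) hi fun x => ?_
      by_cases hx : x ∈ ball (0 : E3) ρ
      · rw [Set.indicator_of_mem hx]
        rw [mem_ball_zero_iff] at hx
        simp only
        rw [cutoff_eq_one hS (hx.le.trans hρ), one_pow, one_mul]
        gcongr
        exact hσ0 x
      · rw [Set.indicator_of_notMem hx]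
        have := hσpos x
        positivity
    have h2 : ∫ x, σ x * (d x ^ 2 * ‖fderiv ℝ (cutoff S) x‖ ^ 2) ≤
        ∫ x, (closedBall (0 : E3) (2 * S)).indicator
          (fun _ => σ₁ * ((C * (S ^ 2)⁻¹) ^ 2 * (C' * S⁻¹) ^ 2)) x := by
      refine integral_mono_of_nonneg (ae_of_all _ fun x => by have := hσpos x; positivity)
        ((integrable_indicator_iff measurableSet_closedBall).mpr
          (integrableOn_const measure_closedBall_lt_top.ne)) ?_
      filter_upwards [hC] with x hx
      by_cases hxS : ‖x‖ < S ∨ 2 * S < ‖x‖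
      · rw [fderiv_cutoff_eq_zero hS hxS]
        simp only [norm_zero, ne_eq, OfNat.ofNat_ne_zero, not_false_eq_true, zero_pow, mul_zero]
        exact Set.indicator_nonneg (fun _ _ => by positivity) _
      · rw [not_or, not_lt, not_lt] at hxS
        rw [Set.indicator_of_mem (by simpa using hxS.2)]
        have h3 := hx (hRS.trans hxS.1)
        have hx0 : 0 < ‖x‖ := hS.trans_le hxS.1
        rw [abs_of_pos (show 0 < (‖x‖ ^ 2)⁻¹ by positivity)] at h3
        have hC0 : 0 ≤ C := by
          by_contra h
          have := (abs_nonneg _).trans h3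
          have h5 : 0 < (‖x‖ ^ 2)⁻¹ := by positivity
          nlinarith
        have h4 : |d x| ≤ C * (S ^ 2)⁻¹ := h3.trans (by gcongr; exact hxS.1)
        rw [← sq_abs (d x)]
        exact mul_le_mul (hσ1 x) (mul_le_mul (pow_le_pow_left₀ (abs_nonneg _) h4 2)
          (pow_le_pow_left₀ (norm_nonneg _) (hC' S hS x) 2) (by positivity) (by positivity))
          (by positivity) hσ₁
    have h3 : ∫ x, (closedBall (0 : E3) (2 * S)).indicator
          (fun _ => σ₁ * ((C * (S ^ 2)⁻¹) ^ 2 * (C' * S⁻¹) ^ 2)) x =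
        (S ^ 3)⁻¹ * (8 * σ₁ * C ^ 2 * C' ^ 2 * V) := by
      rw [integral_indicator measurableSet_closedBall, setIntegral_const,
        Measure.addHaar_real_closedBall _ _ (by positivity), finrank_euclideanSpace_fin, smul_eq_mul]
      field_simp
      ring
    linarith
  have hzero : ∀ n : ℕ, ∀ᵐ x, x ∈ ball (0 : E3) n → d' x = 0 := by
    intro n
    have hlim : Tendsto (fun S : ℝ => (S ^ 3)⁻¹ * (32 * σ₁ * C ^ 2 * C' ^ 2 * V)) atTop (𝓝 0) := by
      rw [← zero_mul (32 * σ₁ * C ^ 2 * C' ^ 2 * V)]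
      exact ((tendsto_pow_atTop (α := ℝ) (n := 3) (by norm_num)).inv_tendsto_atTop).mul_const _
    have h1 : σ₀ * ∫ x in ball (0 : E3) n, ‖d' x‖ ^ 2 ≤ 0 := by
      refine ge_of_tendsto hlim ?_
      filter_upwards [eventually_gt_atTop 0, eventually_ge_atTop (n : ℝ), eventually_ge_atTop R]
        with S h₁ h₂ h₃ using hball n S h₁ h₂ h₃
    have h2 : ∫ x in ball (0 : E3) n, ‖d' x‖ ^ 2 = 0 :=
      le_antisymm (by nlinarith) (integral_nonneg fun _ => by positivity)
    have h3 := (integral_eq_zero_iff_of_nonneg (fun x => by positivity)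
      ((hd2 _ (isCompact_closedBall 0 n)).2.mono_measure
        (Measure.restrict_mono ball_subset_closedBall le_rfl)).norm.integrable_sq).mp h2
    rw [Filter.EventuallyEq, ae_restrict_iff' measurableSet_ball] at h3
    filter_upwards [h3] with x hx hxn
    simpa using hx hxn
  filter_upwards [ae_all_iff.mpr hzero] with x hx
  obtain ⟨n, hn⟩ := exists_nat_gt ‖x‖
  exact hx n (mem_ball_zero_iff.mpr hn)

/-! ### The polarization tensor in terms of correctors -/

/-- The contrast field `(σ - s) I`. -/
def contrast (σ : E3 → ℝ) (s : ℝ) (x : E3) : E3 →L[ℝ] E3 :=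
  (σ x - s) • ContinuousLinearMap.id ℝ E3

theorem memLp_contrast {σ : E3 → ℝ} {s σ₁ : ℝ} (hσ : Measurable σ) (h : ∀ x, |σ x| ≤ σ₁) :
    MemLp (contrast σ s) ∞ volume := by
  refine memLp_top_of_bound ((hσ.sub_const s).aestronglyMeasurable.smul_const _)
    ((σ₁ + |s|) * ‖ContinuousLinearMap.id ℝ E3‖) (ae_of_all _ fun x => ?_)
  rw [contrast, norm_smul, Real.norm_eq_abs]
  gcongr
  exact (abs_sub _ _).trans (by linarith [h x])

/-- If the corrector for the direction `a` has vanishing dipole moment, then the conductivity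
problem is solvable and its solutions have no dipole term. -/
theorem conductivity_solution_of_corrector {σ : E3 → ℝ} {s σ₀ σ₁ R : ℝ} (hσ : Measurable σ)
    (hσ₀ : 0 < σ₀) (hσ0 : ∀ x, σ₀ ≤ σ x) (hσ1 : ∀ x, |σ x| ≤ σ₁) (hs : 0 < s) (hR : 0 < R)
    (hσR : ∀ x ∉ ball (0 : E3) R, σ x = s) {a : E3} {p : L2Field}
    (hp : IsCorrector gradSpace s (mulOp (memLp_contrast (s := s) hσ hσ1)) (ballField R a) p)
    (hM : ∀ c, inner ℝ (mulOp (memLp_contrast (s := s) hσ hσ1) (ballField R a + p))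
      (ballField R c) = 0) :
    (∃ u, IsConductivitySolution σ a u) ∧ ∀ u, IsConductivitySolution σ a u →
      (fun x => u x - inner ℝ a x) =O[aeInfinity] fun x => (‖x‖ ^ 3)⁻¹ := by
  set N := mulOp (memLp_contrast (s := s) hσ hσ1) with hN
  have hcR : ∀ x ∉ ball (0 : E3) R, contrast σ s x = 0 := fun x hx => by
    ext y : 1
    simp [contrast, hσR x hx]
  obtain ⟨w, hw6, hw⟩ := exists_potential hp.1
  -- the source field
  set f : E3 → E3 := fun x => s⁻¹ • ((σ x - s) • (a + p x)) with hf
  have hNf : N (ballField R a + p) =ᵐ[volume] fun x => s • f x := by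
    filter_upwards [coeFn_mulOp_ballField_add (memLp_contrast (s := s) hσ hσ1) hcR a
      (ae_eq_refl p)] with x hx
    rw [hx, hf, smul_inv_smul₀ hs.ne']
    simp [contrast]
  have hfR : ∀ x ∉ ball (0 : E3) R, f x = 0 := fun x hx => by simp [hf, hσR x hx]
  have hf2 : MemLp f 2 volume := by
    have h1 : MemLp (fun x => s⁻¹ • N (ballField R a + p) x) 2 volume :=
      (Lp.memLp _).const_smul s⁻¹
    refine h1.ae_eq ?_
    filter_upwards [hNf] with x hx
    rw [hx, inv_smul_smul₀ hs.ne']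
  have hfi : Integrable f := by
    have h1 : IntegrableOn f (ball (0 : E3) R) := by
      have : IsFiniteMeasure (volume.restrict (ball (0 : E3) R)) :=
        ⟨by rw [Measure.restrict_apply_univ]; exact measure_ball_lt_top⟩
      exact (hf2.restrict _).integrable (by norm_num)
    exact h1.integrable_of_forall_notMem_eq_zero hfR
  -- The vanishing of the polarization form in the direction `a` says exactly that the source has
  -- mean zero.
  have hf0 : ∫ x, f x = 0 := by
    refine ext_inner_left ℝ fun c => ?_
    rw [inner_zero_right, ← integral_inner hfi]
    have h1 := hM c
    rw [inner_eq_integral hNf (coeFn_ballField R c)] at h1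
    have h2 : ∀ x, inner ℝ (s • f x) ((ball (0 : E3) R).indicator (fun _ => c) x) =
        s * inner ℝ c (f x) := fun x => by
      by_cases hx : x ∈ ball (0 : E3) R
      · rw [Set.indicator_of_mem hx, real_inner_smul_left, real_inner_comm]
      · simp [hfR x hx]
    simp_rw [h2, integral_const_mul] at h1
    exact (mul_eq_zero.mp h1).resolve_left hs.ne'
  have heq : ∀ φ, IsTest φ → ∫ x, inner ℝ (p x) (gradient φ x) =
      -∫ x, inner ℝ (f x) (gradient φ x) := by
    intro φ hφ
    have h1 := hp.2 _ hφ.gradLp_mem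
    rw [inner_add_left, real_inner_smul_left, inner_eq_integral (ae_eq_refl p) hφ.coeFn_gradLp,
      inner_eq_integral hNf hφ.coeFn_gradLp] at h1
    simp_rw [real_inner_smul_left, integral_const_mul, ← mul_add] at h1
    linarith [(mul_eq_zero.mp h1).resolve_left hs.ne']
  have hpi : ∀ φ, IsTest φ → Integrable fun x => inner ℝ (p x) (gradient φ x) := fun φ hφ =>
    integrable_inner_of_memLp (Lp.memLp p) hφ.memLp_gradient
  -- the solution built from the potential
  have hO3 := isBigO_of_source hw (MemLp.hasVanishingMeans hw6) hfi hR hfR hf0 heq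
  have h32 : (fun x : E3 => (‖x‖ ^ 3)⁻¹) =O[aeInfinity] fun x : E3 => (‖x‖ ^ 2)⁻¹ := by
    refine isBigO_aeInfinity.mpr ⟨1, 1, ae_of_all _ fun x hx => ?_⟩
    rw [abs_of_nonneg (by positivity), abs_of_nonneg (by positivity), one_mul]
    exact inv_anti₀ (by positivity) (pow_le_pow_right₀ hx (by norm_num))
  -- The solution `w + a · x` is written as a difference with `-a`, so that `HasWeakFDerivOn.sub`
  -- applies.
  set u₀' : E3 → E3 →L[ℝ] ℝ := fun x => innerSL ℝ (p x) - innerSL ℝ (-a) with hu₀'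
  have hwu : HasWeakFDerivOn Set.univ (fun x => w x - inner ℝ (-a) x) u₀' :=
    hw.sub (hasWeakFDerivOn_inner (-a))
  have hu2 : ∀ K : Set E3, IsCompact K →
      MemLp (fun x => w x - inner ℝ (-a) x) 2 (volume.restrict K) ∧
      MemLp u₀' 2 (volume.restrict K) := by
    intro K hK
    have : IsFiniteMeasure (volume.restrict K) :=
      ⟨by rw [Measure.restrict_apply_univ]; exact hK.measure_lt_top⟩
    refine ⟨((hw6.restrict K).mono_exponent (by norm_num)).sub ?_, ?_⟩
    · have hc : Continuous fun x : E3 => inner ℝ (-a) x := by fun_prop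
      obtain ⟨C, hC⟩ := hK.exists_bound_of_continuousOn hc.continuousOn
      exact MemLp.of_bound hc.aestronglyMeasurable C
        ((ae_restrict_iff' hK.measurableSet).mpr (ae_of_all _ hC))
    · exact (((innerSL ℝ : E3 →L[ℝ] E3 →L[ℝ] ℝ).comp_memLp' (Lp.memLp p)).restrict K).sub
        (memLp_const _)
  have hu0eq : ∀ φ, IsTest φ → ∫ x, σ x * u₀' x (gradient φ x) = 0 := by
    intro φ hφ
    have e : ∀ x, σ x * u₀' x (gradient φ x) = s * (inner ℝ (f x) (gradient φ x) +
        inner ℝ a (gradient φ x) + inner ℝ (p x) (gradient φ x)) := fun x => by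
      have h1 : s * inner ℝ (f x) (gradient φ x) =
          (σ x - s) * (inner ℝ a (gradient φ x) + inner ℝ (p x) (gradient φ x)) := by
        rw [← real_inner_smul_left, hf, smul_inv_smul₀ hs.ne', real_inner_smul_left,
          inner_add_left]
      simp only [hu₀', sub_apply, innerSL_apply_apply, inner_neg_left]
      linear_combination -h1
    have i₁ : Integrable fun x => inner ℝ (f x) (gradient φ x) :=
      integrable_inner_of_memLp hf2 hφ.memLp_gradient
    have i₂ : Integrable fun x => inner ℝ a (gradient φ x) :=
      (memLp_one_iff_integrable.mp hφ.memLp_gradient).const_inner a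
    simp_rw [e]
    have i₁₂ : Integrable fun x => inner ℝ (f x) (gradient φ x) + inner ℝ a (gradient φ x) :=
      i₁.add i₂
    rw [integral_const_mul, integral_add i₁₂ (hpi φ hφ), integral_add i₁ i₂,
      hφ.integral_inner_gradient a, heq φ hφ]
    ring
  have hu₀ : IsConductivitySolution σ a (fun x => w x - inner ℝ (-a) x) := by
    refine ⟨⟨u₀', hwu, hu2, fun φ hφ hφc => hu0eq φ ⟨hφ, hφc⟩⟩, ?_⟩
    simpa using hO3.trans h32
  refine ⟨⟨_, hu₀⟩, fun u ⟨⟨u', hu', hu2', hueq⟩, huO⟩ => ?_⟩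
  have hint : ∀ {v : E3 → E3 →L[ℝ] ℝ}, LocallyIntegrable v volume → ∀ φ, IsTest φ →
      Integrable fun x => σ x * v x (gradient φ x) := by
    intro v hv φ hφ
    have h1 : Integrable fun x => gradient φ x := memLp_one_iff_integrable.mp hφ.memLp_gradient
    obtain ⟨C, hC⟩ := hφ.continuous_gradient.bounded_above_of_compact_support
      hφ.hasCompactSupport_gradient
    have h2 : IntegrableOn (fun x => v x (gradient φ x)) (tsupport (gradient φ)) := by
      refine ((hv.integrableOn_isCompact hφ.hasCompactSupport_gradient).norm.const_mul C).mono'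
        ((ContinuousLinearMap.id ℝ (E3 →L[ℝ] ℝ)).aestronglyMeasurable_comp₂
          hv.aestronglyMeasurable h1.1).restrict (ae_of_all _ fun x => ?_)
      rw [mul_comm]
      exact (v x).le_of_opNorm_le_of_le le_rfl (hC x)
    have h3 := h2.integrable_of_forall_notMem_eq_zero fun x hx => by
      rw [image_eq_zero_of_notMem_tsupport hx, map_zero]
    exact h3.bdd_mul hσ.aestronglyMeasurable (c := σ₁) (ae_of_all _ hσ1)
  have hdz : (fun x => u' x - u₀' x) =ᵐ[volume] 0 := by
    refine ae_eq_zero_of_weak_solution (σ₁ := σ₁) hσ hσ₀ hσ0 (fun x => (le_abs_self _).trans (hσ1 x))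
      (hu'.sub hwu) (fun K hK => ⟨(hu2' K hK).1.sub (hu2 K hK).1, (hu2' K hK).2.sub (hu2 K hK).2⟩)
      (fun φ hφ => ?_) ?_
    · simp only [sub_apply, mul_sub]
      rw [integral_sub (hint (locallyIntegrableOn_univ.mp hu'.2.1) φ hφ)
        (hint (locallyIntegrableOn_univ.mp hwu.2.1) φ hφ), hueq φ hφ.1 hφ.2, hu0eq φ hφ, sub_zero]
    · refine (huO.sub (hO3.trans h32)).congr_left fun x => ?_
      simp only [inner_neg_left]
      ring
  -- Only the gradients of the two solutions have been identified. The decay estimate is applied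
  -- afresh to `u - a · x`, whose means vanish by its growth condition, so a possible additive
  -- constant needs no separate argument.
  have hfin : HasWeakFDerivOn Set.univ (fun x => u x - inner ℝ a x)
      (fun x => innerSL ℝ (p x)) := by
    refine (hu'.sub (hasWeakFDerivOn_inner a)).congr_ae ?_
    filter_upwards [hdz] with x hx
    rw [Pi.zero_apply, sub_eq_zero] at hx
    simp only [hx, hu₀', map_neg]
    abel
  exact isBigO_of_source hfin (hasVanishingMeans_of_isBigO (locallyIntegrableOn_univ.mp hfin.1) huO)
    hfi hR hfR hf0 heq

end

section


open Filter Topology ContinuousLinearMap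

/-! ### Change of variables -/

/-- The energy is rewritten as the Dirichlet energy of the full field `a + ∇φ` on a large ball,
minus that of the uniform field; the cross term drops out because `∇φ` has mean zero. In this form
it transforms well under a change of variables. -/
theorem energy_gradLp {s R S : ℝ} {B : E3 → E3 →L[ℝ] E3} (hB : MemLp B ∞ volume)
    (hBR : ∀ x ∉ ball (0 : E3) R, B x = 0) (a : E3) {φ : E3 → ℝ} (hφ : IsTest φ) (hRS : R ≤ S)
    (hφS : tsupport φ ⊆ ball (0 : E3) S) :
    energy s (mulOp hB) (ballField R a) hφ.gradLp =
      (∫ x in ball (0 : E3) S, inner ℝ (B x (a + gradient φ x) + s • (a + gradient φ x))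
        (a + gradient φ x)) - s * ‖a‖ ^ 2 * volume.real (ball (0 : E3) S) := by
  have hg0 : ∀ x ∉ ball (0 : E3) S, gradient φ x = 0 := fun x hx => by
    rw [gradient_eq]
    simp only
    rw [image_eq_zero_of_notMem_tsupport fun h => hx (hφS (tsupport_fderiv_subset ℝ h)), map_zero]
  have hg2 : MemLp (gradient φ) 2 volume := hφ.memLp_gradient
  have hgi : Integrable (gradient φ) := memLp_one_iff_integrable.mp hφ.memLp_gradient
  rw [energy, inner_mulOp_ballField hB hBR a a hφ.coeFn_gradLp hφ.coeFn_gradLp,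
    ← real_inner_self_eq_norm_sq, inner_eq_integral hφ.coeFn_gradLp hφ.coeFn_gradLp]
  have i₁ : Integrable fun x => inner ℝ (B x (a + gradient φ x)) (a + gradient φ x) := by
    have hm := (Lp.memLp (mulOp hB (ballField R a + hφ.gradLp)))
    have hm' := (Lp.memLp (ballField R a + hφ.gradLp))
    refine (integrable_inner_of_memLp hm hm').congr ?_
    filter_upwards [coeFn_mulOp_ballField_add hB hBR a hφ.coeFn_gradLp,
      Lp.coeFn_add (ballField R a) hφ.gradLp, coeFn_ballField R a, hφ.coeFn_gradLp]
      with x h₁ h₂ h₃ h₄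
    rw [h₁, h₂, Pi.add_apply, h₃, h₄]
    by_cases hx : x ∈ ball (0 : E3) R
    · simp [hx]
    · simp [hBR x hx]
  have i₂ : Integrable fun x => inner ℝ (gradient φ x) (gradient φ x) :=
    integrable_inner_of_memLp hg2 hg2
  have i₃ : Integrable fun x => inner ℝ a (gradient φ x) := hgi.const_inner a
  have e₁ : ∫ x, inner ℝ (B x (a + gradient φ x)) (a + gradient φ x) =
      ∫ x in ball (0 : E3) S, inner ℝ (B x (a + gradient φ x)) (a + gradient φ x) :=
    (setIntegral_eq_integral_of_forall_compl_eq_zero fun x hx => by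
      rw [hBR x fun h => hx (ball_subset_ball hRS h)]; simp).symm
  have e₂ : ∫ x, inner ℝ (gradient φ x) (gradient φ x) =
      ∫ x in ball (0 : E3) S, inner ℝ (gradient φ x) (gradient φ x) :=
    (setIntegral_eq_integral_of_forall_compl_eq_zero fun x hx => by
      rw [hg0 x hx]; simp).symm
  have e₃ : ∫ x in ball (0 : E3) S, inner ℝ a (gradient φ x) = 0 := by
    rw [setIntegral_eq_integral_of_forall_compl_eq_zero fun x hx => by rw [hg0 x hx]; simp]
    exact hφ.integral_inner_gradient a
  have hcst : IntegrableOn (fun _ : E3 => s * ‖a‖ ^ 2) (ball (0 : E3) S) :=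
    integrableOn_const measure_ball_lt_top.ne
  have e : ∀ x, inner ℝ (B x (a + gradient φ x) + s • (a + gradient φ x)) (a + gradient φ x) =
      inner ℝ (B x (a + gradient φ x)) (a + gradient φ x) +
        s * inner ℝ (gradient φ x) (gradient φ x) + 2 * s * inner ℝ a (gradient φ x) +
        s * ‖a‖ ^ 2 := fun x => by
    rw [inner_add_left, real_inner_smul_left, real_inner_self_eq_norm_sq, norm_add_sq_real,
      real_inner_self_eq_norm_sq]
    ring
  simp_rw [e]
  have j₁ := i₁.integrableOn (s := ball (0 : E3) S)
  have j₂ := (i₂.integrableOn (s := ball (0 : E3) S)).const_mul s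
  have j₃ := (i₃.integrableOn (s := ball (0 : E3) S)).const_mul (2 * s)
  have j₁₂ : IntegrableOn (fun x => inner ℝ (B x (a + gradient φ x)) (a + gradient φ x) +
        s * inner ℝ (gradient φ x) (gradient φ x)) (ball (0 : E3) S) := j₁.add j₂
  have j₁₂₃ : IntegrableOn (fun x => inner ℝ (B x (a + gradient φ x)) (a + gradient φ x) +
        s * inner ℝ (gradient φ x) (gradient φ x) + 2 * s * inner ℝ a (gradient φ x))
        (ball (0 : E3) S) := j₁₂.add j₃
  rw [integral_add j₁₂₃ hcst, integral_add j₁₂ j₃, integral_add j₁ j₂, integral_const_mul,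
    integral_const_mul, e₃, e₁, e₂, setIntegral_const, smul_eq_mul]
  ring

/-- Comparison of polarizations through the energies of test functions. -/
theorem polarization_le_of_energy {s lam₁ : ℝ} {N₁ N₂ : L2Field →L[ℝ] L2Field}
    {v p₁ p₂ : L2Field} (hlam : 0 ≤ lam₁) (hc : IsCoerciveOn gradSpace s lam₁ N₁)
    (hN₁ : ∀ x y, inner ℝ (N₁ x) y = inner ℝ x (N₁ y)) (h₁ : IsCorrector gradSpace s N₁ v p₁)
    (h₂ : IsCorrector gradSpace s N₂ v p₂)
    (h : ∀ φ (hφ : IsTest φ), ∃ ψ, ∃ hψ : IsTest ψ,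
      energy s N₁ v hψ.gradLp = energy s N₂ v hφ.gradLp) :
    inner ℝ (N₁ (v + p₁)) v ≤ inner ℝ (N₂ (v + p₂)) v := by
  obtain ⟨φ, hφ, hlim⟩ := exists_seq_gradLp h₂.1
  rw [← h₂.energy_eq]
  have hcont : Continuous fun q => energy s N₂ v q := by unfold energy; fun_prop
  refine ge_of_tendsto ((hcont.tendsto p₂).comp hlim) (Eventually.of_forall fun n => ?_)
  obtain ⟨ψ, hψ, e⟩ := h _ (hφ n)
  exact (h₁.le_energy hlam hc hN₁ hψ.gradLp_mem).trans_eq e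

theorem isCoerciveOn_mulOp {s lam : ℝ} {B : E3 → E3 →L[ℝ] E3} (hB : MemLp B ∞ volume)
    (h : ∀ x y, lam * ‖y‖ ^ 2 ≤ s * ‖y‖ ^ 2 + inner ℝ (B x y) y) (G : Submodule ℝ L2Field) :
    IsCoerciveOn G s lam (mulOp hB) := by
  intro p _
  have i₁ : Integrable fun x => inner ℝ (p x) (p x) :=
    integrable_inner_of_memLp (Lp.memLp p) (Lp.memLp p)
  have i₂ : Integrable fun x => inner ℝ (mulOp hB p x) (p x) :=
    integrable_inner_of_memLp (Lp.memLp _) (Lp.memLp p)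
  rw [← real_inner_self_eq_norm_sq, inner_eq_integral (ae_eq_refl p) (ae_eq_refl p),
    inner_eq_integral (ae_eq_refl _) (ae_eq_refl p), ← integral_const_mul, ← integral_const_mul,
    ← integral_add (i₁.const_mul s) i₂]
  refine integral_mono_ae (i₁.const_mul lam) ((i₁.const_mul s).add i₂) ?_
  filter_upwards [coeFn_mulOp hB p] with x hx
  simp only [hx, real_inner_self_eq_norm_sq]
  exact h x (p x)

/-- Two media with the same energies have the same polarization form. -/
theorem polarization_eq_of_diag {s lam₁ lam₂ R : ℝ} {N₁ N₂ : L2Field →L[ℝ] L2Field}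
    {p₁ p₂ : E3 → L2Field} (hlam₁ : 0 < lam₁) (hlam₂ : 0 < lam₂)
    (hc₁ : IsCoerciveOn gradSpace s lam₁ N₁) (hc₂ : IsCoerciveOn gradSpace s lam₂ N₂)
    (hN₁ : ∀ x y, inner ℝ (N₁ x) y = inner ℝ x (N₁ y))
    (hN₂ : ∀ x y, inner ℝ (N₂ x) y = inner ℝ x (N₂ y))
    (h₁ : ∀ a, IsCorrector gradSpace s N₁ (ballField R a) (p₁ a))
    (h₂ : ∀ a, IsCorrector gradSpace s N₂ (ballField R a) (p₂ a))
    (h : ∀ a, inner ℝ (N₁ (ballField R a + p₁ a)) (ballField R a) =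
      inner ℝ (N₂ (ballField R a + p₂ a)) (ballField R a)) (a c : E3) :
    inner ℝ (N₁ (ballField R a + p₁ a)) (ballField R c) =
      inner ℝ (N₂ (ballField R a + p₂ a)) (ballField R c) := by
  -- Polarization of the quadratic form: uniqueness makes the corrector additive in the direction,
  -- and symmetry of `N` merges the two cross terms.
  have key : ∀ {lam : ℝ} {N : L2Field →L[ℝ] L2Field} {p : E3 → L2Field}, 0 < lam →
      IsCoerciveOn gradSpace s lam N → (∀ x y, inner ℝ (N x) y = inner ℝ x (N y)) →
      (∀ a, IsCorrector gradSpace s N (ballField R a) (p a)) →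
      inner ℝ (N (ballField R (a + c) + p (a + c))) (ballField R (a + c)) =
        inner ℝ (N (ballField R a + p a)) (ballField R a) +
          inner ℝ (N (ballField R c + p c)) (ballField R c) +
          2 * inner ℝ (N (ballField R a + p a)) (ballField R c) := by
    intro lam N p hlam hc hN hp
    have hadd : p (a + c) = p a + p c := by
      have := (hp a).add (hp c)
      rw [← ballField_add] at this
      exact (hp (a + c)).unique hlam hc this
    have e : ballField R a + ballField R c + (p a + p c) =
      (ballField R a + p a) + (ballField R c + p c) := by abel
    rw [hadd, ballField_add, e, map_add, inner_add_left, inner_add_right, inner_add_right,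
      ← (hp a).polarization_symm hN (hp c)]
    ring
  have k₁ := key hlam₁ hc₁ hN₁ h₁
  have k₂ := key hlam₂ hc₂ hN₂ h₂
  rw [h, h, h, k₂] at k₁
  linarith

/-- The matrix `|det F| F⁻¹ F⁻ᵀ` with `F = 1 + X`. -/
def pullbackMatrix (X : E3 →L[ℝ] E3) : E3 →L[ℝ] E3 :=
  |(1 + X).det| • (Ring.inverse (1 + X) * adjoint (Ring.inverse (1 + X)))

theorem isUnit_one_add {X : E3 →L[ℝ] E3} (hX : ‖X‖ ≤ 1 / 2) : IsUnit (1 + X) := by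
  have : IsUnit (1 - (-X)) := isUnit_one_sub_of_norm_lt_one (by rw [norm_neg]; linarith)
  simpa using this

/-- With `F = 1 + X`, the factors `F⁻¹` and `F⁻ᵀ` cancel the two copies of `Fᵀ`, and what remains is
the Jacobian of the substitution. -/
theorem inner_pullbackMatrix {X : E3 →L[ℝ] E3} (hX : ‖X‖ ≤ 1 / 2) (y : E3) :
    inner ℝ (pullbackMatrix X (adjoint (1 + X) y)) (adjoint (1 + X) y) =
      |(1 + X).det| * ‖y‖ ^ 2 := by
  have hu := isUnit_one_add hX
  have h1 : (1 + X) * Ring.inverse (1 + X) = 1 := Ring.mul_inverse_cancel _ hu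
  have h2 : adjoint (Ring.inverse (1 + X)) (adjoint (1 + X) y) = y := by
    have : adjoint ((1 + X) * Ring.inverse (1 + X)) = 1 := by
      rw [h1]; exact star_one (E3 →L[ℝ] E3)
    rw [ContinuousLinearMap.mul_def, adjoint_comp] at this
    exact DFunLike.congr_fun this y
  rw [pullbackMatrix, FunLike.coe_smul, Pi.smul_apply, real_inner_smul_left,
    mul_apply_eq_comp, h2, adjoint_inner_right]
  have h3 : (1 + X) (Ring.inverse (1 + X) y) = y := DFunLike.congr_fun h1 y
  rw [h3, real_inner_self_eq_norm_sq]

theorem pullbackMatrix_symm (X : E3 →L[ℝ] E3) (y z : E3) :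
    inner ℝ (pullbackMatrix X y) z = inner ℝ y (pullbackMatrix X z) := by
  simp only [pullbackMatrix, FunLike.coe_smul, Pi.smul_apply, real_inner_smul_left,
    real_inner_smul_right, mul_apply_eq_comp]
  generalize Ring.inverse (1 + X) = A
  rw [← adjoint_inner_right A, ← adjoint_inner_left A]

/-- A smooth perturbation of the identity, supported in the ball of radius `R`. -/
structure IsDisplacement (R : ℝ) (V : E3 → E3) : Prop where
  contDiff : ContDiff ℝ (⊤ : ℕ∞) V
  eq_zero : ∀ x ∉ ball (0 : E3) R, V x = 0
  norm_fderiv_le : ∀ x, ‖fderiv ℝ V x‖ ≤ 1 / 2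

namespace IsDisplacement

variable {R : ℝ} {V : E3 → E3}

theorem lipschitz (h : IsDisplacement R V) : LipschitzWith (1 / 2) V :=
  lipschitzWith_of_nnnorm_fderiv_le (h.contDiff.differentiable (by simp)) fun x => by
    rw [← NNReal.coe_le_coe]
    simpa using h.norm_fderiv_le x

theorem approximatesLinearOn (h : IsDisplacement R V) :
    ApproximatesLinearOn (fun x => x + V x) (ContinuousLinearEquiv.refl ℝ E3 : E3 →L[ℝ] E3)
      Set.univ (1 / 2) := by
  rw [ApproximatesLinearOn.approximatesLinearOn_iff_lipschitzOnWith]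
  have : (fun x => x + V x) - ⇑(ContinuousLinearEquiv.refl ℝ E3 : E3 →L[ℝ] E3) = V := by
    ext1 x
    simp
  rw [this]
  exact h.lipschitz.lipschitzOnWith

/-- The diffeomorphism `x ↦ x + V x`. -/
def homeomorph (h : IsDisplacement R V) : E3 ≃ₜ E3 :=
  h.approximatesLinearOn.toHomeomorph _ (Or.inr (by
    have : ‖((ContinuousLinearEquiv.refl ℝ E3).symm : E3 →L[ℝ] E3)‖₊ = 1 := by
      rw [← NNReal.coe_inj]; simp
    rw [this, inv_one]
    norm_num))

theorem homeomorph_apply (h : IsDisplacement R V) (x : E3) : h.homeomorph x = x + V x := rfl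

theorem contDiff_homeomorph (h : IsDisplacement R V) : ContDiff ℝ (⊤ : ℕ∞) h.homeomorph :=
  contDiff_id.add h.contDiff

theorem hasFDerivAt (h : IsDisplacement R V) (x : E3) :
    HasFDerivAt h.homeomorph (1 + fderiv ℝ V x) x :=
  (hasFDerivAt_id x).add (h.contDiff.differentiable (by simp) x).hasFDerivAt

theorem contDiff_symm (h : IsDisplacement R V) : ContDiff ℝ (⊤ : ℕ∞) h.homeomorph.symm := by
  have hu := fun x => isUnit_one_add (h.norm_fderiv_le x)
  refine h.homeomorph.contDiff_symm (f₀' := fun x =>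
    ContinuousLinearEquiv.unitsEquiv ℝ E3 (hu x).unit) (fun x => ?_) h.contDiff_homeomorph
  exact h.hasFDerivAt x

theorem homeomorph_eq_self (h : IsDisplacement R V) {x : E3} (hx : x ∉ ball (0 : E3) R) :
    h.homeomorph x = x := by rw [homeomorph_apply, h.eq_zero x hx, add_zero]

theorem image_ball (h : IsDisplacement R V) {S : ℝ} (hS : R ≤ S) :
    h.homeomorph '' ball (0 : E3) S = ball (0 : E3) S := by
  have hRS : ∀ x ∉ ball (0 : E3) S, h.homeomorph x = x := fun x hx =>
    h.homeomorph_eq_self fun hx' => hx (ball_subset_ball hS hx')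
  ext y
  constructor
  · rintro ⟨x, hx, rfl⟩
    by_contra hy
    have := h.homeomorph.injective (hRS _ hy)
    exact hy (by rwa [this])
  · intro hy
    obtain ⟨x, rfl⟩ := h.homeomorph.surjective y
    refine ⟨x, ?_, rfl⟩
    by_contra hx
    rw [hRS x hx] at hy
    exact hx hy

theorem isTest_comp (h : IsDisplacement R V) {φ : E3 → ℝ} (hφ : IsTest φ) :
    IsTest fun x => φ (h.homeomorph x) :=
  ⟨hφ.1.comp h.contDiff_homeomorph, hφ.2.comp_homeomorph h.homeomorph⟩

theorem isTest_comp_symm (h : IsDisplacement R V) {φ : E3 → ℝ} (hφ : IsTest φ) :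
    IsTest fun x => φ (h.homeomorph.symm x) :=
  ⟨hφ.1.comp h.contDiff_symm, hφ.2.comp_homeomorph h.homeomorph.symm⟩

theorem isTest_inner (h : IsDisplacement R V) (a : E3) : IsTest fun x => inner ℝ a (V x) :=
  ⟨contDiff_const.inner ℝ h.contDiff, HasCompactSupport.intro (isCompact_closedBall 0 R)
    fun x hx => by rw [h.eq_zero x fun h' => hx (ball_subset_closedBall h'), inner_zero_right]⟩

/-- The pullback of a test function, corrected so that `a + ∇φ` is pulled back as a field. -/
def pullback (h : IsDisplacement R V) (a : E3) (φ : E3 → ℝ) (x : E3) : ℝ :=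
  φ (h.homeomorph x) + inner ℝ a (V x)

theorem isTest_pullback (h : IsDisplacement R V) (a : E3) {φ : E3 → ℝ} (hφ : IsTest φ) :
    IsTest (h.pullback a φ) := (h.isTest_comp hφ).add (h.isTest_inner a)

theorem add_gradient_pullback (h : IsDisplacement R V) (a : E3) {φ : E3 → ℝ} (hφ : IsTest φ)
    (x : E3) : a + gradient (h.pullback a φ) x =
      adjoint (1 + fderiv ℝ V x) (a + gradient φ (h.homeomorph x)) := by
  refine ext_inner_right ℝ fun y => ?_
  have h1 := ((hφ.differentiable (h.homeomorph x)).hasFDerivAt.comp x (h.hasFDerivAt x)).add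
    ((innerSL ℝ a).hasFDerivAt.comp x (h.contDiff.differentiable (by simp) x).hasFDerivAt)
  have h2 : HasFDerivAt (h.pullback a φ) _ x := h1
  rw [inner_add_left, inner_gradient_left, h2.fderiv, adjoint_inner_left, inner_add_left,
    inner_gradient_left]
  simp only [add_apply, coe_comp, Function.comp, one_apply_eq_self, map_add,
    innerSL_apply_apply, inner_add_right]
  ring

theorem exists_pullback_eq (h : IsDisplacement R V) (a : E3) {ψ : E3 → ℝ} (hψ : IsTest ψ) :
    ∃ φ, IsTest φ ∧ h.pullback a φ = ψ := by
  refine ⟨fun x => (ψ - fun y => inner ℝ a (V y)) (h.homeomorph.symm x),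
    h.isTest_comp_symm (hψ.sub (h.isTest_inner a)), ?_⟩
  ext x
  simp [pullback]

/-- The contrast field of the medium `σ` pulled back to the reference configuration. -/
def pullbackContrast (_ : IsDisplacement R V) (σ' : E3 → ℝ) (s : ℝ) (x : E3) : E3 →L[ℝ] E3 :=
  σ' x • pullbackMatrix (fderiv ℝ V x) - s • 1

/-- The diffeomorphism maps a large ball onto itself, so the Dirichlet energies agree by the
substitution rule, and the energy of the uniform field subtracted in `energy_gradLp` is the same on
both sides. -/
theorem energy_pullback (h : IsDisplacement R V) {σ σ' : E3 → ℝ} {s : ℝ}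
    (hσσ' : ∀ x, σ (h.homeomorph x) = σ' x)
    (hB : MemLp (contrast σ s) ∞ volume) (hB' : MemLp (h.pullbackContrast σ' s) ∞ volume)
    (hBR : ∀ x ∉ ball (0 : E3) R, contrast σ s x = 0)
    (hBR' : ∀ x ∉ ball (0 : E3) R, h.pullbackContrast σ' s x = 0) (a : E3) {φ : E3 → ℝ}
    (hφ : IsTest φ) :
    energy s (mulOp hB') (ballField R a) (h.isTest_pullback a hφ).gradLp =
      energy s (mulOp hB) (ballField R a) hφ.gradLp := by
  obtain ⟨S, hS⟩ : ∃ S, tsupport φ ∪ tsupport (h.pullback a φ) ∪ closedBall (0 : E3) R ⊆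
      ball (0 : E3) S :=
    ((hφ.2.isCompact.union (h.isTest_pullback a hφ).2.isCompact).union
      (isCompact_closedBall 0 R)).isBounded.subset_ball 0
  obtain ⟨S', hS'S, hS'R⟩ : ∃ S', S ≤ S' ∧ R ≤ S' := ⟨max S R, le_max_left _ _, le_max_right _ _⟩
  have hsub : ∀ x ∈ tsupport φ ∪ tsupport (h.pullback a φ) ∪ closedBall (0 : E3) R,
    x ∈ ball (0 : E3) S' := fun x hx => ball_subset_ball hS'S (hS hx)
  rw [energy_gradLp hB' hBR' a (h.isTest_pullback a hφ) hS'R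
      fun x hx => hsub x (Or.inl (Or.inr hx)),
    energy_gradLp hB hBR a hφ hS'R fun x hx => hsub x (Or.inl (Or.inl hx))]
  congr 1
  conv_rhs => rw [← h.image_ball hS'R]
  rw [integral_image_eq_integral_abs_det_fderiv_smul volume measurableSet_ball
    (fun x _ => (h.hasFDerivAt x).hasFDerivWithinAt) h.homeomorph.injective.injOn]
  refine integral_congr_ae (ae_of_all _ fun x => ?_)
  simp only
  rw [h.add_gradient_pullback a hφ, smul_eq_mul]
  set y := a + gradient φ (h.homeomorph x)
  have e1 : h.pullbackContrast σ' s x (adjoint (1 + fderiv ℝ V x) y) +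
      s • adjoint (1 + fderiv ℝ V x) y =
      σ' x • pullbackMatrix (fderiv ℝ V x) (adjoint (1 + fderiv ℝ V x) y) := by
    simp [pullbackContrast]
  have e2 : contrast σ s (h.homeomorph x) y + s • y = σ' x • y := by
    simp [contrast, hσσ', sub_smul]
  rw [e1, e2, real_inner_smul_left, inner_pullbackMatrix (h.norm_fderiv_le x),
    real_inner_smul_left, real_inner_self_eq_norm_sq]
  ring

theorem mulOp_pullbackContrast_symm (h : IsDisplacement R V) {σ' : E3 → ℝ} {s : ℝ}
    (hB : MemLp (h.pullbackContrast σ' s) ∞ volume) (x y : L2Field) :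
    inner ℝ (mulOp hB x) y = inner ℝ x (mulOp hB y) := by
  refine mulOp_symm hB (fun z v w => ?_) x y
  simp only [pullbackContrast, sub_apply, FunLike.coe_smul, Pi.smul_apply, inner_sub_left,
    inner_sub_right, real_inner_smul_left, real_inner_smul_right, pullbackMatrix_symm,
    one_apply_eq_self]

/-- The polarization form does not change under a compactly supported change of variables. -/
theorem polarization_pullback (h : IsDisplacement R V) {σ σ' : E3 → ℝ} {s lam₁ lam₂ : ℝ}
    (hσσ' : ∀ x, σ (h.homeomorph x) = σ' x) (hlam₁ : 0 < lam₁) (hlam₂ : 0 < lam₂)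
    (hB : MemLp (contrast σ s) ∞ volume) (hB' : MemLp (h.pullbackContrast σ' s) ∞ volume)
    (hBR : ∀ x ∉ ball (0 : E3) R, contrast σ s x = 0)
    (hBR' : ∀ x ∉ ball (0 : E3) R, h.pullbackContrast σ' s x = 0)
    (hc : IsCoerciveOn gradSpace s lam₁ (mulOp hB))
    (hc' : IsCoerciveOn gradSpace s lam₂ (mulOp hB')) {p p' : E3 → L2Field}
    (hp : ∀ a, IsCorrector gradSpace s (mulOp hB) (ballField R a) (p a))
    (hp' : ∀ a, IsCorrector gradSpace s (mulOp hB') (ballField R a) (p' a)) (a c : E3) :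
    inner ℝ (mulOp hB (ballField R a + p a)) (ballField R c) =
      inner ℝ (mulOp hB' (ballField R a + p' a)) (ballField R c) := by
  have hN : ∀ x y, inner ℝ (mulOp hB x) y = inner ℝ x (mulOp hB y) :=
    mulOp_symm hB fun z v w => by
      simp [contrast, real_inner_smul_left, real_inner_smul_right]
  have hN' := h.mulOp_pullbackContrast_symm hB'
  refine polarization_eq_of_diag hlam₁ hlam₂ hc hc' hN hN' hp hp' (fun a => ?_) a c
  -- Pulling back is a bijection on test functions that preserves the energy. Each inequality
  -- between the two minima transports competitors in one of the two directions.
  apply le_antisymm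
  · refine polarization_le_of_energy hlam₁.le hc hN (hp a) (hp' a) fun ψ hψ => ?_
    obtain ⟨φ, hφ, rfl⟩ := h.exists_pullback_eq a hψ
    exact ⟨φ, hφ, (h.energy_pullback hσσ' hB hB' hBR hBR' a hφ).symm⟩
  · refine polarization_le_of_energy hlam₂.le hc' hN' (hp' a) (hp a) fun φ hφ =>
      ⟨_, h.isTest_pullback a hφ, h.energy_pullback hσσ' hB hB' hBR hBR' a hφ⟩

end IsDisplacement

end

section


open Filter Topology ContinuousLinearMap

/-! ### The concentric neutral configuration -/

theorem memLp_of_norm_le_const {F : Type*} [NormedAddCommGroup F] {f : E3 → F} {r C : ℝ}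
    (hf : AEStronglyMeasurable f volume) (hC : ∀ x, ‖f x‖ ≤ C)
    (h0 : ∀ x ∉ closedBall (0 : E3) r, f x = 0) : MemLp f 2 volume := by
  have : IsFiniteMeasure (volume.restrict (closedBall (0 : E3) r)) :=
    ⟨by rw [Measure.restrict_apply_univ]; exact measure_closedBall_lt_top⟩
  exact memLp_of_norm_le (g := fun _ => (1 : ℝ)) (memLp_const 1) hf (C := C)
    (fun x => by simpa using hC x) h0

/-- The divergence identity `div ((a · ∇φ) x - (x · ∇φ) a) = 2 a · ∇φ`, integrated against a
function with a weak gradient. -/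
theorem HasWeakFDerivOn.integral_curl {ρ : E3 → ℝ} {Z : E3 → E3 →L[ℝ] ℝ}
    (h : HasWeakFDerivOn Set.univ ρ Z) {φ : E3 → ℝ} (hφ : IsTest φ) (a : E3) :
    Integrable (fun x => fderiv ℝ φ x a * Z x x - fderiv ℝ φ x x * Z x a) ∧
    ∫ x, (fderiv ℝ φ x a * Z x x - fderiv ℝ φ x x * Z x a) =
      -2 * ∫ x, ρ x * fderiv ℝ φ x a := by
  have hρ : LocallyIntegrable ρ volume := locallyIntegrableOn_univ.mp h.1
  have hZ : LocallyIntegrable Z volume := locallyIntegrableOn_univ.mp h.2.1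
  have iρ : ∀ {ψ : E3 → ℝ}, IsTest ψ → Integrable fun x => ψ x * ρ x := fun hψ =>
    hρ.integrable_smul_left_of_hasCompactSupport hψ.1.continuous hψ.2
  have iZ : ∀ {ψ : E3 → ℝ}, IsTest ψ → ∀ v, Integrable fun x => ψ x * Z x v := fun hψ v =>
    (hZ.integrable_smul_left_of_hasCompactSupport hψ.1.continuous hψ.2).apply_continuousLinearMap v
  have hd : ∀ x, HasFDerivAt (fderiv ℝ φ) (fderiv ℝ (fderiv ℝ φ) x) x := fun x =>
    ((hφ.1.fderiv_right (m := (⊤ : ℕ∞)) (by simp)).differentiable (by simp) x).hasFDerivAt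
  have hsym : ∀ x v w, fderiv ℝ (fderiv ℝ φ) x v w = fderiv ℝ (fderiv ℝ φ) x w v := fun x v w =>
    (hφ.1.contDiffAt.isSymmSndFDerivAt (by
      simp only [minSmoothness_of_isRCLikeNormedField]
      exact WithTop.coe_le_coe.mpr (le_top : (2 : ℕ∞) ≤ ⊤))) v w
  have h1 : ∀ j : Fin 3, IsTest fun x => x j * fderiv ℝ φ x a := fun j =>
    (hφ.fderiv_apply a).mul_left (EuclideanSpace.proj j : E3 →L[ℝ] ℝ).contDiff
  have h2 : IsTest fun x => fderiv ℝ φ x x :=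
    ⟨(hφ.1.fderiv_right (m := (⊤ : ℕ∞)) (by simp)).clm_apply contDiff_id,
      (hφ.2.fderiv ℝ).mono fun x hx => by
        simp only [Function.mem_support] at hx ⊢
        exact fun h0 => hx (by rw [h0]; rfl)⟩
  have d1 : ∀ j x v, fderiv ℝ (fun x : E3 => x j * fderiv ℝ φ x a) x v =
      x j * fderiv ℝ (fderiv ℝ φ) x v a + v j * fderiv ℝ φ x a := fun j x v => by
    have := ((EuclideanSpace.proj j : E3 →L[ℝ] ℝ).hasFDerivAt (x := x)).mul
      ((hd x).clm_apply (hasFDerivAt_const a x))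
    have e : HasFDerivAt (fun x : E3 => x j * fderiv ℝ φ x a) _ x := this
    rw [e.fderiv]
    simp [mul_comm]
  have d2 : ∀ x v, fderiv ℝ (fun x : E3 => fderiv ℝ φ x x) x v =
      fderiv ℝ (fderiv ℝ φ) x v x + fderiv ℝ φ x v := fun x v => by
    have e : HasFDerivAt (fun x : E3 => fderiv ℝ φ x x) _ x :=
      (hd x).clm_apply (hasFDerivAt_id x)
    rw [e.fderiv]
    simp [add_comm]
  have e1 : ∀ x, fderiv ℝ φ x a * Z x x =
      ∑ j : Fin 3, (x j * fderiv ℝ φ x a) * Z x (EuclideanSpace.single j 1) := fun x => by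
    rw [clm_eq_sum (Z x), Finset.mul_sum]
    exact Finset.sum_congr rfl fun j _ => by ring
  -- The Hessian terms cancel by symmetry of second derivatives. The divergence of `x` contributes
  -- `3` and the derivative of `x` along `a` subtracts `1`.
  have e2 : ∀ x, ∑ j : Fin 3, fderiv ℝ (fun x : E3 => x j * fderiv ℝ φ x a) x
      (EuclideanSpace.single j 1) - fderiv ℝ (fun x : E3 => fderiv ℝ φ x x) x a =
      2 * fderiv ℝ φ x a := fun x => by
    simp only [d1, d2]
    have := clm_eq_sum ((fderiv ℝ (fderiv ℝ φ) x).flip a) x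
    simp only [flip_apply] at this
    rw [hsym x a x, this]
    simp [Fin.sum_univ_three]
    ring
  simp_rw [e1]
  refine ⟨(integrable_finsetSum _ fun j _ => iZ (h1 j) _).sub (iZ h2 a), ?_⟩
  rw [integral_sub (integrable_finsetSum _ fun j _ => iZ (h1 j) _) (iZ h2 a),
    integral_finsetSum _ fun j _ => iZ (h1 j) _]
  have k1 : ∀ j : Fin 3, ∫ x, (x j * fderiv ℝ φ x a) * Z x (EuclideanSpace.single j 1) =
      -∫ x, fderiv ℝ (fun x : E3 => x j * fderiv ℝ φ x a) x (EuclideanSpace.single j 1) * ρ x :=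
    fun j => by rw [h.integral_eq (h1 j), neg_neg]
  have k2 : ∫ x, fderiv ℝ φ x x * Z x a =
      -∫ x, fderiv ℝ (fun x : E3 => fderiv ℝ φ x x) x a * ρ x := by
    rw [h.integral_eq h2, neg_neg]
  have k3 : (∑ j : Fin 3, ∫ x, fderiv ℝ (fun x : E3 => x j * fderiv ℝ φ x a) x
      (EuclideanSpace.single j 1) * ρ x) - ∫ x, fderiv ℝ (fun x : E3 => fderiv ℝ φ x x) x a * ρ x =
      2 * ∫ x, ρ x * fderiv ℝ φ x a := by
    rw [← integral_finsetSum _ fun j _ => iρ ((h1 j).fderiv_apply _),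
      ← integral_sub (integrable_finsetSum _ fun j _ => iρ ((h1 j).fderiv_apply _))
      (iρ (h2.fderiv_apply a)), ← integral_const_mul]
    refine integral_congr_ae (ae_of_all _ fun x => ?_)
    simp only
    rw [← Finset.sum_mul, ← sub_mul, e2]
    ring
  rw [k2, Finset.sum_congr rfl fun j _ => k1 j, Finset.sum_neg_distrib]
  linarith

/-- The profile of the dipole field in the shell, continued by constants. -/
def shellProfile (ri re : ℝ) (x : E3) : ℝ := (max ri (min ‖x‖ re) ^ 3)⁻¹ - (re ^ 3)⁻¹

open Classical in
/-- The gradient of `shellProfile`. -/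
def shellProfileGrad (ri re : ℝ) (x : E3) : E3 :=
  if ri < ‖x‖ ∧ ‖x‖ < re then (-3 * (‖x‖ ^ 5)⁻¹) • x else 0

theorem exists_lipschitzWith_shellProfile {ri : ℝ} (hri : 0 < ri) (re : ℝ) :
    ∃ C, LipschitzWith C (shellProfile ri re) := by
  have h1 : LipschitzOnWith (3 / ri ^ 4).toNNReal (fun t : ℝ => (t ^ 3)⁻¹ - (re ^ 3)⁻¹)
      (Set.Ici ri) := by
    refine (convex_Ici ri).lipschitzOnWith_of_nnnorm_hasDerivWithin_le
      (f' := fun t => -(3 * t ^ 2) / (t ^ 3) ^ 2) (fun t ht => ?_) fun t ht => ?_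
    · have ht0 : (0 : ℝ) < t := hri.trans_le ht
      have := ((hasDerivAt_pow 3 t).inv (by positivity)).sub_const ((re ^ 3)⁻¹)
      exact (this.congr_deriv (by norm_num)).hasDerivWithinAt
    · have ht0 : (0 : ℝ) < t := hri.trans_le ht
      rw [← NNReal.coe_le_coe, Real.coe_toNNReal _ (by positivity), coe_nnnorm, Real.norm_eq_abs,
        neg_div, abs_neg, abs_of_nonneg (by positivity)]
      have : 3 * t ^ 2 / (t ^ 3) ^ 2 = 3 / t ^ 4 := by field_simp
      rw [this]
      have : ri ≤ t := ht
      gcongr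
  have h2 : LipschitzWith 1 fun x : E3 => max ri (min ‖x‖ re) :=
    (lipschitzWith_one_norm.min_const re).const_max ri
  have := h1.comp (h2.lipschitzOnWith (s := Set.univ)) fun x _ =>
    Set.mem_Ici.mpr (le_max_left _ _)
  exact ⟨_, lipschitzOnWith_univ.mp this⟩

theorem shellProfile_of_le {ri re : ℝ} {x : E3} (hx : ‖x‖ ≤ ri) (hr : ri < re) :
    shellProfile ri re x = (ri ^ 3)⁻¹ - (re ^ 3)⁻¹ := by
  rw [shellProfile, min_eq_left (hx.trans hr.le), max_eq_left hx]

theorem shellProfile_of_mem {ri re : ℝ} {x : E3} (hx : ri ≤ ‖x‖) (hx' : ‖x‖ ≤ re) :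
    shellProfile ri re x = (‖x‖ ^ 3)⁻¹ - (re ^ 3)⁻¹ := by
  rw [shellProfile, min_eq_left hx', max_eq_right hx]

theorem shellProfile_of_ge {ri re : ℝ} {x : E3} (hx : re ≤ ‖x‖) (hr : ri < re) :
    shellProfile ri re x = 0 := by
  rw [shellProfile, min_eq_right hx, max_eq_right hr.le, sub_self]

theorem hasFDerivAt_shellProfile {ri re : ℝ} (hri : 0 < ri) (hr : ri < re) {x : E3}
    (h1 : ‖x‖ ≠ ri) (h2 : ‖x‖ ≠ re) :
    HasFDerivAt (shellProfile ri re) (innerSL ℝ (shellProfileGrad ri re x)) x := by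
  rcases h1.lt_or_gt with h | h
  · have : shellProfileGrad ri re x = 0 := by simp [shellProfileGrad, h.not_gt]
    rw [this, map_zero]
    refine (hasFDerivAt_const ((ri ^ 3)⁻¹ - (re ^ 3)⁻¹) x).congr_of_eventuallyEq ?_
    filter_upwards [continuous_norm.continuousAt.eventually (gt_mem_nhds h)] with y hy
    exact shellProfile_of_le hy.le hr
  rcases h2.lt_or_gt with h' | h'
  · have hx0 : 0 < ‖x‖ := hri.trans h
    have hx : x ≠ 0 := norm_pos_iff.mp hx0
    have e : shellProfileGrad ri re x = (-3 * (‖x‖ ^ 5)⁻¹) • x := by simp [shellProfileGrad, h, h']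
    have hn : HasFDerivAt (fun y : E3 => ‖y‖) (‖x‖⁻¹ • innerSL ℝ x) x := by
      have := (hasStrictFDerivAt_norm_sq x).hasFDerivAt.sqrt (by positivity)
      simp only [Real.sqrt_sq (norm_nonneg _)] at this
      refine this.congr_fderiv ?_
      ext y
      simp
      field_simp
    have hp := ((hasDerivAt_pow 3 ‖x‖).inv (by positivity)).sub_const ((re ^ 3)⁻¹)
    have := hp.comp_hasFDerivAt x hn
    rw [e]
    refine (this.congr_fderiv ?_).congr_of_eventuallyEq ?_
    · ext y
      simp
      field_simp
    · filter_upwards [continuous_norm.continuousAt.eventually (lt_mem_nhds h),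
        continuous_norm.continuousAt.eventually (gt_mem_nhds h')] with y hy hy'
      exact shellProfile_of_mem hy.le hy'.le
  · have : shellProfileGrad ri re x = 0 := by simp [shellProfileGrad, h'.not_gt]
    rw [this, map_zero]
    refine (hasFDerivAt_const (0 : ℝ) x).congr_of_eventuallyEq ?_
    filter_upwards [continuous_norm.continuousAt.eventually (lt_mem_nhds h')] with y hy
    exact shellProfile_of_ge hy.le hr

theorem ae_norm_ne (r : ℝ) : ∀ᵐ x : E3, ‖x‖ ≠ r := by
  have := Measure.addHaar_sphere (volume : Measure E3) 0 r
  rw [← compl_compl (sphere (0 : E3) r)] at this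
  filter_upwards [mem_ae_iff.mpr this] with x hx
  simpa using hx

theorem norm_shellProfileGrad_le {ri re : ℝ} (hri : 0 < ri) (x : E3) :
    ‖shellProfileGrad ri re x‖ ≤ 3 / ri ^ 4 := by
  rw [shellProfileGrad]
  split_ifs with h
  · have hx0 : 0 < ‖x‖ := hri.trans h.1
    rw [norm_smul, Real.norm_eq_abs, abs_mul, abs_of_pos (by positivity : 0 < (‖x‖ ^ 5)⁻¹)]
    have : |(-3 : ℝ)| * (‖x‖ ^ 5)⁻¹ * ‖x‖ = 3 / ‖x‖ ^ 4 := by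
      norm_num
      field_simp
    rw [this]
    have := h.1.le
    gcongr
  · rw [norm_zero]; positivity

theorem measurable_shellProfileGrad (ri re : ℝ) : Measurable (shellProfileGrad ri re) := by
  refine Measurable.ite ?_ (by fun_prop) measurable_const
  exact (measurableSet_lt measurable_const measurable_norm).inter
    (measurableSet_lt measurable_norm measurable_const)

/-- The profile has kinks on the two spheres. It is Lipschitz, so integration by parts holds with
the almost everywhere derivative, and the spheres are null sets. -/
theorem hasWeakFDerivOn_shellProfile {ri re : ℝ} (hri : 0 < ri) (hr : ri < re) :
    HasWeakFDerivOn Set.univ (shellProfile ri re)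
      (fun x => innerSL ℝ (shellProfileGrad ri re x)) := by
  obtain ⟨C, hC⟩ := exists_lipschitzWith_shellProfile hri re
  refine ⟨locallyIntegrableOn_univ.mpr hC.continuous.locallyIntegrable, ?_, ?_⟩
  · rw [locallyIntegrableOn_univ]
    refine (locallyIntegrable_const (3 / ri ^ 4)).mono ?_ (ae_of_all _ fun x => ?_)
    · exact (innerSL ℝ : E3 →L[ℝ] _).continuous.comp_aestronglyMeasurable
        (measurable_shellProfileGrad ri re).aestronglyMeasurable
    · rw [innerSL_apply_norm]
      exact (norm_shellProfileGrad_le hri x).trans (le_abs_self _)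
  · intro φ hφ hφc _ v
    obtain ⟨D, hD⟩ := ContDiff.lipschitzWith_of_hasCompactSupport hφc hφ (by simp)
    have := LipschitzWith.integral_lineDeriv_mul_eq (μ := (volume : Measure E3)) hC hD hφc v
    have e1 : ∫ x, lineDeriv ℝ (shellProfile ri re) x v * φ x =
        ∫ x, φ x • innerSL ℝ (shellProfileGrad ri re x) v := by
      refine integral_congr_ae ?_
      filter_upwards [ae_norm_ne ri, ae_norm_ne re] with x h1 h2
      rw [((hasFDerivAt_shellProfile hri hr h1 h2).hasLineDerivAt v).lineDeriv, smul_eq_mul, mul_comm]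
    have e2 : ∀ x, lineDeriv ℝ φ x (-v) * shellProfile ri re x =
        -(fderiv ℝ φ x v • shellProfile ri re x) := fun x => by
      rw [((hφ.differentiable (by simp)) x).lineDeriv_eq_fderiv, map_neg, smul_eq_mul, neg_mul]
    rw [e1] at this
    simp_rw [e2] at this
    rw [integral_neg] at this
    rw [this, neg_neg]

theorem shellProfileGrad_of_ge {ri re : ℝ} {x : E3} (hx : re ≤ ‖x‖) :
    shellProfileGrad ri re x = 0 := by simp [shellProfileGrad, hx.not_gt]

/-- A test function that is linear on a ball. -/
theorem exists_isTest_linear (a : E3) {R : ℝ} (hR : 0 < R) :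
    ∃ χ : E3 → ℝ, IsTest χ ∧ ∀ x ∈ ball (0 : E3) R, χ x = inner ℝ a x ∧
      fderiv ℝ χ x = innerSL ℝ a := by
  refine ⟨_, (isTest_cutoff hR).mul_left (φ := fun x => inner ℝ a x)
    (contDiff_const.inner ℝ contDiff_id), fun x hx => ?_⟩
  have h : ∀ y ∈ ball (0 : E3) R, (fun x => inner ℝ a x) y * cutoff R y = innerSL ℝ a y :=
    fun y hy => by
      rw [cutoff_eq_one hR (mem_ball_zero_iff.mp hy).le, mul_one, innerSL_apply_apply]
  refine ⟨h x hx, ?_⟩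
  have e : ((fun x => inner ℝ a x) * cutoff R) =ᶠ[𝓝 x] innerSL ℝ a := by
    filter_upwards [isOpen_ball.mem_nhds hx] with y hy
    exact h y hy
  rw [e.fderiv_eq, ContinuousLinearMap.fderiv]

/-- The integral of the weak derivative of a function with compact support vanishes. -/
theorem HasWeakFDerivOn.integral_apply_eq_zero {w : E3 → ℝ} {w' : E3 → E3 →L[ℝ] ℝ}
    (h : HasWeakFDerivOn Set.univ w w') {r : ℝ} (hr : 0 < r) (hw : ∀ x ∉ ball (0 : E3) r, w x = 0)
    (hw' : ∀ x ∉ ball (0 : E3) r, w' x = 0) (v : E3) : ∫ x, w' x v = 0 := by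
  have := h.integral_eq (isTest_cutoff hr) v
  have e1 : ∀ x, fderiv ℝ (cutoff r) x v * w x = 0 := fun x => by
    by_cases hx : x ∈ ball (0 : E3) r
    · rw [fderiv_cutoff_eq_zero hr (Or.inl (mem_ball_zero_iff.mp hx))]; simp
    · rw [hw x hx, mul_zero]
  have e2 : ∀ x, cutoff r x * w' x v = w' x v := fun x => by
    by_cases hx : x ∈ ball (0 : E3) r
    · rw [cutoff_eq_one hr (mem_ball_zero_iff.mp hx).le, one_mul]
    · rw [hw' x hx]; simp
  simp_rw [e1, e2, integral_zero] at this
  linarith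

/-- The strength of the dipole field in the shell. -/
def dipoleStrength (σs σm re : ℝ) : ℝ := re ^ 3 * (1 - σm / σs) / 3

/-- The perturbation of the uniform field `a` by the concentric neutral inclusion. -/
def neutralField (ri re β : ℝ) (a x : E3) : E3 :=
  β • (shellProfile ri re x • a + (inner ℝ a x : ℝ) • shellProfileGrad ri re x)

theorem neutralField_eq_zero {ri re : ℝ} (hr : ri < re) (β : ℝ) (a : E3) {x : E3}
    (hx : x ∉ ball (0 : E3) re) : neutralField ri re β a x = 0 := by
  have hx' : re ≤ ‖x‖ := by simpa using hx
  simp [neutralField, shellProfile_of_ge hx' hr, shellProfileGrad_of_ge hx']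

theorem exists_norm_neutralField_le {ri re : ℝ} (hri : 0 < ri) (hr : ri < re) (β : ℝ) (a : E3) :
    ∃ C, ∀ x, ‖neutralField ri re β a x‖ ≤ C := by
  refine ⟨|β| * ((ri ^ 3)⁻¹ * ‖a‖ + ‖a‖ * re * (3 / ri ^ 4)), fun x => ?_⟩
  by_cases hx : x ∈ ball (0 : E3) re
  · have hx' : ‖x‖ ≤ re := (mem_ball_zero_iff.mp hx).le
    rw [neutralField, norm_smul, Real.norm_eq_abs]
    gcongr
    refine (norm_add_le _ _).trans ?_
    rw [norm_smul, norm_smul]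
    gcongr
    · have hm : ri ≤ max ri (min ‖x‖ re) := le_max_left _ _
      have hm' : max ri (min ‖x‖ re) ≤ re := max_le hr.le (min_le_right _ _)
      rw [Real.norm_eq_abs, shellProfile, abs_of_nonneg]
      · have : 0 < re := hri.trans hr
        have : 0 < (re ^ 3)⁻¹ := by positivity
        have : (max ri (min ‖x‖ re) ^ 3)⁻¹ ≤ (ri ^ 3)⁻¹ := by gcongr
        linarith
      · have : (re ^ 3)⁻¹ ≤ (max ri (min ‖x‖ re) ^ 3)⁻¹ := by
          have := hri.trans_le hm
          gcongr
        linarith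
    · have := hri.trans hr
      positivity
    · exact (norm_inner_le_norm (𝕜 := ℝ) a x).trans (by gcongr)
    · exact norm_shellProfileGrad_le hri x
  · rw [neutralField_eq_zero hr β a hx, norm_zero]
    have := hri.trans hr
    positivity

theorem measurable_neutralField {ri : ℝ} (hri : 0 < ri) (re β : ℝ) (a : E3) :
    Measurable (neutralField ri re β a) := by
  obtain ⟨C, hC⟩ := exists_lipschitzWith_shellProfile hri re
  have h1 := hC.continuous.measurable
  have h2 := measurable_shellProfileGrad ri re
  have h3 : Measurable fun x : E3 => (inner ℝ a x : ℝ) :=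
    (continuous_const.inner continuous_id).measurable
  exact ((h1.smul measurable_const).add (h3.smul h2)).const_smul β

theorem memLp_neutralField {ri re : ℝ} (hri : 0 < ri) (hr : ri < re) (β : ℝ) (a : E3) :
    MemLp (neutralField ri re β a) 2 volume := by
  obtain ⟨C, hC⟩ := exists_norm_neutralField_le hri hr β a
  exact memLp_of_norm_le_const (measurable_neutralField hri re β a).aestronglyMeasurable hC
    fun x hx => neutralField_eq_zero hr β a fun h => hx (ball_subset_closedBall h)

theorem exists_hasWeakFDerivOn_neutralField {ri re : ℝ} (hri : 0 < ri) (hr : ri < re) (β : ℝ)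
    (a : E3) : ∃ w : E3 → ℝ, (∀ x ∉ ball (0 : E3) re, w x = 0) ∧ MemLp w 2 volume ∧
      HasWeakFDerivOn Set.univ w fun x => innerSL ℝ (neutralField ri re β a x) := by
  have hre := hri.trans hr
  obtain ⟨χ, hχ, hχe⟩ := exists_isTest_linear (β • a) hre
  have h := (hasWeakFDerivOn_shellProfile hri hr).mul_test hχ
  have h0 : ∀ x ∉ ball (0 : E3) re, χ x * shellProfile ri re x = 0 := fun x hx => by
    rw [shellProfile_of_ge (by simpa using hx) hr, mul_zero]
  obtain ⟨C, hC⟩ := exists_lipschitzWith_shellProfile hri re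
  have hcont : Continuous fun x => χ x * shellProfile ri re x :=
    hχ.1.continuous.mul hC.continuous
  refine ⟨_, h0, hcont.memLp_of_hasCompactSupport (HasCompactSupport.intro
    (isCompact_closedBall 0 re) fun x hx => h0 x fun h => hx (ball_subset_closedBall h)), ?_⟩
  refine h.congr_ae (ae_of_all _ fun x => ?_)
  ext y
  by_cases hx : x ∈ ball (0 : E3) re
  · simp [(hχe x hx).1, (hχe x hx).2, neutralField, real_inner_smul_left]
    ring
  · have hx' : re ≤ ‖x‖ := by simpa using hx
    simp [shellProfile_of_ge hx' hr, shellProfileGrad_of_ge hx', neutralField_eq_zero hr β a hx]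

/-- The flux perturbation of the neutral configuration is a curl. -/
theorem neutral_flux {σc σs σm ri re : ℝ} (hσs : 0 < σs) (hri : 0 < ri) (hr : ri < re)
    (hneutral : (2 * σs + σc) * (σm - σs) + (ri / re) ^ 3 * (σs - σc) * (2 * σs + σm) = 0)
    (a : E3) {x : E3} (h1 : ‖x‖ ≠ ri) (h2 : ‖x‖ ≠ re) :
    conductivity (ball 0 ri) (ball 0 re) σc σs σm x •
        (a + neutralField ri re (dipoleStrength σs σm re) a x) - σm • a =
      (-σs * dipoleStrength σs σm re) • ((2 * shellProfile ri re x) • a +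
        ((inner ℝ (shellProfileGrad ri re x) x : ℝ) • a -
          (inner ℝ (shellProfileGrad ri re x) a : ℝ) • x)) := by
  have hre := hri.trans hr
  rcases h1.lt_or_gt with h | h
  -- Inside the core both fields are uniform. This is the only place where the neutrality condition
  -- is used.
  · have hZ : shellProfileGrad ri re x = 0 := by simp [shellProfileGrad, h.not_gt]
    have hσ : conductivity (ball (0 : E3) ri) (ball 0 re) σc σs σm x = σc := by
      simp [conductivity, h]
    rw [hσ, neutralField, hZ, shellProfile_of_le h.le hr]
    simp only [smul_zero, add_zero, inner_zero_left, zero_smul, sub_zero, smul_smul, smul_add]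
    rw [← add_smul, ← sub_smul]
    congr 1
    rw [dipoleStrength]
    field_simp at hneutral ⊢
    linear_combination -hneutral
  rcases h2.lt_or_gt with h' | h'
  · have hσ : conductivity (ball (0 : E3) ri) (ball 0 re) σc σs σm x = σs := by
      simp [conductivity, h.le, h']
    have hx0 : 0 < ‖x‖ := hri.trans h
    rw [hσ, neutralField, shellProfile_of_mem h.le h'.le]
    simp only [shellProfileGrad, h, h', and_self, if_true, real_inner_smul_left,
      real_inner_self_eq_norm_sq, real_inner_comm a x]
    match_scalars
    -- Matching the coefficients of `a` in the shell amounts to `σs (1 - 3 β / re³) = σm`, which is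
    -- how `dipoleStrength` is chosen. It expresses the continuity of the normal flux across the
    -- outer sphere.
    · rw [dipoleStrength]
      field_simp
      ring
    · ring
  · have hσ : conductivity (ball (0 : E3) ri) (ball 0 re) σc σs σm x = σm := by
      simp [conductivity, h.not_gt, h'.not_gt]
    rw [hσ, neutralField_eq_zero hr _ a (by simpa using h'.le), shellProfile_of_ge h'.le hr,
      shellProfileGrad_of_ge h'.le]
    simp

theorem measurable_conductivity {D Ω : Set E3} (hD : MeasurableSet D) (hΩ : MeasurableSet Ω)
    (σc σs σm : ℝ) : Measurable (conductivity D Ω σc σs σm) :=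
  Measurable.ite hD measurable_const (Measurable.ite hΩ measurable_const measurable_const)

theorem conductivity_cases (D Ω : Set E3) (σc σs σm : ℝ) (x : E3) :
    conductivity D Ω σc σs σm x = σc ∨ conductivity D Ω σc σs σm x = σs ∨
      conductivity D Ω σc σs σm x = σm := by
  rw [conductivity]
  split_ifs <;> simp

theorem abs_conductivity_le {D Ω : Set E3} {σc σs σm : ℝ} (hσc : 0 < σc) (hσs : 0 < σs)
    (hσm : 0 < σm) (x : E3) : |conductivity D Ω σc σs σm x| ≤ σc + σs + σm := by
  rcases conductivity_cases D Ω σc σs σm x with h | h | h <;> rw [h, abs_of_pos ‹_›] <;> linarith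

theorem le_conductivity (D Ω : Set E3) (σc σs σm : ℝ) (x : E3) :
    min σc (min σs σm) ≤ conductivity D Ω σc σs σm x := by
  rcases conductivity_cases D Ω σc σs σm x with h | h | h <;> rw [h] <;> simp

/-- The concentric neutral configuration has an explicit corrector and no dipole moment. -/
theorem neutral_corrector {σc σs σm ri re R : ℝ} (hσs : 0 < σs)
    (hri : 0 < ri) (hr : ri < re) (hR : re ≤ R)
    (hneutral : (2 * σs + σc) * (σm - σs) + (ri / re) ^ 3 * (σs - σc) * (2 * σs + σm) = 0)
    (hN : MemLp (contrast (conductivity (ball 0 ri) (ball 0 re) σc σs σm) σm) ∞ volume)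
    (a : E3) : ∃ p : L2Field, p =ᵐ[volume] neutralField ri re (dipoleStrength σs σm re) a ∧
      IsCorrector gradSpace σm (mulOp hN) (ballField R a) p ∧
      ∀ c, inner ℝ (mulOp hN (ballField R a + p)) (ballField R c) = 0 := by
  have hre := hri.trans hr
  set σ := conductivity (ball (0 : E3) ri) (ball 0 re) σc σs σm
  set β := dipoleStrength σs σm re
  have hL2 := memLp_neutralField hri hr β a
  have hbR : ∀ x ∉ ball (0 : E3) R, contrast σ σm x = 0 := fun x hx => by
    have h1 : x ∉ ball (0 : E3) re := fun h => hx (ball_subset_ball hR h)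
    have h2 : x ∉ ball (0 : E3) ri := fun h => h1 (ball_subset_ball hr.le h)
    simp only [contrast, σ, conductivity, if_neg h1, if_neg h2, sub_self]
    ext y : 1
    simp
  obtain ⟨w, hw0, hw2, hw⟩ := exists_hasWeakFDerivOn_neutralField hri hr β a
  set p : L2Field := hL2.toLp _ with hp
  have hpe : p =ᵐ[volume] neutralField ri re β a := hL2.coeFn_toLp
  have hpG : p ∈ gradSpace := by
    refine hw.mem_gradSpace hw2 ?_ (r := re) (fun x hx => hw0 x fun h =>
      hx (ball_subset_closedBall h)) ?_
    · exact hL2.congr_norm ((innerSL ℝ : E3 →L[ℝ] _).continuous.comp_aestronglyMeasurable hL2.1)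
        (ae_of_all _ fun x => by simp)
    · filter_upwards [hpe] with x hx y
      rw [hx, innerSL_apply_apply]
  let X : E3 → E3 := fun x => σ x • (a + neutralField ri re β a x) - σm • a
  have hX0 : ∀ x ∉ ball (0 : E3) re, X x = 0 := fun x hx => by
    have h2 : x ∉ ball (0 : E3) ri := fun h => hx (ball_subset_ball hr.le h)
    simp only [X, σ, conductivity, if_neg hx, if_neg h2, neutralField_eq_zero hr β a hx, add_zero,
      sub_self]
  have hXφ : ∀ {φ : E3 → ℝ}, IsTest φ → ∫ x, inner ℝ (X x) (gradient φ x) = 0 := by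
    intro φ hφ
    obtain ⟨i2, hcurl⟩ := (hasWeakFDerivOn_shellProfile hri hr).integral_curl hφ a
    obtain ⟨C, hC⟩ := exists_lipschitzWith_shellProfile hri re
    have i1 : Integrable fun x => shellProfile ri re x * fderiv ℝ φ x a :=
      (hC.continuous.mul (hφ.fderiv_apply a).1.continuous).integrable_of_hasCompactSupport
        (hφ.fderiv_apply a).2.mul_left
    have e : ∀ᵐ x, inner ℝ (X x) (gradient φ x) = (-σs * β) *
        (2 * (shellProfile ri re x * fderiv ℝ φ x a) +
          (fderiv ℝ φ x a * innerSL ℝ (shellProfileGrad ri re x) x -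
            fderiv ℝ φ x x * innerSL ℝ (shellProfileGrad ri re x) a)) := by
      filter_upwards [ae_norm_ne ri, ae_norm_ne re] with x h1 h2
      simp only [X]
      rw [neutral_flux hσs hri hr hneutral a h1 h2, real_inner_comm, inner_gradient_left]
      simp only [map_smul, map_add, map_sub, smul_eq_mul, innerSL_apply_apply]
      ring
    rw [integral_congr_ae e, integral_const_mul, integral_add (i1.const_mul 2) i2, hcurl,
      integral_const_mul]
    ring
  have hNe : mulOp hN (ballField R a + p) =ᵐ[volume] fun x => X x - σm • neutralField ri re β a x := by
    filter_upwards [coeFn_mulOp_ballField_add hN hbR a hpe] with x hx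
    rw [hx]
    simp only [contrast, X, FunLike.coe_smul, Pi.smul_apply, coe_id', id_eq, smul_add, sub_smul]
    abel
  have hsum : σm • p + mulOp hN (ballField R a + p) =ᵐ[volume] X := by
    filter_upwards [hNe, Lp.coeFn_add (σm • p) (mulOp hN (ballField R a + p)), Lp.coeFn_smul σm p,
      hpe] with x h1 h2 h3 h4
    rw [h2, Pi.add_apply, h3, Pi.smul_apply, h1, h4]
    abel
  refine ⟨p, hpe, ⟨hpG, fun q hq => ?_⟩, fun c => ?_⟩
  · obtain ⟨φ, hφ, hlim⟩ := exists_seq_gradLp hq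
    refine tendsto_nhds_unique (((continuous_const.inner continuous_id).tendsto q).comp hlim) ?_
    refine tendsto_const_nhds.congr fun n => ?_
    exact ((inner_eq_integral hsum (hφ n).coeFn_gradLp).trans (hXφ (hφ n))).symm
  -- On the support of the flux perturbation `X`, the uniform field `c` is the gradient of a test
  -- function, so `X` has mean zero. So has `p`, being the gradient of a compactly supported
  -- function, and the difference is the dipole moment.
  · obtain ⟨χ, hχ, hχe⟩ := exists_isTest_linear c (hre.trans_le hR)
    have h1 : inner ℝ (σm • p + mulOp hN (ballField R a + p)) (ballField R c) = 0 := by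
      rw [inner_eq_integral hsum (coeFn_ballField R c), ← hXφ hχ]
      refine integral_congr_ae (ae_of_all _ fun x => ?_)
      by_cases hx : x ∈ ball (0 : E3) R
      · simp only [Set.indicator_of_mem hx]
        rw [real_inner_comm _ (X x), real_inner_comm _ (X x), inner_gradient_left, (hχe x hx).2,
          innerSL_apply_apply]
      · simp only [hX0 x fun h => hx (ball_subset_ball hR h), inner_zero_left]
    have h2 : inner ℝ p (ballField R c) = 0 := by
      rw [inner_eq_integral hpe (coeFn_ballField R c), ← hw.integral_apply_eq_zero hre hw0
        (fun x hx => by rw [neutralField_eq_zero hr β a hx, map_zero]) c]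
      refine integral_congr_ae (ae_of_all _ fun x => ?_)
      by_cases hx : x ∈ ball (0 : E3) R
      · simp only [Set.indicator_of_mem hx, innerSL_apply_apply]
      · simp only [neutralField_eq_zero hr β a fun h => hx (ball_subset_ball hR h),
          inner_zero_left, map_zero, zero_apply]
    rw [inner_add_left, real_inner_smul_left, h2, mul_zero, zero_add] at h1
    exact h1

end

section


open Filter Topology ContinuousLinearMap

/-! ### Moments of radial weights -/

/-- A radial weight with compact support. -/
structure IsRadialWeight (R : ℝ) (G : ℝ → ℝ) : Prop where
  integrable : Integrable fun x : E3 => G ‖x‖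
  eq_zero : ∀ r, R ≤ r → G r = 0

/-- The integral of `p` against a radial weight. -/
def radialMean (G : ℝ → ℝ) (p : E3 → ℝ) : ℝ := ∫ x, G ‖x‖ * p x

namespace IsRadialWeight

variable {R : ℝ} {G : ℝ → ℝ}

theorem integrable_mul (h : IsRadialWeight R G) {p : E3 → ℝ} (hp : Continuous p) :
    Integrable fun x => G ‖x‖ * p x := by
  have h1 : IntegrableOn (fun x => G ‖x‖ * p x) (closedBall (0 : E3) R) :=
    h.integrable.integrableOn.mul_continuousOn hp.continuousOn (isCompact_closedBall 0 R)
  refine (integrableOn_iff_integrable_of_support_subset fun x hx => ?_).mp h1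
  by_contra h'
  refine hx ?_
  simp only [mem_closedBall_zero_iff, not_le] at h'
  change G ‖x‖ * p x = 0
  rw [h.eq_zero _ h'.le, zero_mul]

theorem radialMean_add (h : IsRadialWeight R G) {p q : E3 → ℝ} (hp : Continuous p)
    (hq : Continuous q) : radialMean G (fun x => p x + q x) = radialMean G p + radialMean G q := by
  simp only [radialMean, mul_add]
  exact integral_add (h.integrable_mul hp) (h.integrable_mul hq)

theorem radialMean_sum (h : IsRadialWeight R G) {p : Fin 3 → E3 → ℝ} (hp : ∀ i, Continuous (p i)) :
    radialMean G (fun x => ∑ i, p i x) = ∑ i, radialMean G (p i) := by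
  simp only [radialMean, Finset.mul_sum]
  exact integral_finsetSum _ fun i _ => h.integrable_mul (hp i)

end IsRadialWeight

theorem radialMean_const_mul (G : ℝ → ℝ) (c : ℝ) (p : E3 → ℝ) :
    radialMean G (fun x => c * p x) = c * radialMean G p := by
  simp only [radialMean, ← integral_const_mul]
  congr 1; ext x; ring

/-- Two vectors of equal length are exchanged by a reflection, which preserves the weight and the
measure. Hence the moment depends on the length of `y` alone, and homogeneity gives the power. -/
theorem radialMean_inner_pow (G : ℝ → ℝ) (k : ℕ) (y : E3) :
    radialMean G (fun x => (inner ℝ x y : ℝ) ^ k) =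
      ‖y‖ ^ k * radialMean G (fun x => (inner ℝ x (EuclideanSpace.single 0 1 : E3) : ℝ) ^ k) := by
  have hinv : ∀ y z : E3, ‖y‖ = ‖z‖ → radialMean G (fun x => (inner ℝ x y : ℝ) ^ k) =
      radialMean G (fun x => (inner ℝ x z : ℝ) ^ k) := by
    intro y z h
    set e : E3 ≃ₗᵢ[ℝ] E3 := (Submodule.span ℝ {y - z})ᗮ.reflection
    have he : e y = z := Submodule.reflection_sub h
    rw [radialMean, radialMean, ← (e.measurePreserving).integral_comp
      e.toHomeomorph.measurableEmbedding fun x => G ‖x‖ * (inner ℝ x z : ℝ) ^ k]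
    simp_rw [← he, e.inner_map_map, e.norm_map]
  have h1 : ‖y‖ = ‖‖y‖ • (EuclideanSpace.single 0 1 : E3)‖ := by
    rw [norm_smul, PiLp.norm_single]; simp
  rw [hinv _ _ h1, ← radialMean_const_mul]
  simp_rw [real_inner_smul_right, mul_pow]

namespace IsRadialWeight

variable {R : ℝ} {G : ℝ → ℝ}

theorem inner_self_eq_sum (x y : E3) : (inner ℝ x y : ℝ) =
    ∑ i : Fin 3, inner ℝ x (EuclideanSpace.single i 1) * inner ℝ y (EuclideanSpace.single i 1) := by
  simp [PiLp.inner_apply, mul_comm]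

theorem second_moment (h : IsRadialWeight R G) (y z : E3) :
    radialMean G (fun x => (inner ℝ x y : ℝ) * inner ℝ x z) =
      radialMean G (fun x => ‖x‖ ^ 2) / 3 * inner ℝ y z := by
  obtain ⟨A, hA⟩ : ∃ A, ∀ y z, radialMean G (fun x => (inner ℝ x y : ℝ) * inner ℝ x z) =
      A * inner ℝ y z := by
    refine ⟨radialMean G (fun x => (inner ℝ x (EuclideanSpace.single 0 1 : E3) : ℝ) ^ 2),
      fun y z => ?_⟩
    have h1 := radialMean_inner_pow G 2 (y + z)
    have h2 := radialMean_inner_pow G 2 (y - z)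
    have e : (fun x => (inner ℝ x (y + z) : ℝ) ^ 2) =
        fun x => (inner ℝ x (y - z) : ℝ) ^ 2 + 4 * (inner ℝ x y * inner ℝ x z) := by
      ext x; rw [inner_add_right, inner_sub_right]; ring
    rw [e, h.radialMean_add (by fun_prop) (by fun_prop), radialMean_const_mul, h2,
      norm_add_sq_real, norm_sub_sq_real] at h1
    linarith
  have e : (fun x : E3 => ‖x‖ ^ 2) = fun x => ∑ i : Fin 3,
      inner ℝ x (EuclideanSpace.single i 1) * inner ℝ x (EuclideanSpace.single i 1) := by
    ext x; rw [← inner_self_eq_sum, real_inner_self_eq_norm_sq]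
  rw [e, h.radialMean_sum (fun i => by fun_prop), hA]
  simp_rw [hA]
  simp [PiLp.norm_single]

/-- Polarizing the fourth power of a linear form gives the three pairings up to a constant. Summing
over `y = z = eᵢ` and `a = b = eⱼ` determines the constant: `9 + 3 + 3 = 15`. -/
theorem fourth_moment (h : IsRadialWeight R G) (y z a b : E3) :
    radialMean G (fun x => (inner ℝ x y : ℝ) * inner ℝ x z * (inner ℝ x a * inner ℝ x b)) =
      radialMean G (fun x => ‖x‖ ^ 4) / 15 *
        (inner ℝ y z * inner ℝ a b + inner ℝ y a * inner ℝ z b + inner ℝ y b * inner ℝ z a) := by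
  obtain ⟨A, hA⟩ : ∃ A, ∀ y z a b, radialMean G (fun x => (inner ℝ x y : ℝ) * inner ℝ x z *
      (inner ℝ x a * inner ℝ x b)) =
      A * (inner ℝ y z * inner ℝ a b + inner ℝ y a * inner ℝ z b + inner ℝ y b * inner ℝ z a) := by
    set C := radialMean G (fun x => (inner ℝ x (EuclideanSpace.single 0 1 : E3) : ℝ) ^ 4)
    have k0 : ∀ y, radialMean G (fun x => (inner ℝ x y : ℝ) ^ 4) = (inner ℝ y y) ^ 2 * C :=
      fun y => by rw [radialMean_inner_pow, real_inner_self_eq_norm_sq]; ring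
    have k1 : ∀ y z, radialMean G (fun x => (inner ℝ x y : ℝ) ^ 2 * (inner ℝ x z) ^ 2) =
        C / 3 * (inner ℝ y y * inner ℝ z z + 2 * (inner ℝ y z) ^ 2) := fun y z => by
      have h1 := k0 (y + z)
      have h2 := k0 (y - z)
      have e : (fun x => (inner ℝ x (y + z) : ℝ) ^ 4) = fun x =>
          -1 * (inner ℝ x (y - z) : ℝ) ^ 4 + (2 * (inner ℝ x y) ^ 4 + (2 * (inner ℝ x z) ^ 4 +
            12 * ((inner ℝ x y) ^ 2 * (inner ℝ x z) ^ 2))) := by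
        ext x; rw [inner_add_right, inner_sub_right]; ring
      rw [e, h.radialMean_add (by fun_prop) (by fun_prop),
        h.radialMean_add (by fun_prop) (by fun_prop),
        h.radialMean_add (by fun_prop) (by fun_prop), radialMean_const_mul, radialMean_const_mul,
        radialMean_const_mul, radialMean_const_mul, h2, k0, k0] at h1
      simp only [inner_add_left, inner_add_right, inner_sub_left, inner_sub_right,
        real_inner_comm y z] at h1
      linear_combination h1 / 12
    have k2 : ∀ y a b, radialMean G (fun x => (inner ℝ x y : ℝ) ^ 2 *
        (inner ℝ x a * inner ℝ x b)) =
        C / 3 * (inner ℝ y y * inner ℝ a b + 2 * (inner ℝ y a * inner ℝ y b)) := fun y a b => by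
      have h1 := k1 y (a + b)
      have h2 := k1 y (a - b)
      have e : (fun x => (inner ℝ x y : ℝ) ^ 2 * (inner ℝ x (a + b)) ^ 2) = fun x =>
          (inner ℝ x y : ℝ) ^ 2 * (inner ℝ x (a - b)) ^ 2 +
            4 * ((inner ℝ x y : ℝ) ^ 2 * (inner ℝ x a * inner ℝ x b)) := by
        ext x; rw [inner_add_right, inner_sub_right]; ring
      rw [e, h.radialMean_add (by fun_prop) (by fun_prop), radialMean_const_mul, h2] at h1
      simp only [inner_add_left, inner_add_right, inner_sub_left, inner_sub_right,
        real_inner_comm a b] at h1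
      linear_combination h1 / 4
    refine ⟨C / 3, fun y z a b => ?_⟩
    have h1 := k2 (y + z) a b
    have h2 := k2 (y - z) a b
    have e : (fun x => (inner ℝ x (y + z) : ℝ) ^ 2 * (inner ℝ x a * inner ℝ x b)) = fun x =>
        (inner ℝ x (y - z) : ℝ) ^ 2 * (inner ℝ x a * inner ℝ x b) +
          4 * ((inner ℝ x y * inner ℝ x z) * (inner ℝ x a * inner ℝ x b)) := by
      ext x; rw [inner_add_right, inner_sub_right]; ring
    rw [e, h.radialMean_add (by fun_prop) (by fun_prop), radialMean_const_mul, h2] at h1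
    simp only [inner_add_left, inner_add_right, inner_sub_left, inner_sub_right,
      real_inner_comm y z] at h1
    linear_combination h1 / 4
  have e : (fun x : E3 => ‖x‖ ^ 4) = fun x => ∑ i : Fin 3, ∑ j : Fin 3,
      inner ℝ x (EuclideanSpace.single i 1) * inner ℝ x (EuclideanSpace.single i 1) *
      (inner ℝ x (EuclideanSpace.single j 1) * inner ℝ x (EuclideanSpace.single j 1)) := by
    ext x
    simp_rw [← Finset.mul_sum, ← Finset.sum_mul]
    rw [← inner_self_eq_sum, real_inner_self_eq_norm_sq]; ring
  rw [e, h.radialMean_sum (fun i => by fun_prop), hA]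
  rw [Finset.sum_congr rfl fun i _ => h.radialMean_sum (fun j => by fun_prop)]
  simp_rw [hA]
  simp [Fin.sum_univ_three, EuclideanSpace.inner_single_right]
  left
  ring

end IsRadialWeight

/-- The trace of an endomorphism. -/
def tr (Q : E3 →L[ℝ] E3) : ℝ :=
  ∑ i : Fin 3, inner ℝ (Q (EuclideanSpace.single i 1)) (EuclideanSpace.single i 1)

namespace IsRadialWeight

variable {R : ℝ} {G : ℝ → ℝ}

theorem moment_apply (h : IsRadialWeight R G) (Q : E3 →L[ℝ] E3) (y z : E3) :
    radialMean G (fun x => (inner ℝ (Q x) y : ℝ) * inner ℝ x z) =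
      radialMean G (fun x => ‖x‖ ^ 2) / 3 * inner ℝ y (Q z) := by
  simp_rw [← adjoint_inner_right Q]
  rw [h.second_moment, adjoint_inner_left]

theorem moment_quadratic (h : IsRadialWeight R G) (Q : E3 →L[ℝ] E3) :
    radialMean G (fun x => inner ℝ (Q x) x) = radialMean G (fun x => ‖x‖ ^ 2) / 3 * tr Q := by
  simp_rw [fun x => inner_self_eq_sum (Q x) x]
  rw [h.radialMean_sum (fun i => by fun_prop), tr, Finset.mul_sum]
  exact Finset.sum_congr rfl fun i _ => by rw [h.moment_apply, real_inner_comm]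

theorem moment_quadratic_mul (h : IsRadialWeight R G) (Q : E3 →L[ℝ] E3) (a b : E3) :
    radialMean G (fun x => inner ℝ (Q x) x * (inner ℝ x a * inner ℝ x b)) =
      radialMean G (fun x => ‖x‖ ^ 4) / 15 *
        (tr Q * inner ℝ a b + inner ℝ (Q a) b + inner ℝ (Q b) a) := by
  simp_rw [fun x => inner_self_eq_sum (Q x) x, Finset.sum_mul]
  rw [h.radialMean_sum (fun i => by fun_prop), inner_self_eq_sum (Q a) b,
    inner_self_eq_sum (Q b) a, tr, Finset.sum_mul, ← Finset.sum_add_distrib,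
    ← Finset.sum_add_distrib, Finset.mul_sum]
  refine Finset.sum_congr rfl fun i _ => ?_
  have := h.fourth_moment (adjoint Q (EuclideanSpace.single i 1)) (EuclideanSpace.single i 1) a b
  simp only [adjoint_inner_left, adjoint_inner_right] at this
  rw [this, real_inner_comm (Q a), real_inner_comm (Q b), real_inner_comm (Q _),
    real_inner_comm b (EuclideanSpace.single i 1 : E3),
    real_inner_comm a (EuclideanSpace.single i 1 : E3)]

end IsRadialWeight

theorem integral_annulus {lo hi : ℝ} (hlo : 0 < lo) (hhi : lo ≤ hi) (K : ℝ → ℝ) :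
    ∫ x : E3, (Set.Ico lo hi).indicator K ‖x‖ =
      3 * volume.real (ball (0 : E3) 1) * ∫ r in lo..hi, r ^ 2 * K r := by
  rw [integral_fun_norm_addHaar volume ((Set.Ico lo hi).indicator K), finrank_euclideanSpace,
    Fintype.card_fin]
  have e : ∫ y in Set.Ioi (0 : ℝ), y ^ (3 - 1) • (Set.Ico lo hi).indicator K y =
      ∫ r in lo..hi, r ^ 2 * K r := by
    rw [intervalIntegral.integral_of_le hhi, ← integral_Ico_eq_integral_Ioc,
      ← integral_indicator measurableSet_Ico, ← integral_indicator measurableSet_Ioi]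
    congr 1; ext r
    by_cases hr : r ∈ Set.Ico lo hi
    · have : r ∈ Set.Ioi (0 : ℝ) := hlo.trans_le hr.1
      simp [hr, this]
    · rw [Set.indicator_of_notMem hr]
      by_cases h0 : r ∈ Set.Ioi (0 : ℝ)
      · rw [Set.indicator_of_mem h0, Set.indicator_of_notMem hr, smul_zero]
      · rw [Set.indicator_of_notMem h0]
  rw [e]
  simp
  ring

theorem isRadialWeight_annulus {lo hi : ℝ} {K : ℝ → ℝ}
    (hK : ContinuousOn K (Set.Icc lo hi)) : IsRadialWeight hi ((Set.Ico lo hi).indicator K) := by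
  refine ⟨?_, fun r hr => Set.indicator_of_notMem (fun h => h.2.not_ge hr) _⟩
  have e : (fun x : E3 => (Set.Ico lo hi).indicator K ‖x‖) =
      (norm ⁻¹' Set.Ico lo hi).indicator fun x => K ‖x‖ := by
    ext x; rfl
  rw [e, integrable_indicator_iff (measurable_norm measurableSet_Ico)]
  have hc : IsCompact (norm ⁻¹' Set.Icc lo hi : Set E3) :=
    (isCompact_closedBall (0 : E3) hi).of_isClosed_subset (isClosed_Icc.preimage continuous_norm)
      fun x hx => mem_closedBall_zero_iff.mpr hx.2
  have : ContinuousOn (fun x : E3 => K ‖x‖) (norm ⁻¹' Set.Icc lo hi) :=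
    hK.comp continuous_norm.continuousOn fun x hx => hx
  exact (this.integrableOn_compact hc).mono_set (Set.preimage_mono Set.Ico_subset_Icc_self)

end

section


open Filter Topology ContinuousLinearMap

/-! ### The derivative of the pulled back medium -/

/-- The matrix entries as linear functionals. -/
def entry (i j : Fin 3) : (E3 →L[ℝ] E3) →L[ℝ] ℝ :=
  (EuclideanSpace.proj i : E3 →L[ℝ] ℝ).comp
    (ContinuousLinearMap.apply ℝ E3 (EuclideanSpace.single j 1 : E3))

theorem entry_apply (i j : Fin 3) (X : E3 →L[ℝ] E3) :
    entry i j X = X (EuclideanSpace.single j 1) i := rfl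

theorem det_eq_entries (X : E3 →L[ℝ] E3) :
    X.det = (Matrix.of fun i j => entry i j X).det := by
  rw [ContinuousLinearMap.det, ← LinearMap.det_toMatrix (EuclideanSpace.basisFun (Fin 3) ℝ).toBasis]
  congr 1

/-- The trace as a continuous linear functional. -/
def trL : (E3 →L[ℝ] E3) →L[ℝ] ℝ := ∑ i : Fin 3, entry i i

theorem trL_apply (X : E3 →L[ℝ] E3) : trL X = tr X := by
  simp [trL, tr, entry_apply, EuclideanSpace.inner_single_right]

theorem hasStrictFDerivAt_det : HasStrictFDerivAt (fun X : E3 →L[ℝ] E3 => (1 + X).det) trL 0 := by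
  have h : ∀ i j, HasStrictFDerivAt (fun X : E3 →L[ℝ] E3 => entry i j (1 + X)) (entry i j) 0 :=
    fun i j => (entry i j).hasStrictFDerivAt.comp (0 : E3 →L[ℝ] E3)
      ((hasStrictFDerivAt_id (𝕜 := ℝ) (0 : E3 →L[ℝ] E3)).const_add 1)
  have e : (fun X : E3 →L[ℝ] E3 => (1 + X).det) = fun X =>
      entry 0 0 (1 + X) * entry 1 1 (1 + X) * entry 2 2 (1 + X) -
      entry 0 0 (1 + X) * entry 1 2 (1 + X) * entry 2 1 (1 + X) -
      entry 0 1 (1 + X) * entry 1 0 (1 + X) * entry 2 2 (1 + X) +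
      entry 0 1 (1 + X) * entry 1 2 (1 + X) * entry 2 0 (1 + X) +
      entry 0 2 (1 + X) * entry 1 0 (1 + X) * entry 2 1 (1 + X) -
      entry 0 2 (1 + X) * entry 1 1 (1 + X) * entry 2 0 (1 + X) := by
    ext X
    rw [det_eq_entries, Matrix.det_fin_three]
    rfl
  rw [e]
  have m := fun i j k l p q => ((h i j).mul (h k l)).mul (h p q)
  refine (((((m 0 0 1 1 2 2).sub (m 0 0 1 2 2 1)).sub (m 0 1 1 0 2 2)).add
    (m 0 1 1 2 2 0)).add (m 0 2 1 0 2 1)).sub (m 0 2 1 1 2 0) |>.congr_fderiv ?_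
  ext X
  simp [trL, entry_apply, Fin.sum_univ_three]
  ring

/-- The adjoint as a linear map. -/
def adjointL : (E3 →L[ℝ] E3) →L[ℝ] (E3 →L[ℝ] E3) :=
  LinearMap.mkContinuous
    { toFun := fun X => adjoint X
      map_add' := fun X Y => map_add _ X Y
      map_smul' := fun c X => by simp } 1 fun X => by simp

theorem adjointL_apply (X : E3 →L[ℝ] E3) : adjointL X = adjoint X := rfl

/-- The derivative of `pullbackMatrix` at the origin. -/
def pullbackDeriv : (E3 →L[ℝ] E3) →L[ℝ] (E3 →L[ℝ] E3) :=
  trL.smulRight 1 - ContinuousLinearMap.id ℝ _ - adjointL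

theorem pullbackDeriv_apply (X : E3 →L[ℝ] E3) :
    pullbackDeriv X = tr X • 1 - X - adjoint X := by
  simp [pullbackDeriv, trL_apply, adjointL_apply]

theorem hasStrictFDerivAt_abs_det :
    HasStrictFDerivAt (fun X : E3 →L[ℝ] E3 => |(1 + X).det|) trL 0 := by
  have hpos : (0 : ℝ) < (1 + (0 : E3 →L[ℝ] E3)).det := by
    rw [add_zero]; simp [ContinuousLinearMap.det]
  exact ((hasStrictDerivAt_abs_pos hpos).comp_hasStrictFDerivAt 0 hasStrictFDerivAt_det).congr_fderiv
    (one_smul _ _)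

theorem hasStrictFDerivAt_inverse_one_add {A : Type*} [NormedRing A] [NormedAlgebra ℝ A]
    [HasSummableGeomSeries A] :
    HasStrictFDerivAt (fun X : A => Ring.inverse (1 + X)) (-ContinuousLinearMap.id ℝ A) 0 := by
  have hi : HasStrictFDerivAt (Ring.inverse : A → A)
      (-mulLeftRight ℝ A ↑(1 : Aˣ)⁻¹ ↑(1 : Aˣ)⁻¹) (1 + (0 : A)) := by
    rw [add_zero]
    exact hasStrictFDerivAt_ringInverse (1 : Aˣ)
  refine (hi.comp (0 : A)
    ((hasStrictFDerivAt_id (𝕜 := ℝ) (0 : A)).const_add 1)).congr_fderiv ?_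
  ext X : 1
  simp

theorem hasStrictFDerivAt_adjoint_inverse_one_add :
    HasStrictFDerivAt (fun X : E3 →L[ℝ] E3 => adjointL (Ring.inverse (1 + X))) (-adjointL) 0 :=
  (adjointL.hasStrictFDerivAt.comp (0 : E3 →L[ℝ] E3)
    hasStrictFDerivAt_inverse_one_add).congr_fderiv (by ext X : 1; simp)

theorem det_one_clm : (1 : E3 →L[ℝ] E3).det = 1 := by simp [ContinuousLinearMap.det]

theorem adjoint_one : adjoint (1 : E3 →L[ℝ] E3) = 1 := star_one (E3 →L[ℝ] E3)

/-- The product rule gives `tr X - X - Xᵀ`. Strict differentiability is essential: the contraction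
argument compares two nearby displacements with each other, and not just one of them with zero. -/
theorem hasStrictFDerivAt_pullbackMatrix : HasStrictFDerivAt pullbackMatrix pullbackDeriv 0 := by
  have h4 := hasStrictFDerivAt_abs_det.smul
    (hasStrictFDerivAt_inverse_one_add.clm_comp hasStrictFDerivAt_adjoint_inverse_one_add)
  refine HasStrictFDerivAt.congr_fderiv (f := pullbackMatrix) h4 ?_
  ext X : 1
  simp only [add_zero, Ring.inverse_one, det_one_clm, adjointL_apply, adjoint_one, abs_one]
  ext y : 1
  simp [pullbackDeriv_apply, trL_apply, adjointL_apply]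
  abel

theorem pullbackMatrix_zero : pullbackMatrix 0 = 1 := by
  simp only [pullbackMatrix, add_zero, Ring.inverse_one, det_one_clm, adjoint_one, abs_one]
  ext y : 1
  simp

/-! ### Radial displacements -/

/-- The quadratic form of an endomorphism. -/
def quad (Q : E3 →L[ℝ] E3) (x : E3) : ℝ := inner ℝ (Q x) x

/-- The radial displacement with angular profile `⟪Q ω, ω⟫`. -/
def displacement (g : ℝ → ℝ) (Q : E3 →L[ℝ] E3) (x : E3) : E3 := (g (‖x‖ ^ 2) * quad Q x) • x

/-- The derivative of `displacement`. -/
def displacementDeriv (g : ℝ → ℝ) (Q : E3 →L[ℝ] E3) (x : E3) : E3 →L[ℝ] E3 :=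
  (g (‖x‖ ^ 2) * quad Q x) • 1 +
    ((2 * deriv g (‖x‖ ^ 2) * quad Q x) • innerSL ℝ x +
      g (‖x‖ ^ 2) • (innerSL ℝ (Q x) + innerSL ℝ (adjoint Q x))).smulRight x

theorem contDiff_quad (Q : E3 →L[ℝ] E3) : ContDiff ℝ (⊤ : ℕ∞) (quad Q) :=
  Q.contDiff.inner ℝ contDiff_id

theorem contDiff_displacement {g : ℝ → ℝ} (hg : ContDiff ℝ (⊤ : ℕ∞) g) (Q : E3 →L[ℝ] E3) :
    ContDiff ℝ (⊤ : ℕ∞) (displacement g Q) :=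
  ((hg.comp (contDiff_norm_sq ℝ)).mul (contDiff_quad Q)).smul contDiff_id

theorem hasFDerivAt_quad (Q : E3 →L[ℝ] E3) (x : E3) :
    HasFDerivAt (quad Q) (innerSL ℝ (Q x) + innerSL ℝ (adjoint Q x)) x := by
  refine (Q.hasFDerivAt.inner ℝ (hasFDerivAt_id x)).congr_fderiv ?_
  ext y
  simp [adjoint_inner_left, real_inner_comm x (Q y)]

theorem fderiv_displacement {g : ℝ → ℝ} (hg : ContDiff ℝ (⊤ : ℕ∞) g) (Q : E3 →L[ℝ] E3) (x : E3) :
    fderiv ℝ (displacement g Q) x = displacementDeriv g Q x := by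
  have h1 := ((hg.differentiable (by simp)) (‖x‖ ^ 2)).hasDerivAt.comp_hasFDerivAt x
    (hasStrictFDerivAt_norm_sq x).hasFDerivAt
  have h2 : HasFDerivAt (displacement g Q) _ x :=
    (h1.mul (hasFDerivAt_quad Q x)).smul (hasFDerivAt_id x)
  rw [h2.fderiv]
  ext1 y
  simp [displacementDeriv, Function.comp]
  module

theorem quad_sub (P Q : E3 →L[ℝ] E3) (x : E3) : quad (P - Q) x = quad P x - quad Q x := by
  simp [quad, inner_sub_left]

theorem displacementDeriv_sub (g : ℝ → ℝ) (P Q : E3 →L[ℝ] E3) (x : E3) :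
    displacementDeriv g (P - Q) x = displacementDeriv g P x - displacementDeriv g Q x := by
  ext1 y
  simp [displacementDeriv, quad_sub]
  module

theorem abs_quad_le (Q : E3 →L[ℝ] E3) (x : E3) : |quad Q x| ≤ ‖Q‖ * ‖x‖ ^ 2 := by
  refine (abs_real_inner_le_norm _ _).trans ?_
  calc ‖Q x‖ * ‖x‖ ≤ (‖Q‖ * ‖x‖) * ‖x‖ := by gcongr; exact Q.le_opNorm x
    _ = _ := by ring

/-- The profile of the displacements. -/
structure IsProfile (r₀ R : ℝ) (g : ℝ → ℝ) : Prop where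
  contDiff : ContDiff ℝ (⊤ : ℕ∞) g
  eq_zero_of_le : ∀ t ≤ r₀ ^ 2, g t = 0
  eq_zero_of_ge : ∀ t, R ^ 2 ≤ t → g t = 0

namespace IsProfile

variable {r₀ R : ℝ} {g : ℝ → ℝ}

theorem deriv_eq_zero_of_ge (h : IsProfile r₀ R g) {t : ℝ} (ht : R ^ 2 ≤ t) : deriv g t = 0 := by
  have h1 : DifferentiableAt ℝ g t := h.contDiff.differentiable (by simp) t
  have h2 : HasDerivWithinAt g (deriv g t) (Set.Ici t) t := h1.hasDerivAt.hasDerivWithinAt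
  have h3 : HasDerivWithinAt g 0 (Set.Ici t) t :=
    (hasDerivWithinAt_const t _ (0 : ℝ)).congr (fun y hy => h.eq_zero_of_ge y (ht.trans hy))
      (h.eq_zero_of_ge t ht)
  exact (uniqueDiffWithinAt_Ici t).eq_deriv _ h2 h3

theorem deriv_eq_zero_of_le (h : IsProfile r₀ R g) {t : ℝ} (ht : t ≤ r₀ ^ 2) : deriv g t = 0 := by
  have h1 : DifferentiableAt ℝ g t := h.contDiff.differentiable (by simp) t
  have h2 : HasDerivWithinAt g (deriv g t) (Set.Iic t) t := h1.hasDerivAt.hasDerivWithinAt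
  have h3 : HasDerivWithinAt g 0 (Set.Iic t) t :=
    (hasDerivWithinAt_const t _ (0 : ℝ)).congr (fun y hy => h.eq_zero_of_le y (le_trans hy ht))
      (h.eq_zero_of_le t ht)
  exact (uniqueDiffWithinAt_Iic t).eq_deriv _ h2 h3

theorem displacementDeriv_of_ge (h : IsProfile r₀ R g) (hR : 0 ≤ R) (Q : E3 →L[ℝ] E3) {x : E3}
    (hx : R ≤ ‖x‖) : displacementDeriv g Q x = 0 := by
  have : R ^ 2 ≤ ‖x‖ ^ 2 := by gcongr
  ext1 y
  simp [displacementDeriv, h.eq_zero_of_ge _ this, h.deriv_eq_zero_of_ge this]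

theorem displacementDeriv_of_le (h : IsProfile r₀ R g) (Q : E3 →L[ℝ] E3) {x : E3}
    (hx : ‖x‖ ≤ r₀) : displacementDeriv g Q x = 0 := by
  have : ‖x‖ ^ 2 ≤ r₀ ^ 2 := by gcongr
  ext1 y
  simp [displacementDeriv, h.eq_zero_of_le _ this, h.deriv_eq_zero_of_le this]

theorem exists_norm_displacementDeriv_le (h : IsProfile r₀ R g) (hR : 0 ≤ R) :
    ∃ C, 0 < C ∧ ∀ Q x, ‖displacementDeriv g Q x‖ ≤ C * ‖Q‖ := by
  have hg' : Continuous (deriv g) := h.contDiff.continuous_deriv (by simp)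
  obtain ⟨A, hA⟩ := (isCompact_Icc (a := (0 : ℝ)) (b := R ^ 2)).exists_bound_of_continuousOn
    h.contDiff.continuous.continuousOn
  obtain ⟨B, hB⟩ := (isCompact_Icc (a := (0 : ℝ)) (b := R ^ 2)).exists_bound_of_continuousOn
    hg'.continuousOn
  have hA0 : 0 ≤ A := (norm_nonneg _).trans (hA 0 ⟨le_rfl, sq_nonneg R⟩)
  have hB0 : 0 ≤ B := (norm_nonneg _).trans (hB 0 ⟨le_rfl, sq_nonneg R⟩)
  -- The summand `1` only makes the constant positive, so that one can divide by it later.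
  refine ⟨A * R ^ 2 + (2 * B * R ^ 2 * R + 2 * A * R) * R + 1, by positivity, fun Q x => ?_⟩
  rcases le_total R ‖x‖ with hx | hx
  · rw [h.displacementDeriv_of_ge hR Q hx, norm_zero]
    positivity
  · have hx2 : ‖x‖ ^ 2 ∈ Set.Icc (0 : ℝ) (R ^ 2) := ⟨by positivity, by gcongr⟩
    have a := hA _ hx2
    have b := hB _ hx2
    rw [Real.norm_eq_abs] at a b
    have q : |quad Q x| ≤ ‖Q‖ * R ^ 2 := (abs_quad_le Q x).trans (by gcongr)
    have hQ : ‖Q x‖ ≤ ‖Q‖ * R := (Q.le_opNorm x).trans (by gcongr)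
    have hQ' : ‖adjoint Q x‖ ≤ ‖Q‖ * R := by
      refine ((adjoint Q).le_opNorm x).trans ?_
      rw [LinearIsometryEquiv.norm_map]
      gcongr
    have n1 : ‖(g (‖x‖ ^ 2) * quad Q x) • (1 : E3 →L[ℝ] E3)‖ ≤ A * (‖Q‖ * R ^ 2) := by
      rw [norm_smul, norm_one, mul_one, Real.norm_eq_abs, abs_mul]
      gcongr
    have n2 : ‖(2 * deriv g (‖x‖ ^ 2) * quad Q x) • innerSL ℝ x‖ ≤ 2 * B * (‖Q‖ * R ^ 2) * R := by
      rw [norm_smul, innerSL_apply_norm, Real.norm_eq_abs, abs_mul, abs_mul, abs_two]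
      gcongr
    have n3 : ‖g (‖x‖ ^ 2) • (innerSL ℝ (Q x) + innerSL ℝ (adjoint Q x))‖ ≤
        A * (‖Q‖ * R + ‖Q‖ * R) := by
      rw [norm_smul, Real.norm_eq_abs]
      gcongr
      refine (norm_add_le _ _).trans ?_
      rw [innerSL_apply_norm, innerSL_apply_norm]
      gcongr
    rw [displacementDeriv]
    refine (norm_add_le _ _).trans ?_
    rw [norm_smulRight_apply]
    have n4 := (norm_add_le _ _).trans (add_le_add n2 n3)
    calc _ ≤ A * (‖Q‖ * R ^ 2) + (2 * B * (‖Q‖ * R ^ 2) * R + A * (‖Q‖ * R + ‖Q‖ * R)) * R := by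
          gcongr
      _ ≤ _ := by nlinarith [norm_nonneg Q]

end IsProfile

end

section


open Filter Topology ContinuousLinearMap

/-! ### The first variation of the polarization tensor -/

theorem tr_displacementDeriv (g : ℝ → ℝ) (Q : E3 →L[ℝ] E3) (x : E3) :
    tr (displacementDeriv g Q x) =
      (5 * g (‖x‖ ^ 2) + 2 * ‖x‖ ^ 2 * deriv g (‖x‖ ^ 2)) * quad Q x := by
  have h1 : ∑ i : Fin 3, inner ℝ x (EuclideanSpace.single i 1) *
      inner ℝ x (EuclideanSpace.single i 1) = ‖x‖ ^ 2 := by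
    rw [← IsRadialWeight.inner_self_eq_sum, real_inner_self_eq_norm_sq]
  have h2 : ∑ i : Fin 3, inner ℝ (Q x) (EuclideanSpace.single i 1) *
      inner ℝ x (EuclideanSpace.single i 1) = quad Q x :=
    (IsRadialWeight.inner_self_eq_sum (Q x) x).symm
  have h3 : ∑ i : Fin 3, inner ℝ (adjoint Q x) (EuclideanSpace.single i 1) *
      inner ℝ x (EuclideanSpace.single i 1) = quad Q x := by
    rw [← IsRadialWeight.inner_self_eq_sum, adjoint_inner_left, real_inner_comm, quad]
  have e : ∀ i : Fin 3, inner ℝ (displacementDeriv g Q x (EuclideanSpace.single i 1))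
      (EuclideanSpace.single i 1) = g (‖x‖ ^ 2) * quad Q x +
        (2 * deriv g (‖x‖ ^ 2) * quad Q x) * (inner ℝ x (EuclideanSpace.single i 1) *
          inner ℝ x (EuclideanSpace.single i 1)) +
        g (‖x‖ ^ 2) * (inner ℝ (Q x) (EuclideanSpace.single i 1) *
          inner ℝ x (EuclideanSpace.single i 1)) +
        g (‖x‖ ^ 2) * (inner ℝ (adjoint Q x) (EuclideanSpace.single i 1) *
          inner ℝ x (EuclideanSpace.single i 1)) := fun i => by
    simp only [displacementDeriv, add_apply, FunLike.coe_smul, Pi.smul_apply, one_apply_eq_self,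
      smulRight_apply, innerSL_apply_apply, inner_add_left, real_inner_smul_left, smul_eq_mul,
      real_inner_self_eq_norm_sq, PiLp.norm_single, norm_one]
    ring
  rw [tr, Finset.sum_congr rfl fun i _ => e i]
  simp only [Finset.sum_add_distrib, ← Finset.mul_sum, h1, h2, h3]
  simp
  ring

/-- In each layer the neutral field has the form `m a + n ⟪x, a⟫ x` with radial `m` and `n`. The
variation then splits into radial weights times three polynomials whose moments have been computed;
their coefficients become `coeffA`, `coeffB` and `coeffC`. -/
theorem inner_pullbackDeriv (g : ℝ → ℝ) {Q : E3 →L[ℝ] E3} (hQ : adjoint Q = Q) (x a c : E3)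
    (m n : ℝ) :
    inner ℝ (pullbackDeriv (displacementDeriv g Q x) (m • a + (n * inner ℝ x a) • x))
      (m • c + (n * inner ℝ x c) • x) =
    ((3 * g (‖x‖ ^ 2) + 2 * ‖x‖ ^ 2 * deriv g (‖x‖ ^ 2)) * m ^ 2) * (quad Q x * inner ℝ a c) +
    ((3 * g (‖x‖ ^ 2) + 2 * ‖x‖ ^ 2 * deriv g (‖x‖ ^ 2)) * (2 * m * n + n ^ 2 * ‖x‖ ^ 2) -
      4 * deriv g (‖x‖ ^ 2) * (m + n * ‖x‖ ^ 2) ^ 2 - 4 * g (‖x‖ ^ 2) * (m + n * ‖x‖ ^ 2) * n) *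
        (quad Q x * (inner ℝ x a * inner ℝ x c)) +
    (-2 * g (‖x‖ ^ 2) * (m + n * ‖x‖ ^ 2) * m) *
      (inner ℝ (Q x) a * inner ℝ x c + inner ℝ (Q x) c * inner ℝ x a) := by
  rw [pullbackDeriv_apply, tr_displacementDeriv]
  simp only [sub_apply, FunLike.coe_smul, Pi.smul_apply, one_apply_eq_self, inner_sub_left,
    adjoint_inner_left, displacementDeriv, add_apply, smulRight_apply, innerSL_apply_apply, hQ,
    inner_add_left, inner_add_right, real_inner_smul_left, real_inner_smul_right, smul_eq_mul,
    real_inner_self_eq_norm_sq, real_inner_comm x a, map_add, map_smul]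
  simp only [← show quad Q x = inner ℝ (Q x) x from rfl]
  ring

/-- Coefficients of the first variation. -/
def coeffA (g : ℝ → ℝ) (α β r : ℝ) : ℝ :=
  (3 * g (r ^ 2) + 2 * r ^ 2 * deriv g (r ^ 2)) * (α + β * (r ^ 3)⁻¹) ^ 2

/-- Coefficients of the first variation. -/
def coeffB (g : ℝ → ℝ) (α β r : ℝ) : ℝ :=
  (3 * g (r ^ 2) + 2 * r ^ 2 * deriv g (r ^ 2)) *
    (2 * (α + β * (r ^ 3)⁻¹) * (-3 * β * (r ^ 5)⁻¹) + (-3 * β * (r ^ 5)⁻¹) ^ 2 * r ^ 2) -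
    4 * deriv g (r ^ 2) * (α + β * (r ^ 3)⁻¹ + -3 * β * (r ^ 5)⁻¹ * r ^ 2) ^ 2 -
    4 * g (r ^ 2) * (α + β * (r ^ 3)⁻¹ + -3 * β * (r ^ 5)⁻¹ * r ^ 2) * (-3 * β * (r ^ 5)⁻¹)

/-- Coefficients of the first variation. -/
def coeffC (g : ℝ → ℝ) (α β r : ℝ) : ℝ :=
  -2 * g (r ^ 2) * (α + β * (r ^ 3)⁻¹ + -3 * β * (r ^ 5)⁻¹ * r ^ 2) * (α + β * (r ^ 3)⁻¹)

/-- Radial primitives of the first variation. -/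
def primTrace (g : ℝ → ℝ) (α β r : ℝ) : ℝ :=
  r ^ 5 * g (r ^ 2) * (4 * (α + β * (r ^ 3)⁻¹) ^ 2 - (α - 2 * β * (r ^ 3)⁻¹) ^ 2) / 15

/-- Radial primitives of the first variation. -/
def primQuad (g : ℝ → ℝ) (α β r : ℝ) : ℝ :=
  -(r ^ 5 * g (r ^ 2) * (2 / 15) * ((α + β * (r ^ 3)⁻¹) ^ 2 + (α - 2 * β * (r ^ 3)⁻¹) ^ 2))

/-- The weights `1/3` and `1/15` come from the second and fourth moments. That the result is a total
radial derivative reflects that the field is curl free and divergence free in the annulus: a first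
variation then reduces to boundary terms. The expressions `α + β r⁻³` and `α - 2 β r⁻³` are the
tangential and radial amplitudes of the field. -/
theorem hasDerivAt_primTrace {g : ℝ → ℝ} (hg : ContDiff ℝ (⊤ : ℕ∞) g)
    (α β : ℝ) {r : ℝ} (hr : 0 < r) :
    HasDerivAt (primTrace g α β)
      (r ^ 2 * (coeffA g α β r * r ^ 2) / 3 + r ^ 2 * (coeffB g α β r * r ^ 4) / 15) r := by
  have h1 : HasDerivAt (fun r : ℝ => g (r ^ 2)) (deriv g (r ^ 2) * (2 * r)) r := by
    have := ((hg.differentiable (by simp)) (r ^ 2)).hasDerivAt.comp r (hasDerivAt_pow 2 r)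
    exact this.congr_deriv (by simp)
  have h2 : HasDerivAt (fun r : ℝ => (r ^ 3)⁻¹) (-3 * (r ^ 4)⁻¹) r :=
    ((hasDerivAt_pow 3 r).inv (by positivity)).congr_deriv (by simp; field_simp)
  have h := ((((hasDerivAt_pow 5 r).mul h1).mul ((((h2.const_mul β).const_add α).pow 2).const_mul 4
    |>.sub (((h2.const_mul (2 * β)).const_sub α).pow 2))).div_const 15)
  refine HasDerivAt.congr_deriv (f := primTrace g α β) h ?_
  simp [coeffA, coeffB]
  field_simp
  ring

theorem hasDerivAt_primQuad {g : ℝ → ℝ} (hg : ContDiff ℝ (⊤ : ℕ∞) g)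
    (α β : ℝ) {r : ℝ} (hr : 0 < r) :
    HasDerivAt (primQuad g α β)
      (2 * (r ^ 2 * (coeffB g α β r * r ^ 4)) / 15 + 2 * (r ^ 2 * (coeffC g α β r * r ^ 2)) / 3)
      r := by
  have h1 : HasDerivAt (fun r : ℝ => g (r ^ 2)) (deriv g (r ^ 2) * (2 * r)) r := by
    have := ((hg.differentiable (by simp)) (r ^ 2)).hasDerivAt.comp r (hasDerivAt_pow 2 r)
    exact this.congr_deriv (by simp)
  have h2 : HasDerivAt (fun r : ℝ => (r ^ 3)⁻¹) (-3 * (r ^ 4)⁻¹) r :=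
    ((hasDerivAt_pow 3 r).inv (by positivity)).congr_deriv (by simp; field_simp)
  have h := ((((hasDerivAt_pow 5 r).mul h1).mul_const (2 / 15)).mul
    ((((h2.const_mul β).const_add α).pow 2).add (((h2.const_mul (2 * β)).const_sub α).pow 2))).neg
  refine HasDerivAt.congr_deriv (f := primQuad g α β) h ?_
  simp [coeffB, coeffC]
  field_simp
  ring

theorem continuousOn_coeff {g : ℝ → ℝ} (hg : ContDiff ℝ (⊤ : ℕ∞) g)
    (α β : ℝ) {lo hi : ℝ} (hlo : 0 < lo) :
    ContinuousOn (coeffA g α β) (Set.Icc lo hi) ∧ ContinuousOn (coeffB g α β) (Set.Icc lo hi) ∧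
      ContinuousOn (coeffC g α β) (Set.Icc lo hi) := by
  have h1 : Continuous g := hg.continuous
  have h2 : Continuous (deriv g) := hg.continuous_deriv (by simp)
  have h3 : ∀ r ∈ Set.Icc lo hi, r ^ 3 ≠ 0 := fun r hr => (pow_pos (hlo.trans_le hr.1) 3).ne'
  have h5 : ∀ r ∈ Set.Icc lo hi, r ^ 5 ≠ 0 := fun r hr => (pow_pos (hlo.trans_le hr.1) 5).ne'
  refine ⟨?_, ?_, ?_⟩
  · unfold coeffA; fun_prop (disch := assumption)
  · unfold coeffB; fun_prop (disch := assumption)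
  · unfold coeffC; fun_prop (disch := assumption)

theorem radialMean_annulus {lo hi : ℝ} (hlo : 0 < lo) (hhi : lo ≤ hi) (K : ℝ → ℝ) (k : ℕ) :
    radialMean ((Set.Ico lo hi).indicator K) (fun x => ‖x‖ ^ k) =
      3 * volume.real (ball (0 : E3) 1) * ∫ r in lo..hi, r ^ 2 * (K r * r ^ k) := by
  rw [← integral_annulus hlo hhi, radialMean]
  congr 1
  ext x
  by_cases hx : ‖x‖ ∈ Set.Ico lo hi
  · simp [Set.indicator_of_mem hx]
  · rw [Set.indicator_of_notMem hx, Set.indicator_of_notMem hx, zero_mul]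

theorem integral_variation_annulus {g : ℝ → ℝ} (hg : ContDiff ℝ (⊤ : ℕ∞) g)
    (α β : ℝ) {lo hi : ℝ} (hlo : 0 < lo) (hhi : lo ≤ hi)
    {Q : E3 →L[ℝ] E3} (hQ : adjoint Q = Q) (a c : E3) :
    Integrable ((norm ⁻¹' Set.Ico lo hi).indicator fun x : E3 =>
      (inner ℝ (pullbackDeriv (displacementDeriv g Q x)
        ((α + β * (‖x‖ ^ 3)⁻¹) • a + (-3 * β * (‖x‖ ^ 5)⁻¹ * inner ℝ x a) • x))
        ((α + β * (‖x‖ ^ 3)⁻¹) • c + (-3 * β * (‖x‖ ^ 5)⁻¹ * inner ℝ x c) • x) : ℝ)) ∧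
    ∫ x, (norm ⁻¹' Set.Ico lo hi).indicator (fun x : E3 =>
      (inner ℝ (pullbackDeriv (displacementDeriv g Q x)
        ((α + β * (‖x‖ ^ 3)⁻¹) • a + (-3 * β * (‖x‖ ^ 5)⁻¹ * inner ℝ x a) • x))
        ((α + β * (‖x‖ ^ 3)⁻¹) • c + (-3 * β * (‖x‖ ^ 5)⁻¹ * inner ℝ x c) • x) : ℝ)) x =
      3 * volume.real (ball (0 : E3) 1) *
        (tr Q * inner ℝ a c * (primTrace g α β hi - primTrace g α β lo) +
          inner ℝ (Q a) c * (primQuad g α β hi - primQuad g α β lo)) := by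
  obtain ⟨cA, cB, cC⟩ := continuousOn_coeff hg α β hlo (hi := hi)
  have wA := isRadialWeight_annulus cA
  have wB := isRadialWeight_annulus cB
  have wC := isRadialWeight_annulus cC
  have hq : Continuous (quad Q) := (contDiff_quad Q).continuous
  have e : ((norm ⁻¹' Set.Ico lo hi).indicator fun x : E3 =>
      (inner ℝ (pullbackDeriv (displacementDeriv g Q x)
        ((α + β * (‖x‖ ^ 3)⁻¹) • a + (-3 * β * (‖x‖ ^ 5)⁻¹ * inner ℝ x a) • x))
        ((α + β * (‖x‖ ^ 3)⁻¹) • c + (-3 * β * (‖x‖ ^ 5)⁻¹ * inner ℝ x c) • x) : ℝ)) = fun x =>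
      (Set.Ico lo hi).indicator (coeffA g α β) ‖x‖ * (inner ℝ a c * inner ℝ (Q x) x) +
      (Set.Ico lo hi).indicator (coeffB g α β) ‖x‖ *
        (inner ℝ (Q x) x * (inner ℝ x a * inner ℝ x c)) +
      (Set.Ico lo hi).indicator (coeffC g α β) ‖x‖ *
        (inner ℝ (Q x) a * inner ℝ x c + inner ℝ (Q x) c * inner ℝ x a) := by
    ext x
    by_cases hx : ‖x‖ ∈ Set.Ico lo hi
    · have hx' : x ∈ norm ⁻¹' Set.Ico lo hi := hx
      rw [Set.indicator_of_mem hx', Set.indicator_of_mem hx, Set.indicator_of_mem hx,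
        Set.indicator_of_mem hx, inner_pullbackDeriv g hQ, mul_comm (inner ℝ a c)]
      rfl
    · have hx' : x ∉ norm ⁻¹' Set.Ico lo hi := hx
      rw [Set.indicator_of_notMem hx', Set.indicator_of_notMem hx, Set.indicator_of_notMem hx,
        Set.indicator_of_notMem hx]
      ring
  have iA := wA.integrable_mul (p := fun x => inner ℝ a c * inner ℝ (Q x) x) (by fun_prop)
  have iB := wB.integrable_mul (p := fun x => inner ℝ (Q x) x * (inner ℝ x a * inner ℝ x c))
    (by fun_prop)
  have iC := wC.integrable_mul (p := fun x =>
    inner ℝ (Q x) a * inner ℝ x c + inner ℝ (Q x) c * inner ℝ x a) (by fun_prop)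
  have iAB : Integrable fun x => (Set.Ico lo hi).indicator (coeffA g α β) ‖x‖ *
      (inner ℝ a c * inner ℝ (Q x) x) + (Set.Ico lo hi).indicator (coeffB g α β) ‖x‖ *
        (inner ℝ (Q x) x * (inner ℝ x a * inner ℝ x c)) := iA.add iB
  rw [e]
  refine ⟨iAB.add iC, ?_⟩
  rw [integral_add iAB iC, integral_add iA iB]
  have kA : ∫ x, (Set.Ico lo hi).indicator (coeffA g α β) ‖x‖ * (inner ℝ a c * inner ℝ (Q x) x) =
      _ := (radialMean_const_mul _ _ _).trans (congrArg _ (wA.moment_quadratic Q))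
  have kB : ∫ x, (Set.Ico lo hi).indicator (coeffB g α β) ‖x‖ *
      (inner ℝ (Q x) x * (inner ℝ x a * inner ℝ x c)) = _ := wB.moment_quadratic_mul Q a c
  have kC : ∫ x, (Set.Ico lo hi).indicator (coeffC g α β) ‖x‖ *
      (inner ℝ (Q x) a * inner ℝ x c + inner ℝ (Q x) c * inner ℝ x a) = _ :=
    (wC.radialMean_add (p := fun x => inner ℝ (Q x) a * inner ℝ x c)
      (q := fun x => inner ℝ (Q x) c * inner ℝ x a) (by fun_prop) (by fun_prop)).trans
      (congrArg₂ _ (wC.moment_apply Q a c) (wC.moment_apply Q c a))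
  have hsym : ∀ u v : E3, inner ℝ u (Q v) = (inner ℝ (Q u) v : ℝ) := fun u v => by
    rw [← adjoint_inner_right, hQ]
  have hQc : (inner ℝ (Q c) a : ℝ) = inner ℝ (Q a) c := by rw [← hsym, real_inner_comm]
  rw [kA, kB, kC, radialMean_annulus hlo hhi, radialMean_annulus hlo hhi,
    radialMean_annulus hlo hhi, hsym, hsym, hQc]
  have hu : Set.uIcc lo hi = Set.Icc lo hi := Set.uIcc_of_le hhi
  have jA : IntervalIntegrable (fun r => r ^ 2 * (coeffA g α β r * r ^ 2)) volume lo hi :=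
    ContinuousOn.intervalIntegrable (by rw [hu]; fun_prop)
  have jB : IntervalIntegrable (fun r => r ^ 2 * (coeffB g α β r * r ^ 4)) volume lo hi :=
    ContinuousOn.intervalIntegrable (by rw [hu]; fun_prop)
  have jC : IntervalIntegrable (fun r => r ^ 2 * (coeffC g α β r * r ^ 2)) volume lo hi :=
    ContinuousOn.intervalIntegrable (by rw [hu]; fun_prop)
  have f1 : (∫ r in lo..hi, r ^ 2 * (coeffA g α β r * r ^ 2)) / 3 +
      (∫ r in lo..hi, r ^ 2 * (coeffB g α β r * r ^ 4)) / 15 =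
      primTrace g α β hi - primTrace g α β lo := by
    rw [← intervalIntegral.integral_div, ← intervalIntegral.integral_div,
      ← intervalIntegral.integral_add (jA.div_const 3) (jB.div_const 15)]
    refine intervalIntegral.integral_eq_sub_of_hasDerivAt (fun r hr => ?_)
      ((jA.div_const 3).add (jB.div_const 15))
    rw [hu] at hr
    exact hasDerivAt_primTrace hg α β (hlo.trans_le hr.1)
  have f2 : 2 * (∫ r in lo..hi, r ^ 2 * (coeffB g α β r * r ^ 4)) / 15 +
      2 * (∫ r in lo..hi, r ^ 2 * (coeffC g α β r * r ^ 2)) / 3 =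
      primQuad g α β hi - primQuad g α β lo := by
    rw [← intervalIntegral.integral_const_mul, ← intervalIntegral.integral_const_mul,
      ← intervalIntegral.integral_div, ← intervalIntegral.integral_div,
      ← intervalIntegral.integral_add ((jB.const_mul 2).div_const 15) ((jC.const_mul 2).div_const 3)]
    refine intervalIntegral.integral_eq_sub_of_hasDerivAt (fun r hr => ?_)
      (((jB.const_mul 2).div_const 15).add ((jC.const_mul 2).div_const 3))
    rw [hu] at hr
    exact hasDerivAt_primQuad hg α β (hlo.trans_le hr.1)
  rw [← f1, ← f2]
  ring

theorem add_neutralField_of_mem {ri re β : ℝ} (a : E3) {x : E3} (hx : ri < ‖x‖)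
    (hx' : ‖x‖ < re) : a + neutralField ri re β a x =
      ((1 - β * (re ^ 3)⁻¹) + β * (‖x‖ ^ 3)⁻¹) • a + (-3 * β * (‖x‖ ^ 5)⁻¹ * inner ℝ x a) • x := by
  rw [neutralField, shellProfile_of_mem hx.le hx'.le]
  simp only [shellProfileGrad, hx, hx', and_self, if_true, real_inner_comm x a]
  module

/-- The first variation of the polarization form at the neutral configuration, in the direction of
a radial displacement of the outer boundary. -/
theorem shape_derivative {σc σs σm ri r₀ re R : ℝ} {g : ℝ → ℝ} (hσs : 0 < σs) (hri : 0 < ri)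
    (h₀ : ri < r₀) (hre : r₀ < re) (hR : re < R) (hg : IsProfile r₀ R g)
    (hg1 : g (re ^ 2) * re ^ 3 = 1) {Q : E3 →L[ℝ] E3} (hQ : adjoint Q = Q) (a c : E3) :
    ∫ x, inner ℝ ((conductivity (ball 0 ri) (ball 0 re) σc σs σm x •
        pullbackDeriv (displacementDeriv g Q x))
        (a + neutralField ri re (dipoleStrength σs σm re) a x))
        (c + neutralField ri re (dipoleStrength σs σm re) c x) =
      3 * volume.real (ball (0 : E3) 1) * re ^ 2 * σs / 15 *
        ((1 - σm / σs) * (4 + σm / σs) * (tr Q * inner ℝ a c) -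
          2 * (1 - σm / σs) ^ 2 * inner ℝ (Q a) c) := by
  set β := dipoleStrength σs σm re with hβ
  have hr0 : 0 < r₀ := hri.trans h₀
  have hre0 : 0 < re := hr0.trans hre
  -- The shell carries a uniform field plus a dipole field; outside the outer sphere the neutral
  -- field is uniform, which is the case `α = 1`, `β = 0`.
  obtain ⟨i1, e1⟩ := integral_variation_annulus hg.contDiff (1 - β * (re ^ 3)⁻¹) β hr0 hre.le hQ a c
  obtain ⟨i2, e2⟩ := integral_variation_annulus hg.contDiff 1 0 hre0 hR.le hQ a c
  have e : ∀ x, inner ℝ ((conductivity (ball 0 ri) (ball 0 re) σc σs σm x •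
        pullbackDeriv (displacementDeriv g Q x))
        (a + neutralField ri re β a x)) (c + neutralField ri re β c x) =
      σs * (norm ⁻¹' Set.Ico r₀ re).indicator (fun x : E3 =>
        (inner ℝ (pullbackDeriv (displacementDeriv g Q x)
          (((1 - β * (re ^ 3)⁻¹) + β * (‖x‖ ^ 3)⁻¹) • a +
            (-3 * β * (‖x‖ ^ 5)⁻¹ * inner ℝ x a) • x))
          (((1 - β * (re ^ 3)⁻¹) + β * (‖x‖ ^ 3)⁻¹) • c +
            (-3 * β * (‖x‖ ^ 5)⁻¹ * inner ℝ x c) • x) : ℝ)) x +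
      σm * (norm ⁻¹' Set.Ico re R).indicator (fun x : E3 =>
        (inner ℝ (pullbackDeriv (displacementDeriv g Q x)
          ((1 + 0 * (‖x‖ ^ 3)⁻¹) • a + (-3 * 0 * (‖x‖ ^ 5)⁻¹ * inner ℝ x a) • x))
          ((1 + 0 * (‖x‖ ^ 3)⁻¹) • c + (-3 * 0 * (‖x‖ ^ 5)⁻¹ * inner ℝ x c) • x) : ℝ)) x := by
    intro x
    have n1 : ‖x‖ < r₀ ∨ re ≤ ‖x‖ → x ∉ norm ⁻¹' Set.Ico r₀ re := fun h hx =>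
      h.elim (fun h => h.not_ge hx.1) fun h => h.not_gt hx.2
    have n2 : ‖x‖ < re ∨ R ≤ ‖x‖ → x ∉ norm ⁻¹' Set.Ico re R := fun h hx =>
      h.elim (fun h => h.not_ge hx.1) fun h => h.not_gt hx.2
    rcases lt_or_ge ‖x‖ r₀ with h | h
    · rw [Set.indicator_of_notMem (n1 (Or.inl h)),
        Set.indicator_of_notMem (n2 (Or.inl (h.trans hre))), hg.displacementDeriv_of_le Q h.le,
        map_zero, FunLike.coe_smul, Pi.smul_apply, zero_apply, smul_zero, inner_zero_left]
      ring
    rcases lt_or_ge ‖x‖ re with h' | h'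
    · have hσ : conductivity (ball (0 : E3) ri) (ball 0 re) σc σs σm x = σs := by
        simp [conductivity, (h₀.trans_le h).le, h']
      have hm : x ∈ norm ⁻¹' Set.Ico r₀ re := ⟨h, h'⟩
      rw [Set.indicator_of_notMem (n2 (Or.inl h')), Set.indicator_of_mem hm, hσ,
        add_neutralField_of_mem a (h₀.trans_le h) h', add_neutralField_of_mem c (h₀.trans_le h) h',
        FunLike.coe_smul, Pi.smul_apply, real_inner_smul_left, mul_zero, add_zero]
    have hσ : conductivity (ball (0 : E3) ri) (ball 0 re) σc σs σm x = σm := by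
      simp [conductivity, (h₀.trans_le h).not_gt, h'.not_gt]
    have hx : x ∉ ball (0 : E3) re := by simpa using h'
    rw [Set.indicator_of_notMem (n1 (Or.inr h')), hσ,
      neutralField_eq_zero (h₀.trans hre) β a hx, neutralField_eq_zero (h₀.trans hre) β c hx,
      FunLike.coe_smul, Pi.smul_apply, real_inner_smul_left, mul_zero, zero_add, add_zero, add_zero]
    rcases lt_or_ge ‖x‖ R with h'' | h''
    · have hm : x ∈ norm ⁻¹' Set.Ico re R := ⟨h', h''⟩
      rw [Set.indicator_of_mem hm]
      simp only [zero_mul, mul_zero, add_zero, one_smul, zero_smul]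
    · rw [Set.indicator_of_notMem (n2 (Or.inr h'')),
        hg.displacementDeriv_of_ge (hre0.trans hR).le Q h'', map_zero, zero_apply, inner_zero_left]
  simp_rw [e]
  rw [integral_add (i1.const_mul σs) (i2.const_mul σm), integral_const_mul, integral_const_mul,
    e1, e2]
  -- The profile vanishes at `r₀` and at `R`, so only the jump of the primitives across the outer
  -- sphere survives.
  have hgre : g (re ^ 2) = (re ^ 3)⁻¹ := eq_inv_of_mul_eq_one_left hg1
  simp only [primTrace, primQuad, hg.eq_zero_of_le _ le_rfl, hg.eq_zero_of_ge _ le_rfl, hgre, hβ,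
    dipoleStrength]
  field_simp
  ring

end

section


open Filter Topology ContinuousLinearMap

/-! ### Perturbation of the polarization form -/

theorem abs_inner_sub_inner_le {H : Type*} [NormedAddCommGroup H] [InnerProductSpace ℝ H]
    (K : H →L[ℝ] H) {x y x₀ y₀ : H} {κ B t : ℝ} (hK : ‖K‖ ≤ κ) (hx₀ : ‖x₀‖ ≤ B) (hy₀ : ‖y₀‖ ≤ B)
    (hx : ‖x - x₀‖ ≤ t) (hy : ‖y - y₀‖ ≤ t) :
    |inner ℝ (K x) y - inner ℝ (K x₀) y₀| ≤ κ * (t * (2 * B + t)) := by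
  have hκ := (norm_nonneg K).trans hK
  have hB := (norm_nonneg x₀).trans hx₀
  have ht := (norm_nonneg _).trans hx
  have hy' : ‖y‖ ≤ B + t := by
    have : y = y₀ + (y - y₀) := by abel
    rw [this]
    exact (norm_add_le _ _).trans (add_le_add hy₀ hy)
  have e : inner ℝ (K x) y - inner ℝ (K x₀) y₀ =
      inner ℝ (K (x - x₀)) y + inner ℝ (K x₀) (y - y₀) := by
    rw [map_sub, inner_sub_left, inner_sub_right]; ring
  rw [e]
  refine (abs_add_le _ _).trans ?_
  have h1 : |inner ℝ (K (x - x₀)) y| ≤ κ * t * (B + t) :=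
    (abs_real_inner_le_norm _ _).trans (mul_le_mul ((K.le_opNorm _).trans (by gcongr)) hy'
      (norm_nonneg _) (by positivity))
  have h2 : |inner ℝ (K x₀) (y - y₀)| ≤ κ * B * t :=
    (abs_real_inner_le_norm _ _).trans (mul_le_mul ((K.le_opNorm _).trans (by gcongr)) hy
      (norm_nonneg _) (by positivity))
  linarith

/-- The polarization form depends on the medium almost linearly. -/
theorem IsCorrector.abs_polarization_sub_sub_le {H : Type*} [NormedAddCommGroup H]
    [InnerProductSpace ℝ H] {G : Submodule ℝ H} {s lam : ℝ} {N₀ N N' K : H →L[ℝ] H}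
    {v w p₀ q₀ p p' q' : H} {B θ η κ : ℝ} (hlam : 0 < lam) (hN : IsCoerciveOn G s lam N)
    (hN' : IsCoerciveOn G s lam N') (hsymm : ∀ x y, inner ℝ (N' x) y = inner ℝ x (N' y))
    (hp₀ : IsCorrector G s N₀ v p₀) (hq₀ : IsCorrector G s N₀ w q₀) (hp : IsCorrector G s N v p)
    (hp' : IsCorrector G s N' v p') (hq' : IsCorrector G s N' w q')
    (hBv : ‖v + p₀‖ ≤ B) (hBw : ‖w + q₀‖ ≤ B) (hθ : ‖(N - N₀) (v + p₀)‖ ≤ θ)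
    (hθ' : ‖(N' - N₀) (w + q₀)‖ ≤ θ) (hη : ‖N - N' - K‖ ≤ η) (hκ : ‖K‖ ≤ κ) :
    |inner ℝ (N (v + p)) w - inner ℝ (N' (v + p')) w - inner ℝ (K (v + p₀)) (w + q₀)| ≤
      η * (B + lam⁻¹ * θ) ^ 2 + κ * (lam⁻¹ * θ * (2 * B + lam⁻¹ * θ)) := by
  have t1 : ‖(v + p) - (v + p₀)‖ ≤ lam⁻¹ * θ := by
    rw [add_sub_add_left_eq_sub]
    exact (hp.norm_sub_le hlam hN hp₀).trans (by gcongr)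
  have t2 : ‖(w + q') - (w + q₀)‖ ≤ lam⁻¹ * θ := by
    rw [add_sub_add_left_eq_sub]
    exact (hq'.norm_sub_le hlam hN' hq₀).trans (by gcongr)
  have n1 : ‖v + p‖ ≤ B + lam⁻¹ * θ := by
    have : v + p = (v + p₀) + ((v + p) - (v + p₀)) := by abel
    rw [this]
    exact (norm_add_le _ _).trans (add_le_add hBv t1)
  have n2 : ‖w + q'‖ ≤ B + lam⁻¹ * θ := by
    have : w + q' = (w + q₀) + ((w + q') - (w + q₀)) := by abel
    rw [this]
    exact (norm_add_le _ _).trans (add_le_add hBw t2)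
  have hη0 := (norm_nonneg _).trans hη
  have hB0 := (norm_nonneg _).trans n1
  -- The difference of the forms is exactly a pairing with `N - N'`. It remains to replace `N - N'`
  -- by its linearization `K`, at the cost `η`, and the two perturbed fields by the reference
  -- fields, at the cost `lam⁻¹ θ` each.
  have e : inner ℝ (N (v + p)) w - inner ℝ (N' (v + p')) w - inner ℝ (K (v + p₀)) (w + q₀) =
      inner ℝ ((N - N' - K) (v + p)) (w + q') +
        (inner ℝ (K (v + p)) (w + q') - inner ℝ (K (v + p₀)) (w + q₀)) := by
    rw [hp'.polarization_symm hsymm hq', hp.polarization_sub hsymm hq', sub_apply (N - N'),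
      inner_sub_left]
    ring
  rw [e]
  refine (abs_add_le _ _).trans (add_le_add ?_
    (abs_inner_sub_inner_le K hκ hBv hBw t1 t2))
  refine (abs_real_inner_le_norm _ _).trans ?_
  calc ‖(N - N' - K) (v + p)‖ * ‖w + q'‖ ≤
      (η * (B + lam⁻¹ * θ)) * (B + lam⁻¹ * θ) := by
        refine mul_le_mul ((le_opNorm _ _).trans (by gcongr)) n2 (norm_nonneg _) (by positivity)
    _ = _ := by ring

/-- Symmetry moves `N' - N` onto the field `w + q` of one of the media. It is thus enough that the
change of medium be small on a fixed field. -/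
theorem IsCorrector.abs_polarization_sub_le {H : Type*} [NormedAddCommGroup H]
    [InnerProductSpace ℝ H] {G : Submodule ℝ H} {s : ℝ} {N N' : H →L[ℝ] H}
    {v w p p' q : H} {B θ : ℝ} (hsymm : ∀ x y, inner ℝ (N x) y = inner ℝ x (N y))
    (hsymm' : ∀ x y, inner ℝ (N' x) y = inner ℝ x (N' y))
    (hp : IsCorrector G s N v p) (hq : IsCorrector G s N w q)
    (hp' : IsCorrector G s N' v p') (hB : ‖v + p'‖ ≤ B) (hθ : ‖(N' - N) (w + q)‖ ≤ θ) :
    |inner ℝ (N' (v + p')) w - inner ℝ (N (v + p)) w| ≤ B * θ := by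
  rw [hp.polarization_symm hsymm hq, hp'.polarization_sub hsymm hq, sub_apply, inner_sub_left,
    hsymm', hsymm, ← inner_sub_right, ← sub_apply]
  exact (abs_real_inner_le_norm _ _).trans
    (mul_le_mul hB hθ (norm_nonneg _) ((norm_nonneg _).trans hB))

/-! ### Endomorphisms given by their entries -/

/-- The endomorphism with the given matrix entries. -/
def ofEntries (m : Fin 3 → Fin 3 → ℝ) : E3 →L[ℝ] E3 :=
  ∑ i : Fin 3, ∑ j : Fin 3, m i j • (innerSL ℝ (EuclideanSpace.single i 1 : E3)).smulRight
    (EuclideanSpace.single j 1 : E3)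

theorem inner_ofEntries (m : Fin 3 → Fin 3 → ℝ) (i j : Fin 3) :
    inner ℝ (ofEntries m (EuclideanSpace.single i 1)) (EuclideanSpace.single j 1) = m i j := by
  simp [ofEntries, sum_apply, EuclideanSpace.inner_single_right, Pi.single_apply]

theorem clm_ext_entries {S T : E3 →L[ℝ] E3}
    (h : ∀ i j : Fin 3, (inner ℝ (S (EuclideanSpace.single i 1)) (EuclideanSpace.single j 1) : ℝ) =
      inner ℝ (T (EuclideanSpace.single i 1)) (EuclideanSpace.single j 1)) : S = T := by
  refine ContinuousLinearMap.coe_injective ((EuclideanSpace.basisFun (Fin 3) ℝ).toBasis.ext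
    fun i => ?_)
  ext j
  simpa [EuclideanSpace.inner_single_right] using h i j

theorem ofEntries_inner (T : E3 →L[ℝ] E3) : ofEntries (fun i j =>
    inner ℝ (T (EuclideanSpace.single i 1)) (EuclideanSpace.single j 1)) = T :=
  clm_ext_entries fun i j => inner_ofEntries _ i j

theorem ofEntries_sub (m m' : Fin 3 → Fin 3 → ℝ) :
    ofEntries (fun i j => m i j - m' i j) = ofEntries m - ofEntries m' :=
  clm_ext_entries fun i j => by
    rw [sub_apply, inner_sub_left, inner_ofEntries, inner_ofEntries, inner_ofEntries]

theorem adjoint_ofEntries {m : Fin 3 → Fin 3 → ℝ} (hm : ∀ i j, m i j = m j i) :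
    adjoint (ofEntries m) = ofEntries m :=
  clm_ext_entries fun i j => by
    rw [adjoint_inner_left, real_inner_comm, inner_ofEntries, inner_ofEntries, hm]

theorem norm_ofEntries_le {m : Fin 3 → Fin 3 → ℝ} {C : ℝ} (hm : ∀ i j, |m i j| ≤ C) :
    ‖ofEntries m‖ ≤ 9 * C := by
  have h : ∀ i j : Fin 3, ‖m i j • (innerSL ℝ (EuclideanSpace.single i 1 : E3)).smulRight
      (EuclideanSpace.single j 1 : E3)‖ ≤ C := fun i j => by
    rw [norm_smul, norm_smulRight_apply, innerSL_apply_norm, PiLp.norm_single, PiLp.norm_single]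
    simpa using hm i j
  refine (norm_sum_le_of_le (f := fun i => ∑ j : Fin 3, m i j •
    (innerSL ℝ (EuclideanSpace.single i 1 : E3)).smulRight (EuclideanSpace.single j 1 : E3))
    (n := fun _ => ∑ _ : Fin 3, C) _ fun i _ => norm_sum_le_of_le _ fun j _ => h i j).trans ?_
  simp
  linarith

/-- The linearized map from symmetric boundary perturbations to polarization tensors. -/
def shapeMap (κ₁ κ₂ : ℝ) (Q : E3 →L[ℝ] E3) : E3 →L[ℝ] E3 := (κ₁ * tr Q) • 1 - κ₂ • Q

/-- The inverse of `shapeMap`. -/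
def shapeInv (κ₁ κ₂ : ℝ) : (E3 →L[ℝ] E3) →L[ℝ] (E3 →L[ℝ] E3) :=
  -(κ₂⁻¹ • (ContinuousLinearMap.id ℝ _ - (κ₁ / (3 * κ₁ - κ₂)) • trL.smulRight 1))

theorem shapeInv_apply (κ₁ κ₂ : ℝ) (T : E3 →L[ℝ] E3) :
    shapeInv κ₁ κ₂ T = -(κ₂⁻¹ • (T - (κ₁ / (3 * κ₁ - κ₂) * tr T) • 1)) := by
  ext y : 1
  simp [shapeInv, trL_apply, smul_smul]

theorem tr_shapeMap (κ₁ κ₂ : ℝ) (Q : E3 →L[ℝ] E3) :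
    tr (shapeMap κ₁ κ₂ Q) = (3 * κ₁ - κ₂) * tr Q := by
  simp [shapeMap, tr, Fin.sum_univ_three, inner_sub_left, real_inner_smul_left, PiLp.norm_single]
  ring

/-- The map acts as `3 κ₁ - κ₂` on multiples of the identity and as `-κ₂` on matrices of trace zero,
whence the two conditions. -/
theorem shapeInv_shapeMap {κ₁ κ₂ : ℝ} (h₂ : κ₂ ≠ 0) (h₁ : 3 * κ₁ - κ₂ ≠ 0) (Q : E3 →L[ℝ] E3) :
    shapeInv κ₁ κ₂ (shapeMap κ₁ κ₂ Q) = Q := by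
  rw [shapeInv_apply, tr_shapeMap, shapeMap]
  ext y : 1
  simp only [neg_apply, FunLike.coe_smul, Pi.smul_apply, sub_apply, one_apply_eq_self]
  obtain ⟨d, hd⟩ : ∃ d, d = 3 * κ₁ - κ₂ := ⟨_, rfl⟩
  obtain rfl : κ₁ = (d + κ₂) / 3 := by rw [hd]; ring
  rw [← hd] at h₁ ⊢
  match_scalars <;> field_simp <;> ring

theorem shapeInv_injective {κ₁ κ₂ : ℝ} (h₂ : κ₂ ≠ 0) (h₁ : 3 * κ₁ - κ₂ ≠ 0) {T : E3 →L[ℝ] E3}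
    (hT : shapeInv κ₁ κ₂ T = 0) : T = 0 := by
  have htr : tr T = 0 := by
    have : tr (shapeInv κ₁ κ₂ T) = (3 * κ₁ - κ₂)⁻¹ * tr T := by
      rw [shapeInv_apply]
      obtain ⟨d, hd⟩ : ∃ d, d = 3 * κ₁ - κ₂ := ⟨_, rfl⟩
      obtain rfl : κ₁ = (d + κ₂) / 3 := by rw [hd]; ring
      rw [← hd] at h₁ ⊢
      simp [tr, Fin.sum_univ_three, inner_sub_left, real_inner_smul_left, PiLp.norm_single]
      field_simp
      ring
    rw [hT] at this
    have h0 : tr (0 : E3 →L[ℝ] E3) = 0 := by simp [tr]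
    rw [h0] at this
    exact (mul_eq_zero.mp this.symm).resolve_left (inv_ne_zero h₁)
  have := hT
  rw [shapeInv_apply, htr] at this
  ext1 y
  have := DFunLike.congr_fun this y
  simpa [h₂] using this

theorem adjoint_shapeInv {κ₁ κ₂ : ℝ} {T : E3 →L[ℝ] E3} (hT : adjoint T = T) :
    adjoint (shapeInv κ₁ κ₂ T) = shapeInv κ₁ κ₂ T := by
  rw [shapeInv_apply, map_neg, ← adjointL_apply, map_smul, map_sub, map_smul, adjointL_apply,
    adjointL_apply, hT, adjoint_one]

/-- A fixed point theorem on the intersection of a ball with a closed set. -/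
theorem exists_fixedPoint_of_contraction {E : Type*} [NormedAddCommGroup E] [CompleteSpace E]
    {S : Set E} (hS : IsClosed S) (h0 : (0 : E) ∈ S) {F : E → E} {ρ : ℝ} (hρ : 0 ≤ ρ)
    (hFS : ∀ x ∈ S, ‖x‖ ≤ ρ → F x ∈ S)
    (hF : ∀ x ∈ S, ∀ y ∈ S, ‖x‖ ≤ ρ → ‖y‖ ≤ ρ → ‖F x - F y‖ ≤ 1 / 2 * ‖x - y‖)
    (hF0 : ‖F 0‖ ≤ ρ / 2) : ∃ x ∈ S, ‖x‖ ≤ ρ ∧ F x = x := by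
  set K : Set E := S ∩ closedBall 0 ρ
  have hK : IsClosed K := hS.inter isClosed_closedBall
  have hmaps : Set.MapsTo F K K := fun x hx => by
    have hxρ : ‖x‖ ≤ ρ := mem_closedBall_zero_iff.mp hx.2
    refine ⟨hFS x hx.1 hxρ, mem_closedBall_zero_iff.mpr ?_⟩
    have h1 := hF x hx.1 0 h0 hxρ (by simpa using hρ)
    rw [sub_zero] at h1
    have : F x = (F x - F 0) + F 0 := by abel
    rw [this]
    exact (norm_add_le _ _).trans (by linarith)
  have hcontr : ContractingWith (1 / 2) (hmaps.restrict F K K) := by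
    refine ⟨by rw [← NNReal.coe_lt_coe]; norm_num, LipschitzWith.of_dist_le_mul fun x y => ?_⟩
    have := hF x x.2.1 y y.2.1 (mem_closedBall_zero_iff.mp x.2.2)
      (mem_closedBall_zero_iff.mp y.2.2)
    rw [Subtype.dist_eq, Subtype.dist_eq, dist_eq_norm, dist_eq_norm]
    simpa using this
  obtain ⟨x, hx, hfx, -⟩ := hcontr.exists_fixedPoint' hK.isComplete hmaps (x := 0)
    ⟨h0, by simpa using hρ⟩ (edist_ne_top _ _)
  exact ⟨x, hx.1, mem_closedBall_zero_iff.mp hx.2, hfx⟩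

end

section


open Filter Topology ContinuousLinearMap

/-! ### The family of pulled back media -/

theorem exists_pullbackMatrix_approx {η : ℝ} (hη : 0 < η) : ∃ δ, 0 < δ ∧
    ∀ X Y : E3 →L[ℝ] E3, ‖X‖ ≤ δ → ‖Y‖ ≤ δ →
      ‖pullbackMatrix X - pullbackMatrix Y - pullbackDeriv (X - Y)‖ ≤ η * ‖X - Y‖ := by
  obtain ⟨s, hs, h⟩ := hasStrictFDerivAt_pullbackMatrix.approximates_deriv_on_nhds
    (c := ⟨η, hη.le⟩) (Or.inr hη)
  obtain ⟨δ, hδ, hδs⟩ := Metric.nhds_basis_closedBall.mem_iff.mp hs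
  exact ⟨δ, hδ, fun X Y hX hY => h X (hδs (by simpa using hX)) Y (hδs (by simpa using hY))⟩

theorem exists_pullbackMatrix_lipschitz : ∃ δ K, 0 < δ ∧ 0 < K ∧ δ ≤ 1 / 2 ∧
    (∀ X Y : E3 →L[ℝ] E3, ‖X‖ ≤ δ → ‖Y‖ ≤ δ →
      ‖pullbackMatrix X - pullbackMatrix Y‖ ≤ K * ‖X - Y‖) ∧
    ∀ X : E3 →L[ℝ] E3, ‖X‖ ≤ δ → ‖pullbackMatrix X - 1‖ ≤ 1 / 2 := by
  obtain ⟨δ, hδ, h⟩ := exists_pullbackMatrix_approx one_pos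
  set K := 1 + ‖pullbackDeriv‖ with hK
  have hK0 : 0 < K := by positivity
  have hl : ∀ X Y : E3 →L[ℝ] E3, ‖X‖ ≤ δ → ‖Y‖ ≤ δ →
      ‖pullbackMatrix X - pullbackMatrix Y‖ ≤ K * ‖X - Y‖ := fun X Y hX hY => by
    have e : pullbackMatrix X - pullbackMatrix Y =
      (pullbackMatrix X - pullbackMatrix Y - pullbackDeriv (X - Y)) + pullbackDeriv (X - Y) := by
      abel
    rw [e]
    refine (norm_add_le _ _).trans ((add_le_add (h X Y hX hY) (pullbackDeriv.le_opNorm _)).trans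
      (le_of_eq ?_))
    rw [hK]; ring
  refine ⟨min δ (min (1 / 2) (1 / (2 * K))), K, by positivity, hK0,
    (min_le_right _ _).trans (min_le_left _ _), fun X Y hX hY =>
      hl X Y (hX.trans (min_le_left _ _)) (hY.trans (min_le_left _ _)), fun X hX => ?_⟩
  have h1 := hl X 0 (hX.trans (min_le_left _ _)) (by simpa using hδ.le)
  rw [pullbackMatrix_zero, sub_zero] at h1
  have h2 : ‖X‖ ≤ 1 / (2 * K) := hX.trans ((min_le_right _ _).trans (min_le_right _ _))
  calc _ ≤ K * ‖X‖ := h1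
    _ ≤ K * (1 / (2 * K)) := by gcongr
    _ = 1 / 2 := by field_simp

theorem continuousAt_pullbackMatrix {X : E3 →L[ℝ] E3} (hX : ‖X‖ ≤ 1 / 2) :
    ContinuousAt pullbackMatrix X := by
  have h1 : ContinuousAt (fun X : E3 →L[ℝ] E3 => Ring.inverse (1 + X)) X := by
    have hu := isUnit_one_add hX
    have := NormedRing.inverse_continuousAt hu.unit
    exact ContinuousAt.comp (f := fun X : E3 →L[ℝ] E3 => 1 + X) (x := X) this (by fun_prop)
  have h2 : ContinuousAt (fun X : E3 →L[ℝ] E3 => adjointL (Ring.inverse (1 + X))) X :=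
    adjointL.continuous.continuousAt.comp h1
  have h3 : ContinuousAt (fun X : E3 →L[ℝ] E3 => |(1 + X).det|) X :=
    ((ContinuousLinearMap.continuous_det.comp (continuous_const.add continuous_id)).abs).continuousAt
  exact h3.smul (h1.clm_comp h2)

/-- The data of a neutral core-shell configuration together with a profile for the displacement of
the outer boundary. -/
structure ShellData where
  /-- conductivity of the core -/
  σc : ℝ
  /-- conductivity of the shell -/
  σs : ℝ
  /-- conductivity of the matrix -/
  σm : ℝ
  /-- inner radius -/
  ri : ℝ
  /-- a radius bounding all perturbed cores -/
  r₀ : ℝ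
  /-- outer radius -/
  re : ℝ
  /-- a radius bounding all displacements -/
  R : ℝ
  /-- radial profile of the displacements -/
  g : ℝ → ℝ
  σc_pos : 0 < σc
  σs_pos : 0 < σs
  σm_pos : 0 < σm
  ri_pos : 0 < ri
  ri_lt : ri < r₀
  r₀_lt : r₀ < re
  re_lt : re < R
  profile : IsProfile r₀ R g
  profile_one : g (re ^ 2) * re ^ 3 = 1
  neutral : (2 * σs + σc) * (σm - σs) + (ri / re) ^ 3 * (σs - σc) * (2 * σs + σm) = 0

namespace ShellData

variable (S : ShellData)

theorem re_pos : 0 < S.re := S.ri_pos.trans (S.ri_lt.trans S.r₀_lt)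

theorem R_pos : 0 < S.R := S.re_pos.trans S.re_lt

/-- Admissible cores. -/
def IsCore (D : Set E3) : Prop := MeasurableSet D ∧ D ⊆ ball 0 S.r₀

theorem isCore_base : S.IsCore (ball 0 S.ri) := ⟨measurableSet_ball, ball_subset_ball S.ri_lt.le⟩

/-- The conductivity with core `D` and unperturbed outer boundary. -/
def cond (D : Set E3) : E3 → ℝ := conductivity D (ball 0 S.re) S.σc S.σs S.σm

/-- An upper bound for the conductivity. -/
def σ₁ : ℝ := S.σc + S.σs + S.σm

/-- A lower bound for the conductivity. -/
def σ₀ : ℝ := min S.σc (min S.σs S.σm)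

theorem σ₀_pos : 0 < S.σ₀ := lt_min S.σc_pos (lt_min S.σs_pos S.σm_pos)

theorem σ₁_pos : 0 < S.σ₁ := add_pos (add_pos S.σc_pos S.σs_pos) S.σm_pos

theorem abs_cond_le (D : Set E3) (x : E3) : |S.cond D x| ≤ S.σ₁ :=
  abs_conductivity_le S.σc_pos S.σs_pos S.σm_pos x

theorem le_cond (D : Set E3) (x : E3) : S.σ₀ ≤ S.cond D x := le_conductivity _ _ _ _ _ x

theorem cond_pos (D : Set E3) (x : E3) : 0 < S.cond D x := S.σ₀_pos.trans_le (S.le_cond D x)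

variable {S} in
theorem IsCore.measurable_cond {D : Set E3} (hD : S.IsCore D) : Measurable (S.cond D) :=
  measurable_conductivity hD.1 measurableSet_ball _ _ _

variable {S} in
theorem IsCore.cond_eq {D D' : Set E3} (hD : S.IsCore D) (hD' : S.IsCore D') {x : E3}
    (hx : x ∉ ball (0 : E3) S.r₀) : S.cond D x = S.cond D' x := by
  have h1 : x ∉ D := fun h => hx (hD.2 h)
  have h2 : x ∉ D' := fun h => hx (hD'.2 h)
  simp only [cond, conductivity, if_neg h1, if_neg h2]

variable {S} in
theorem IsCore.cond_of_notMem {D : Set E3} (hD : S.IsCore D) {x : E3}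
    (hx : x ∉ ball (0 : E3) S.R) : S.cond D x = S.σm := by
  have h1 : x ∉ ball (0 : E3) S.re := fun h => hx (ball_subset_ball S.re_lt.le h)
  have h2 : x ∉ D := fun h => h1 (ball_subset_ball S.r₀_lt.le (hD.2 h))
  simp only [cond, conductivity, if_neg h1, if_neg h2]

/-- The contrast of the medium with core `D`, pulled back by the displacement with profile `Q`. -/
def medium (D : Set E3) (Q : E3 →L[ℝ] E3) (x : E3) : E3 →L[ℝ] E3 :=
  S.cond D x • pullbackMatrix (displacementDeriv S.g Q x) - S.σm • 1

/-- Admissible displacements. -/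
structure IsSmall (Q : E3 →L[ℝ] E3) : Prop where
  norm_le : ∀ x, ‖displacementDeriv S.g Q x‖ ≤ 1 / 2
  near : ∀ x, ‖pullbackMatrix (displacementDeriv S.g Q x) - 1‖ ≤ 1 / 2

theorem displacementDeriv_zero (x : E3) : displacementDeriv S.g 0 x = 0 := by
  ext1 y
  simp [displacementDeriv, quad]

theorem isSmall_zero : S.IsSmall 0 :=
  ⟨fun x => by rw [displacementDeriv_zero, norm_zero]; norm_num, fun x => by
    rw [displacementDeriv_zero, pullbackMatrix_zero, sub_self, norm_zero]; norm_num⟩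

theorem continuous_displacementDeriv (Q : E3 →L[ℝ] E3) : Continuous (displacementDeriv S.g Q) := by
  have : displacementDeriv S.g Q = fderiv ℝ (displacement S.g Q) :=
    funext fun x => (fderiv_displacement S.profile.contDiff Q x).symm
  rw [this]
  exact (contDiff_displacement S.profile.contDiff Q).continuous_fderiv (by simp)

variable {S}

theorem IsSmall.norm_pullbackMatrix_le {Q : E3 →L[ℝ] E3} (hQ : S.IsSmall Q) (x : E3) :
    ‖pullbackMatrix (displacementDeriv S.g Q x)‖ ≤ 3 / 2 := by
  have e : pullbackMatrix (displacementDeriv S.g Q x) =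
    (pullbackMatrix (displacementDeriv S.g Q x) - 1) + 1 := by abel
  rw [e]
  refine (norm_add_le _ _).trans ?_
  rw [norm_one]
  linarith [hQ.near x]

theorem norm_medium_le {D : Set E3} {Q : E3 →L[ℝ] E3} (hQ : S.IsSmall Q) (x : E3) :
    ‖S.medium D Q x‖ ≤ S.σ₁ * (3 / 2) + S.σm := by
  rw [medium]
  refine (norm_sub_le _ _).trans ?_
  rw [norm_smul, norm_smul, norm_one, mul_one, Real.norm_eq_abs, Real.norm_eq_abs,
    abs_of_pos S.σm_pos]
  gcongr
  · exact S.σ₁_pos.le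
  · exact S.abs_cond_le D x
  · exact hQ.norm_pullbackMatrix_le x

theorem IsSmall.continuous_pullbackMatrix {Q : E3 →L[ℝ] E3} (hQ : S.IsSmall Q) :
    Continuous fun x => pullbackMatrix (displacementDeriv S.g Q x) :=
  continuous_iff_continuousAt.mpr fun x =>
    ContinuousAt.comp (f := displacementDeriv S.g Q) (continuousAt_pullbackMatrix (hQ.norm_le x))
      (S.continuous_displacementDeriv Q).continuousAt

theorem memLp_medium {D : Set E3} {Q : E3 →L[ℝ] E3} (hD : S.IsCore D) (hQ : S.IsSmall Q) :
    MemLp (S.medium D Q) ∞ volume :=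
  memLp_top_of_bound ((hD.measurable_cond.aestronglyMeasurable.smul
    hQ.continuous_pullbackMatrix.aestronglyMeasurable).sub aestronglyMeasurable_const) _
    (ae_of_all _ (norm_medium_le hQ))

theorem medium_eq_zero {D : Set E3} (hD : S.IsCore D) (Q : E3 →L[ℝ] E3) :
    ∀ x ∉ ball (0 : E3) S.R, S.medium D Q x = 0 := fun x hx => by
  rw [medium, hD.cond_of_notMem hx, S.profile.displacementDeriv_of_ge S.R_pos.le Q
    (by simpa using hx), pullbackMatrix_zero, sub_self]

variable (S) in
open Classical in
/-- Multiplication by the contrast of a pulled back medium. -/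
def op (D : Set E3) (Q : E3 →L[ℝ] E3) : L2Field →L[ℝ] L2Field :=
  if h : MemLp (S.medium D Q) ∞ volume then mulOp h else 0

theorem op_eq {D : Set E3} {Q : E3 →L[ℝ] E3} (h : MemLp (S.medium D Q) ∞ volume) :
    S.op D Q = mulOp h := dif_pos h

theorem norm_op_le {D : Set E3} {Q : E3 →L[ℝ] E3} (hD : S.IsCore D) (hQ : S.IsSmall Q) :
    ‖S.op D Q‖ ≤ S.σ₁ * (3 / 2) + S.σm := by
  rw [op_eq (memLp_medium hD hQ)]
  exact norm_mulOp_le _ (by have := S.σ₁_pos; have := S.σm_pos; positivity) (norm_medium_le hQ)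

theorem op_symm {D : Set E3} {Q : E3 →L[ℝ] E3} (hD : S.IsCore D) (hQ : S.IsSmall Q)
    (u v : L2Field) : inner ℝ (S.op D Q u) v = inner ℝ u (S.op D Q v) := by
  rw [op_eq (memLp_medium hD hQ)]
  refine mulOp_symm _ (fun x y z => ?_) u v
  simp only [medium, sub_apply, FunLike.coe_smul, Pi.smul_apply, inner_sub_left, inner_sub_right,
    real_inner_smul_left, real_inner_smul_right, pullbackMatrix_symm, one_apply_eq_self]

/-- Half of the coercivity is lost because the pulled back identity matrix is only known to lie
within `1/2` of the identity. -/
theorem isCoerciveOn_op {D : Set E3} {Q : E3 →L[ℝ] E3} (hD : S.IsCore D) (hQ : S.IsSmall Q) :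
    IsCoerciveOn gradSpace S.σm (S.σ₀ / 2) (S.op D Q) := by
  rw [op_eq (memLp_medium hD hQ)]
  refine isCoerciveOn_mulOp _ (fun x y => ?_) _
  set P := pullbackMatrix (displacementDeriv S.g Q x)
  have e : S.σm * ‖y‖ ^ 2 + inner ℝ (S.medium D Q x y) y = S.cond D x * inner ℝ (P y) y := by
    simp only [medium, sub_apply, FunLike.coe_smul, Pi.smul_apply, inner_sub_left,
      real_inner_smul_left, one_apply_eq_self, real_inner_self_eq_norm_sq]
    ring
  have h1 : 1 / 2 * ‖y‖ ^ 2 ≤ inner ℝ (P y) y := by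
    have e2 : inner ℝ (P y) y = ‖y‖ ^ 2 + inner ℝ ((P - 1) y) y := by
      rw [sub_apply, inner_sub_left, one_apply_eq_self, real_inner_self_eq_norm_sq]; ring
    have h3 : |inner ℝ ((P - 1) y) y| ≤ 1 / 2 * ‖y‖ ^ 2 := by
      refine (abs_real_inner_le_norm _ _).trans ?_
      calc _ ≤ (1 / 2 * ‖y‖) * ‖y‖ := by
            gcongr
            exact (le_opNorm _ _).trans (by gcongr; exact hQ.near x)
        _ = _ := by ring
    rw [e2]
    linarith [neg_le_of_abs_le h3]
  rw [e]
  calc S.σ₀ / 2 * ‖y‖ ^ 2 = S.σ₀ * (1 / 2 * ‖y‖ ^ 2) := by ring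
    _ ≤ _ := mul_le_mul (S.le_cond D x) h1 (by positivity) (S.cond_pos D x).le

variable (S) in
open Classical in
/-- The corrector of a pulled back medium. -/
def corr (D : Set E3) (Q : E3 →L[ℝ] E3) (a : E3) : L2Field :=
  if h : ∃ p, IsCorrector gradSpace S.σm (S.op D Q) (ballField S.R a) p then h.choose else 0

theorem isCorrector_corr {D : Set E3} {Q : E3 →L[ℝ] E3} (hD : S.IsCore D) (hQ : S.IsSmall Q)
    (a : E3) : IsCorrector gradSpace S.σm (S.op D Q) (ballField S.R a) (S.corr D Q a) := by
  have h := (isCoerciveOn_op hD hQ).exists_isCorrector isClosed_gradSpace (half_pos S.σ₀_pos)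
    (ballField S.R a)
  rw [corr, dif_pos h]
  exact h.choose_spec

variable (S) in
/-- The polarization form of a pulled back medium. -/
def pol (D : Set E3) (Q : E3 →L[ℝ] E3) (a c : E3) : ℝ :=
  inner ℝ (S.op D Q (ballField S.R a + S.corr D Q a)) (ballField S.R c)

theorem pol_symm {D : Set E3} {Q : E3 →L[ℝ] E3} (hD : S.IsCore D) (hQ : S.IsSmall Q) (a c : E3) :
    S.pol D Q a c = S.pol D Q c a :=
  (isCorrector_corr hD hQ a).polarization_symm (op_symm hD hQ) (isCorrector_corr hD hQ c)

theorem pol_add_right (D : Set E3) (Q : E3 →L[ℝ] E3) (a c d : E3) :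
    S.pol D Q a (c + d) = S.pol D Q a c + S.pol D Q a d := by
  rw [pol, ballField_add, inner_add_right]; rfl

theorem pol_smul_right (D : Set E3) (Q : E3 →L[ℝ] E3) (a : E3) (t : ℝ) (c : E3) :
    S.pol D Q a (t • c) = t * S.pol D Q a c := by
  rw [pol, ballField_smul, real_inner_smul_right]; rfl

theorem pol_eq_zero {D : Set E3} {Q : E3 →L[ℝ] E3} (hD : S.IsCore D) (hQ : S.IsSmall Q)
    (h : ∀ i j : Fin 3, S.pol D Q (EuclideanSpace.single i 1) (EuclideanSpace.single j 1) = 0)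
    (a c : E3) : S.pol D Q a c = 0 := by
  have hb : ∀ y : E3, y = y 0 • EuclideanSpace.single 0 (1 : ℝ) +
      y 1 • EuclideanSpace.single 1 (1 : ℝ) + y 2 • EuclideanSpace.single 2 (1 : ℝ) := fun y => by
    ext j
    fin_cases j <;> simp
  have h1 : ∀ (i : Fin 3) c, S.pol D Q (EuclideanSpace.single i 1) c = 0 := fun i c => by
    rw [hb c]
    simp only [pol_add_right, pol_smul_right, h, mul_zero, add_zero]
  rw [hb a, pol_symm hD hQ]
  simp only [pol_add_right, pol_smul_right]
  rw [pol_symm hD hQ c, pol_symm hD hQ c, pol_symm hD hQ c, h1, h1, h1]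
  simp

end ShellData

end

section


open Filter Topology ContinuousLinearMap

namespace ShellData

variable {S : ShellData}

/-! ### Compensation of core perturbations -/

theorem clm_smul_sub (c : ℝ) (A B : E3 →L[ℝ] E3) : c • A - c • B = c • (A - B) := by
  ext1 y
  simp [smul_sub]

theorem mulOp_eq_of_eq {A B : E3 → E3 →L[ℝ] E3} (hA : MemLp A ∞ volume) (hB : MemLp B ∞ volume)
    (h : ∀ x, A x = B x) : mulOp hA = mulOp hB := by
  obtain rfl : A = B := funext h
  rfl

variable (S) in
/-- The first variation of the medium. -/
def variation (Y : E3 →L[ℝ] E3) (x : E3) : E3 →L[ℝ] E3 :=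
  S.cond (ball 0 S.ri) x • pullbackDeriv (displacementDeriv S.g Y x)

theorem norm_variation_le {C : ℝ} (hC : ∀ Q x, ‖displacementDeriv S.g Q x‖ ≤ C * ‖Q‖)
    (Y : E3 →L[ℝ] E3) (x : E3) : ‖S.variation Y x‖ ≤ S.σ₁ * ‖pullbackDeriv‖ * C * ‖Y‖ := by
  rw [variation, norm_smul, Real.norm_eq_abs, mul_assoc, mul_assoc]
  have h := S.abs_cond_le (ball 0 S.ri) x
  have := S.σ₁_pos
  gcongr
  exact (pullbackDeriv.le_opNorm _).trans (by gcongr; exact hC Y x)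

theorem memLp_variation (Y : E3 →L[ℝ] E3) : MemLp (S.variation Y) ∞ volume := by
  obtain ⟨C, -, hC⟩ := S.profile.exists_norm_displacementDeriv_le S.R_pos.le
  exact memLp_top_of_bound (S.isCore_base.measurable_cond.aestronglyMeasurable.smul
    (pullbackDeriv.continuous.comp (S.continuous_displacementDeriv Y)).aestronglyMeasurable) _
    (ae_of_all _ (norm_variation_le hC Y))

/-- Two cores can differ only in the ball of radius `r₀`, where the displacement vanishes. Hence the
linearization in `Q` is the same operator for every core. -/
theorem variation_eq {D : Set E3} (hD : S.IsCore D) (Y : E3 →L[ℝ] E3) (x : E3) :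
    S.variation Y x = S.cond D x • pullbackDeriv (displacementDeriv S.g Y x) := by
  by_cases hx : x ∈ ball (0 : E3) S.r₀
  · have h0 := S.profile.displacementDeriv_of_le Y (mem_ball_zero_iff.mp hx).le
    rw [variation, h0, map_zero]
    ext y : 1
    simp
  · rw [variation, S.isCore_base.cond_eq hD hx]

/-- For the same reason the effect of exchanging cores does not depend on the displacement, and it
can be measured at `Q = 0`. -/
theorem op_sub_op {D D' : Set E3} {Q Q' : E3 →L[ℝ] E3} (hD : S.IsCore D) (hD' : S.IsCore D')
    (hQ : S.IsSmall Q) (hQ' : S.IsSmall Q') :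
    S.op D Q - S.op D' Q = S.op D Q' - S.op D' Q' := by
  rw [op_eq (memLp_medium hD hQ), op_eq (memLp_medium hD' hQ), op_eq (memLp_medium hD hQ'),
    op_eq (memLp_medium hD' hQ'), mulOp_sub, mulOp_sub]
  refine mulOp_eq_of_eq _ _ fun x => ?_
  simp only [Pi.sub_apply, medium, sub_sub_sub_cancel_right]
  by_cases hx : x ∈ ball (0 : E3) S.r₀
  · have hx' := (mem_ball_zero_iff.mp hx).le
    rw [S.profile.displacementDeriv_of_le Q hx', S.profile.displacementDeriv_of_le Q' hx']
  · rw [hD.cond_eq hD' hx, sub_self, sub_self]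

theorem exists_norm_op_sub_le : ∃ ρ K, 0 < ρ ∧ 0 < K ∧ (∀ Q, ‖Q‖ ≤ ρ → S.IsSmall Q) ∧
    ∀ D Q Q', S.IsCore D → ‖Q‖ ≤ ρ → ‖Q'‖ ≤ ρ → ‖S.op D Q - S.op D Q'‖ ≤ K * ‖Q - Q'‖ := by
  obtain ⟨C, hC0, hC⟩ := S.profile.exists_norm_displacementDeriv_le S.R_pos.le
  obtain ⟨δ, K, hδ, hK, hδ2, hl, hn⟩ := exists_pullbackMatrix_lipschitz
  have hb : ∀ Q, ‖Q‖ ≤ δ / C → ∀ x, ‖displacementDeriv S.g Q x‖ ≤ δ := fun Q hQ x => by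
    rw [le_div_iff₀ hC0] at hQ
    exact (hC Q x).trans (by linarith)
  have hs : ∀ Q, ‖Q‖ ≤ δ / C → S.IsSmall Q := fun Q hQ =>
    ⟨fun x => (hb Q hQ x).trans hδ2, fun x => hn _ (hb Q hQ x)⟩
  have := S.σ₁_pos
  refine ⟨δ / C, S.σ₁ * (K * C), by positivity, by positivity, hs, fun D Q Q' hD hQ hQ' => ?_⟩
  rw [op_eq (memLp_medium hD (hs Q hQ)), op_eq (memLp_medium hD (hs Q' hQ')), mulOp_sub]
  refine norm_mulOp_le _ (by positivity) fun x => ?_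
  rw [Pi.sub_apply, medium, medium, sub_sub_sub_cancel_right, clm_smul_sub, norm_smul,
    Real.norm_eq_abs, mul_assoc]
  gcongr
  · exact S.abs_cond_le D x
  · refine (hl _ _ (hb Q hQ x) (hb Q' hQ' x)).trans ?_
    rw [← displacementDeriv_sub, mul_assoc]
    gcongr
    exact hC _ x

/-- In contrast to the dependence on the core, the dependence on `Q` is strictly differentiable in
operator norm, uniformly in the core. -/
theorem exists_norm_op_sub_variation_le {η : ℝ} (hη : 0 < η) : ∃ ρ, 0 < ρ ∧
    ∀ D Q Q', S.IsCore D → S.IsSmall Q → S.IsSmall Q' → ‖Q‖ ≤ ρ → ‖Q'‖ ≤ ρ →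
      ‖S.op D Q - S.op D Q' - mulOp (S.memLp_variation (Q - Q'))‖ ≤ η * ‖Q - Q'‖ := by
  obtain ⟨C, hC0, hC⟩ := S.profile.exists_norm_displacementDeriv_le S.R_pos.le
  have hσ := S.σ₁_pos
  obtain ⟨δ, hδ, h⟩ := exists_pullbackMatrix_approx (η := η / (S.σ₁ * C)) (by positivity)
  have hb : ∀ Q, ‖Q‖ ≤ δ / C → ∀ x, ‖displacementDeriv S.g Q x‖ ≤ δ := fun Q hQ x => by
    rw [le_div_iff₀ hC0] at hQ
    exact (hC Q x).trans (by linarith)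
  refine ⟨δ / C, by positivity, fun D Q Q' hD hsQ hsQ' hQ hQ' => ?_⟩
  rw [op_eq (memLp_medium hD hsQ), op_eq (memLp_medium hD hsQ'), mulOp_sub, mulOp_sub]
  refine norm_mulOp_le _ (by positivity) fun x => ?_
  rw [Pi.sub_apply, Pi.sub_apply, variation_eq hD, medium, medium, sub_sub_sub_cancel_right,
    clm_smul_sub, clm_smul_sub, norm_smul, Real.norm_eq_abs, displacementDeriv_sub]
  refine (mul_le_mul (S.abs_cond_le D x) (h _ _ (hb Q hQ x) (hb Q' hQ' x)) (norm_nonneg _)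
    hσ.le).trans ?_
  rw [← displacementDeriv_sub]
  calc S.σ₁ * (η / (S.σ₁ * C) * ‖displacementDeriv S.g (Q - Q') x‖)
      ≤ S.σ₁ * (η / (S.σ₁ * C) * (C * ‖Q - Q'‖)) := by gcongr; exact hC _ x
    _ = η * ‖Q - Q'‖ := by field_simp

theorem exists_norm_variation_op_le : ∃ κ, 0 < κ ∧
    ∀ Y, ‖mulOp (S.memLp_variation Y)‖ ≤ κ * ‖Y‖ := by
  obtain ⟨C, hC0, hC⟩ := S.profile.exists_norm_displacementDeriv_le S.R_pos.le
  have hσ := S.σ₁_pos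
  refine ⟨S.σ₁ * ‖pullbackDeriv‖ * C + 1, by positivity, fun Y => ?_⟩
  refine norm_mulOp_le _ (by positivity) fun x => (norm_variation_le hC Y x).trans ?_
  gcongr
  linarith

/-! ### The neutral configuration -/

variable (S) in
/-- The unperturbed total field. -/
def baseField (a : E3) : L2Field := ballField S.R a + S.corr (ball 0 S.ri) 0 a

theorem medium_base (x : E3) : S.medium (ball 0 S.ri) 0 x = contrast (S.cond (ball 0 S.ri)) S.σm x := by
  rw [medium, displacementDeriv_zero, pullbackMatrix_zero, contrast]
  ext1 y
  simp [sub_smul]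

/-- Uniqueness identifies the abstract corrector of the unperturbed medium with the explicit neutral
field. -/
theorem base_spec (a : E3) : S.corr (ball 0 S.ri) 0 a =ᵐ[volume]
    neutralField S.ri S.re (dipoleStrength S.σs S.σm S.re) a ∧
    ∀ c, S.pol (ball 0 S.ri) 0 a c = 0 := by
  have hm := memLp_medium S.isCore_base S.isSmall_zero
  have hN : MemLp (contrast (conductivity (ball 0 S.ri) (ball 0 S.re) S.σc S.σs S.σm) S.σm) ∞
      volume := by
    change MemLp (contrast (S.cond (ball 0 S.ri)) S.σm) ∞ volume
    rwa [← funext medium_base]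
  obtain ⟨p, hp, hc, h0⟩ := neutral_corrector S.σs_pos S.ri_pos (S.ri_lt.trans S.r₀_lt)
    S.re_lt.le S.neutral hN a
  have e : S.op (ball 0 S.ri) 0 = mulOp hN := by
    rw [op_eq hm]
    exact mulOp_eq_of_eq _ _ medium_base
  rw [← e] at hc h0
  have hpc : S.corr (ball 0 S.ri) 0 a = p :=
    (isCorrector_corr S.isCore_base S.isSmall_zero a).unique (half_pos S.σ₀_pos)
      (isCoerciveOn_op S.isCore_base S.isSmall_zero) hc
  refine ⟨by rw [hpc]; exact hp, fun c => ?_⟩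
  rw [pol, hpc]
  exact h0 c

variable (S) in
/-- The contrast of the shell. -/
def ratio : ℝ := S.σm / S.σs

variable (S) in
/-- The trace coefficient of the first variation. -/
def κ₁ : ℝ := 3 * volume.real (ball (0 : E3) 1) * S.re ^ 2 * S.σs / 15 *
  ((1 - S.ratio) * (4 + S.ratio))

variable (S) in
/-- The coefficient of the first variation. -/
def κ₂ : ℝ := 3 * volume.real (ball (0 : E3) 1) * S.re ^ 2 * S.σs / 15 *
  (2 * (1 - S.ratio) ^ 2)

theorem inner_variation {Q : E3 →L[ℝ] E3} (hQ : adjoint Q = Q) (a c : E3) :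
    inner ℝ (mulOp (S.memLp_variation Q) (S.baseField a)) (S.baseField c) =
      inner ℝ (shapeMap S.κ₁ S.κ₂ Q a) c := by
  have h0 : ∀ x ∉ ball (0 : E3) S.R, S.variation Q x = 0 := fun x hx => by
    rw [variation, S.profile.displacementDeriv_of_ge S.R_pos.le Q (by simpa using hx), map_zero]
    ext y : 1
    simp
  rw [baseField, baseField, inner_mulOp_ballField _ h0 a c (base_spec a).1 (base_spec c).1]
  refine (shape_derivative S.σs_pos S.ri_pos S.ri_lt S.r₀_lt S.re_lt S.profile S.profile_one hQ a
    c).trans ?_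
  simp only [shapeMap, sub_apply, FunLike.coe_smul, Pi.smul_apply, one_apply_eq_self,
    inner_sub_left, real_inner_smul_left, κ₁, κ₂, ratio]
  ring

theorem volume_ball_pos : 0 < volume.real (ball (0 : E3) 1) :=
  ENNReal.toReal_pos (measure_ball_pos _ _ one_pos).ne' measure_ball_lt_top.ne

theorem κ₂_ne_zero (h : S.σs ≠ S.σm) : S.κ₂ ≠ 0 := by
  have h1 := volume_ball_pos
  have h2 := S.re_pos
  have h3 := S.σs_pos
  have h4 : 1 - S.ratio ≠ 0 := by
    rw [ratio, sub_ne_zero, ne_comm, Ne, div_eq_one_iff_eq h3.ne']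
    exact h.symm
  rw [κ₂]
  positivity

/-- With `ρ = σm / σs` the factor is `3 (1 - ρ)(4 + ρ) - 2 (1 - ρ)² = (1 - ρ)(10 + 5ρ)`, and `ρ` is
positive. -/
theorem three_κ₁_sub_κ₂_ne_zero (h : S.σs ≠ S.σm) : 3 * S.κ₁ - S.κ₂ ≠ 0 := by
  have h1 := volume_ball_pos
  have h2 := S.re_pos
  have h3 := S.σs_pos
  have h4 : 1 - S.ratio ≠ 0 := by
    rw [ratio, sub_ne_zero, ne_comm, Ne, div_eq_one_iff_eq h3.ne']
    exact h.symm
  have h5 : 0 < S.ratio := div_pos S.σm_pos h3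
  have e : 3 * S.κ₁ - S.κ₂ = 3 * volume.real (ball (0 : E3) 1) * S.re ^ 2 * S.σs / 15 *
      ((1 - S.ratio) * (10 + 5 * S.ratio)) := by
    rw [κ₁, κ₂]; ring
  rw [e]
  positivity

/-! ### The compensating displacement -/

variable (S) in
/-- The polarization tensor of a pulled back medium. -/
def polOp (D : Set E3) (Q : E3 →L[ℝ] E3) : E3 →L[ℝ] E3 :=
  ofEntries fun i j => S.pol D Q (EuclideanSpace.single i 1) (EuclideanSpace.single j 1)

variable (S) in
/-- The deviation of a core from the unperturbed one, as seen by the unperturbed fields. -/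
def IsClose (τ : ℝ) (D : Set E3) : Prop := S.IsCore D ∧ ∀ i : Fin 3,
  ‖(S.op D 0 - S.op (ball 0 S.ri) 0) (S.baseField (EuclideanSpace.single i 1))‖ ≤ τ

/-- The inverse of the derivative at the neutral configuration inverts the polarization map up to a
factor `1/2`, uniformly over all close cores. Two errors of size `1 / (36 Λ)` arise, from the
linearization of the medium and from the change of the fields. The nine matrix entries and the
factor `Λ` turn their sum into `1/2`. -/
theorem exists_newton (h : S.σs ≠ S.σm) : ∃ ρ τ, 0 < ρ ∧ 0 < τ ∧ (∀ Q, ‖Q‖ ≤ ρ → S.IsSmall Q) ∧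
    ∀ D, S.IsClose τ D → ∀ Q Q', adjoint Q = Q → adjoint Q' = Q' → ‖Q‖ ≤ ρ → ‖Q'‖ ≤ ρ →
      ‖Q - Q' - shapeInv S.κ₁ S.κ₂ (S.polOp D Q - S.polOp D Q')‖ ≤ 1 / 2 * ‖Q - Q'‖ := by
  obtain ⟨ρ₁, K, hρ₁, hK, hsmall, hop⟩ := S.exists_norm_op_sub_le
  obtain ⟨κ, hκ, hvar⟩ := S.exists_norm_variation_op_le
  set lam := S.σ₀ / 2
  have hlam : 0 < lam := half_pos S.σ₀_pos
  obtain ⟨B, hB0, hB⟩ : ∃ B, 0 < B ∧ ∀ i : Fin 3,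
      ‖S.baseField (EuclideanSpace.single i 1)‖ ≤ B := by
    refine ⟨∑ i : Fin 3, ‖S.baseField (EuclideanSpace.single i 1)‖ + 1, by positivity,
      fun i => ?_⟩
    have := Finset.single_le_sum (f := fun i : Fin 3 =>
      ‖S.baseField (EuclideanSpace.single i 1)‖) (fun j _ => norm_nonneg _) (Finset.mem_univ i)
    linarith
  set Λ := ‖shapeInv S.κ₁ S.κ₂‖ + 1
  have hΛ : 0 < Λ := by positivity
  -- choose the tolerance on the fields first, then the one on the media
  obtain ⟨t, ht, ht1, htκ⟩ : ∃ t, 0 < t ∧ t ≤ 1 ∧ κ * (t * (2 * B + t)) ≤ 1 / (36 * Λ) := by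
    refine ⟨min 1 (1 / (36 * Λ * κ * (2 * B + 1))), by positivity, min_le_left _ _, ?_⟩
    set t := min 1 (1 / (36 * Λ * κ * (2 * B + 1)))
    have h1 : t ≤ 1 := min_le_left _ _
    have h2 : t ≤ 1 / (36 * Λ * κ * (2 * B + 1)) := min_le_right _ _
    have h0 : 0 < t := by positivity
    calc κ * (t * (2 * B + t)) ≤ κ * (1 / (36 * Λ * κ * (2 * B + 1)) * (2 * B + 1)) := by gcongr
      _ = 1 / (36 * Λ) := by field_simp
  obtain ⟨ρ₂, hρ₂, happ⟩ := S.exists_norm_op_sub_variation_le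
    (η := 1 / (36 * Λ * (B + t) ^ 2)) (by positivity)
  set τ := lam * t / 2
  have hτ : 0 < τ := by positivity
  set ρ := min (min ρ₁ ρ₂) (τ / (K * B))
  have hρle1 : ρ ≤ ρ₁ := (min_le_left _ _).trans (min_le_left _ _)
  have hρle2 : ρ ≤ ρ₂ := (min_le_left _ _).trans (min_le_right _ _)
  have hρle3 : ρ ≤ τ / (K * B) := min_le_right _ _
  refine ⟨ρ, τ, by positivity, hτ, fun Q hQ => hsmall Q (hQ.trans hρle1), ?_⟩
  intro D hD Q Q' hQs hQ's hQ hQ'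
  have hsQ := hsmall Q (hQ.trans hρle1)
  have hsQ' := hsmall Q' (hQ'.trans hρle1)
  -- The distance to the base medium splits into the effect of the displacement, small in operator
  -- norm, and that of the core, small on the base fields by `IsClose`. Each half receives `τ = lam
  -- t / 2`.
  have hθ : ∀ {P : E3 →L[ℝ] E3}, ‖P‖ ≤ ρ → ∀ i : Fin 3,
      ‖(S.op D P - S.op (ball 0 S.ri) 0) (S.baseField (EuclideanSpace.single i 1))‖ ≤ lam * t := by
    intro P hP i
    have e : S.op D P - S.op (ball 0 S.ri) 0 =
      (S.op D P - S.op D 0) + (S.op D 0 - S.op (ball 0 S.ri) 0) := by abel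
    rw [e, add_apply]
    refine (norm_add_le _ _).trans ?_
    have h1 : ‖(S.op D P - S.op D 0) (S.baseField (EuclideanSpace.single i 1))‖ ≤ τ := by
      refine (le_opNorm _ _).trans ?_
      have h2 := hop D P 0 hD.1 (hP.trans hρle1) (by simpa using hρ₁.le)
      rw [sub_zero] at h2
      calc _ ≤ (K * ‖P‖) * B := by gcongr; exact hB i
        _ ≤ (K * (τ / (K * B))) * B := by gcongr; exact hP.trans hρle3
        _ = τ := by field_simp
    have h3 := hD.2 i
    have : τ + τ = lam * t := by ring
    linarith
  have hlt : lam⁻¹ * (lam * t) = t := by field_simp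
  have key : ∀ i j : Fin 3, |S.pol D Q (EuclideanSpace.single i 1) (EuclideanSpace.single j 1) -
      S.pol D Q' (EuclideanSpace.single i 1) (EuclideanSpace.single j 1) -
      inner ℝ (shapeMap S.κ₁ S.κ₂ (Q - Q') (EuclideanSpace.single i 1))
        (EuclideanSpace.single j 1)| ≤ 1 / (18 * Λ) * ‖Q - Q'‖ := by
    intro i j
    rw [← inner_variation (by rw [map_sub, hQs, hQ's])]
    have := IsCorrector.abs_polarization_sub_sub_le hlam (isCoerciveOn_op hD.1 hsQ)
      (isCoerciveOn_op hD.1 hsQ') (op_symm hD.1 hsQ')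
      (isCorrector_corr S.isCore_base S.isSmall_zero (EuclideanSpace.single i 1))
      (isCorrector_corr S.isCore_base S.isSmall_zero (EuclideanSpace.single j 1))
      (isCorrector_corr hD.1 hsQ (EuclideanSpace.single i 1))
      (isCorrector_corr hD.1 hsQ' (EuclideanSpace.single i 1))
      (isCorrector_corr hD.1 hsQ' (EuclideanSpace.single j 1)) (hB i) (hB j) (hθ hQ i) (hθ hQ' j)
      (happ D Q Q' hD.1 hsQ hsQ' (hQ.trans hρle2) (hQ'.trans hρle2)) (hvar (Q - Q'))
    refine this.trans ?_
    rw [hlt]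
    calc 1 / (36 * Λ * (B + t) ^ 2) * ‖Q - Q'‖ * (B + t) ^ 2 +
        κ * ‖Q - Q'‖ * (t * (2 * B + t))
        = (1 / (36 * Λ) + κ * (t * (2 * B + t))) * ‖Q - Q'‖ := by field_simp
      _ ≤ (1 / (36 * Λ) + 1 / (36 * Λ)) * ‖Q - Q'‖ := by gcongr
      _ = 1 / (18 * Λ) * ‖Q - Q'‖ := by field_simp; ring
  have e : Q - Q' - shapeInv S.κ₁ S.κ₂ (S.polOp D Q - S.polOp D Q') =
      -shapeInv S.κ₁ S.κ₂ (ofEntries fun i j =>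
        S.pol D Q (EuclideanSpace.single i 1) (EuclideanSpace.single j 1) -
        S.pol D Q' (EuclideanSpace.single i 1) (EuclideanSpace.single j 1) -
        inner ℝ (shapeMap S.κ₁ S.κ₂ (Q - Q') (EuclideanSpace.single i 1))
          (EuclideanSpace.single j 1)) := by
    rw [ofEntries_sub, ofEntries_sub, ofEntries_inner, map_sub _ _ (shapeMap _ _ _),
      shapeInv_shapeMap (κ₂_ne_zero h) (three_κ₁_sub_κ₂_ne_zero h), neg_sub]
    rfl
  rw [e, norm_neg]
  refine (le_opNorm _ _).trans ?_
  calc _ ≤ Λ * (9 * (1 / (18 * Λ) * ‖Q - Q'‖)) := by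
        gcongr
        · simp [Λ]
        · exact norm_ofEntries_le key
    _ = 1 / 2 * ‖Q - Q'‖ := by field_simp; ring

theorem exists_norm_field_le : ∃ B, 0 < B ∧ ∀ D Q, S.IsCore D → S.IsSmall Q → ∀ i : Fin 3,
    ‖ballField S.R (EuclideanSpace.single i 1) + S.corr D Q (EuclideanSpace.single i 1)‖ ≤ B := by
  set lam := S.σ₀ / 2
  have hlam : 0 < lam := half_pos S.σ₀_pos
  set M := S.σ₁ * (3 / 2) + S.σm
  have hM : 0 < M := by have := S.σ₁_pos; have := S.σm_pos; positivity
  set A := ∑ i : Fin 3, ‖ballField S.R (EuclideanSpace.single i 1)‖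
  have hA : ∀ i : Fin 3, ‖ballField S.R (EuclideanSpace.single i 1)‖ ≤ A := fun i =>
    Finset.single_le_sum (f := fun i : Fin 3 => ‖ballField S.R (EuclideanSpace.single i 1)‖)
      (fun j _ => norm_nonneg _) (Finset.mem_univ i)
  have hA0 : 0 ≤ A := Finset.sum_nonneg fun _ _ => norm_nonneg _
  refine ⟨A + lam⁻¹ * (M * A) + 1, by positivity, fun D Q hD hQ i => ?_⟩
  have h1 := (isCorrector_corr hD hQ (EuclideanSpace.single i 1)).norm_le hlam
    (isCoerciveOn_op hD hQ)
  have h2 : ‖S.op D Q (ballField S.R (EuclideanSpace.single i 1))‖ ≤ M * A :=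
    (le_opNorm _ _).trans (mul_le_mul (norm_op_le hD hQ) (hA i) (norm_nonneg _) hM.le)
  have h3 : lam⁻¹ * ‖S.op D Q (ballField S.R (EuclideanSpace.single i 1))‖ ≤ lam⁻¹ * (M * A) := by
    gcongr
  have := norm_add_le (ballField S.R (EuclideanSpace.single i 1))
    (S.corr D Q (EuclideanSpace.single i 1))
  linarith [hA i]

/-- Small perturbations of the core are compensated by a displacement of the outer boundary that
depends on the core in a Lipschitz way. -/
theorem exists_compensation (h : S.σs ≠ S.σm) : ∃ ρ₁ τ₁ L : ℝ, 0 < ρ₁ ∧ 0 < τ₁ ∧ 0 < L ∧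
    (∀ Q, ‖Q‖ ≤ ρ₁ → S.IsSmall Q) ∧
    (∀ ρ, 0 < ρ → ρ ≤ ρ₁ → ∃ τ, 0 < τ ∧ τ ≤ τ₁ ∧ ∀ D, S.IsClose τ D →
      ∃ Q, adjoint Q = Q ∧ ‖Q‖ ≤ ρ ∧ ∀ a c, S.pol D Q a c = 0) ∧
    ∀ D D' Q Q', S.IsClose τ₁ D → S.IsClose τ₁ D' → adjoint Q = Q → adjoint Q' = Q' →
      ‖Q‖ ≤ ρ₁ → ‖Q'‖ ≤ ρ₁ → (∀ a c, S.pol D Q a c = 0) → (∀ a c, S.pol D' Q' a c = 0) →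
      ∀ θ, (∀ i : Fin 3, ‖(S.op D' 0 - S.op D 0)
        (ballField S.R (EuclideanSpace.single i 1) +
          S.corr D Q (EuclideanSpace.single i 1))‖ ≤ θ) → ‖Q - Q'‖ ≤ L * θ := by
  obtain ⟨ρ₁, τ₁, hρ₁, hτ₁, hsmall, hnewton⟩ := exists_newton h
  obtain ⟨B, hB, hfield⟩ := S.exists_norm_field_le
  set Λ := ‖shapeInv S.κ₁ S.κ₂‖ + 1
  have hΛ : 0 < Λ := by positivity
  have hΛle : ∀ T, ‖shapeInv S.κ₁ S.κ₂ T‖ ≤ Λ * ‖T‖ := fun T =>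
    (le_opNorm _ T).trans (by gcongr; simp [Λ])
  refine ⟨ρ₁, τ₁, 2 * (Λ * (9 * B)), hρ₁, hτ₁, by positivity, hsmall, ?_, ?_⟩
  · intro ρ hρ hρle
    refine ⟨min τ₁ (ρ / (2 * (Λ * (9 * B)))), by positivity, min_le_left _ _, fun D hD => ?_⟩
    have hD₁ : S.IsClose τ₁ D := ⟨hD.1, fun i => (hD.2 i).trans (min_le_left _ _)⟩
    -- Newton's method with the derivative frozen at the neutral configuration. It is run on the
    -- closed set of symmetric matrices, which the iteration preserves because the polarization form
    -- is symmetric.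
    obtain ⟨Q, hQS, hQρ, hQ⟩ := exists_fixedPoint_of_contraction
      (S := {Q : E3 →L[ℝ] E3 | adjoint Q = Q}) (isClosed_eq adjointL.continuous continuous_id)
      (by simp) (F := fun Q => Q - shapeInv S.κ₁ S.κ₂ (S.polOp D Q)) hρ.le
      (fun Q hQ hQρ => by
        have hQs := hsmall Q (hQρ.trans hρle)
        have h1 : adjoint (S.polOp D Q) = S.polOp D Q :=
          adjoint_ofEntries fun i j => pol_symm hD.1 hQs _ _
        simp only [Set.mem_ofPred_eq] at hQ ⊢
        rw [map_sub, hQ, adjoint_shapeInv h1])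
      (fun Q hQ Q' hQ' hQρ hQρ' => by
        refine (le_of_eq ?_).trans (hnewton D hD₁ Q Q' hQ hQ' (hQρ.trans hρle) (hQρ'.trans hρle))
        rw [map_sub]
        congr 1
        abel)
      (by
        -- The first step is small because the base configuration has zero polarization and the core
        -- `D` barely changes the base fields.
        have h1 : ‖S.polOp D 0‖ ≤ 9 * (B * (ρ / (2 * (Λ * (9 * B))))) :=
          norm_ofEntries_le fun i j => by
            have := IsCorrector.abs_polarization_sub_le (op_symm S.isCore_base S.isSmall_zero)
              (op_symm hD.1 S.isSmall_zero)
              (isCorrector_corr S.isCore_base S.isSmall_zero (EuclideanSpace.single i 1))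
              (isCorrector_corr S.isCore_base S.isSmall_zero (EuclideanSpace.single j 1))
              (isCorrector_corr hD.1 S.isSmall_zero (EuclideanSpace.single i 1))
              (hfield D 0 hD.1 S.isSmall_zero i) ((hD.2 j).trans (min_le_right _ _))
            have h0 := (S.base_spec (EuclideanSpace.single i 1)).2 (EuclideanSpace.single j 1)
            rw [pol] at h0
            rwa [h0, sub_zero] at this
        simp only [zero_sub, norm_neg]
        calc _ ≤ Λ * ‖S.polOp D 0‖ := hΛle _
          _ ≤ Λ * (9 * (B * (ρ / (2 * (Λ * (9 * B)))))) := by gcongr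
          _ = ρ / 2 := by field_simp)
    refine ⟨Q, hQS, hQρ, ?_⟩
    have h0 : S.polOp D Q = 0 :=
      shapeInv_injective (κ₂_ne_zero h) (three_κ₁_sub_κ₂_ne_zero h) (by simpa using hQ)
    refine pol_eq_zero hD.1 (hsmall Q (hQρ.trans hρle)) fun i j => ?_
    have := inner_ofEntries (fun i j =>
      S.pol D Q (EuclideanSpace.single i 1) (EuclideanSpace.single j 1)) i j
    rw [← this]
    change inner ℝ (S.polOp D Q (EuclideanSpace.single i 1)) (EuclideanSpace.single j 1) = 0
    rw [h0, zero_apply, inner_zero_left]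
  · intro D D' Q Q' hD hD' hQ hQ' hQρ hQρ' hpol hpol' θ hθ
    have hQs := hsmall Q hQρ
    have h1 := hnewton D' hD' Q Q' hQ hQ' hQρ hQρ'
    have h2 : ‖S.polOp D' Q - S.polOp D' Q'‖ ≤ 9 * (B * θ) := by
      rw [polOp, polOp, ← ofEntries_sub]
      refine norm_ofEntries_le fun i j => ?_
      have := IsCorrector.abs_polarization_sub_le (op_symm hD.1 hQs) (op_symm hD'.1 hQs)
        (isCorrector_corr hD.1 hQs (EuclideanSpace.single i 1))
        (isCorrector_corr hD.1 hQs (EuclideanSpace.single j 1))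
        (isCorrector_corr hD'.1 hQs (EuclideanSpace.single i 1))
        (hfield D' Q hD'.1 hQs i) (θ := θ)
        (by rw [op_sub_op hD'.1 hD.1 hQs S.isSmall_zero]; exact hθ j)
      have h0 := hpol (EuclideanSpace.single i 1) (EuclideanSpace.single j 1)
      rw [pol] at h0
      rw [h0, sub_zero] at this
      rw [hpol', sub_zero]
      exact this
    -- Since the polarization of `(D', Q')` vanishes, the second summand only involves the
    -- polarization of `(D', Q)`. This is compared with the vanishing one of `(D, Q)`, and the first
    -- summand is absorbed on the left.
    have h3 : ‖Q - Q'‖ ≤ ‖Q - Q' - shapeInv S.κ₁ S.κ₂ (S.polOp D' Q - S.polOp D' Q')‖ +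
        ‖shapeInv S.κ₁ S.κ₂ (S.polOp D' Q - S.polOp D' Q')‖ := by
      have := norm_add_le (Q - Q' - shapeInv S.κ₁ S.κ₂ (S.polOp D' Q - S.polOp D' Q'))
        (shapeInv S.κ₁ S.κ₂ (S.polOp D' Q - S.polOp D' Q'))
      rwa [sub_add_cancel] at this
    have h4 : ‖shapeInv S.κ₁ S.κ₂ (S.polOp D' Q - S.polOp D' Q')‖ ≤ Λ * (9 * (B * θ)) :=
      (hΛle _).trans (by gcongr)
    linarith

theorem IsSmall.isDisplacement {Q : E3 →L[ℝ] E3} (hQ : S.IsSmall Q) :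
    IsDisplacement S.R (displacement S.g Q) where
  contDiff := contDiff_displacement S.profile.contDiff Q
  eq_zero x hx := by
    have hx' : S.R ≤ ‖x‖ := by simpa using hx
    have hR := S.R_pos
    have : S.R ^ 2 ≤ ‖x‖ ^ 2 := by gcongr
    simp [displacement, S.profile.eq_zero_of_ge _ this]
  norm_fderiv_le x := by
    rw [fderiv_displacement S.profile.contDiff]
    exact hQ.norm_le x

/-- If the pulled back medium has vanishing polarization tensor, so has the displaced medium. -/
theorem conductivity_solution_of_pol_eq_zero {D : Set E3} {Q : E3 →L[ℝ] E3} (hD : S.IsCore D)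
    (hQ : S.IsSmall Q) (hpol : ∀ a c, S.pol D Q a c = 0) {σ : E3 → ℝ} (hσ : Measurable σ)
    (hσ0 : ∀ x, S.σ₀ ≤ σ x) (hσ1 : ∀ x, |σ x| ≤ S.σ₁)
    (hσR : ∀ x ∉ ball (0 : E3) S.R, σ x = S.σm)
    (hσD : ∀ x, σ (x + displacement S.g Q x) = S.cond D x) (a : E3) :
    (∃ u, IsConductivitySolution σ a u) ∧ ∀ u, IsConductivitySolution σ a u →
      (fun x => u x - inner ℝ a x) =O[aeInfinity] fun x => (‖x‖ ^ 3)⁻¹ := by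
  have hV := hQ.isDisplacement
  have hm : hV.pullbackContrast (S.cond D) S.σm = S.medium D Q := by
    ext1 x
    rw [IsDisplacement.pullbackContrast, fderiv_displacement S.profile.contDiff, medium]
  have hB' : MemLp (hV.pullbackContrast (S.cond D) S.σm) ∞ volume := hm ▸ memLp_medium hD hQ
  have hop : S.op D Q = mulOp hB' := by
    rw [op_eq (memLp_medium hD hQ)]
    exact mulOp_eq_of_eq _ _ fun x => by rw [hm]
  have hB := memLp_contrast (s := S.σm) hσ hσ1
  have hc : IsCoerciveOn gradSpace S.σm S.σ₀ (mulOp hB) :=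
    isCoerciveOn_mulOp hB (fun x y => by
      have e : S.σm * ‖y‖ ^ 2 + inner ℝ (contrast σ S.σm x y) y = σ x * ‖y‖ ^ 2 := by
        simp only [contrast, FunLike.coe_smul, Pi.smul_apply, coe_id', id_eq,
          real_inner_smul_left, real_inner_self_eq_norm_sq]
        ring
      rw [e]
      gcongr
      exact hσ0 x) _
  have hex := fun a => hc.exists_isCorrector isClosed_gradSpace S.σ₀_pos (ballField S.R a)
  choose p hp using hex
  refine conductivity_solution_of_corrector hσ S.σ₀_pos hσ0 hσ1 S.σm_pos S.R_pos hσR (hp a)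
    fun c => ?_
  have hc' := isCoerciveOn_op hD hQ
  have hp' := isCorrector_corr hD hQ
  rw [hop] at hc' hp'
  rw [hV.polarization_pullback hσD S.σ₀_pos (half_pos S.σ₀_pos) hB hB'
    (fun x hx => by rw [contrast, hσR x hx, sub_self]; ext1 y; simp)
    (fun x hx => by rw [hm]; exact medium_eq_zero hD Q x hx) hc hc' hp hp', ← hop]
  exact hpol a c

end ShellData

end

section


open Filter Topology ContinuousLinearMap
open scoped Pointwise

/-! ### Star-shaped domains -/

theorem radialExt_smul_sphere (f : S2 → ℝ) (ω : S2) {t : ℝ} (ht : 0 < t) :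
    radialExt f (t • (ω : E3)) = f ω := by
  have hω : ‖(ω : E3)‖ = 1 := norm_eq_of_mem_sphere ω
  have h0 : (ω : E3) ≠ 0 := norm_ne_zero_iff.mp (by rw [hω]; exact one_ne_zero)
  rw [radialExt, dif_neg (smul_ne_zero ht.ne' h0)]
  congr 1
  ext1
  simp only [norm_smul, hω, mul_one, Real.norm_eq_abs, abs_of_pos ht]
  rw [inv_smul_smul₀ ht.ne']

theorem exists_polar {x : E3} (hx : x ≠ 0) : ∃ (ω : S2) (t : ℝ), 0 < t ∧ x = t • (ω : E3) := by
  have h := norm_ne_zero_iff.mpr hx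
  refine ⟨⟨‖x‖⁻¹ • x, ?_⟩, ‖x‖, norm_pos_iff.mpr hx, (smul_inv_smul₀ h x).symm⟩
  rw [mem_sphere_zero_iff_norm, norm_smul, norm_inv, norm_norm, inv_mul_cancel₀ h]

theorem norm_smul_sphere (ω : S2) {t : ℝ} (ht : 0 ≤ t) : ‖t • (ω : E3)‖ = t := by
  rw [norm_smul, norm_eq_of_mem_sphere ω, mul_one, Real.norm_eq_abs, abs_of_nonneg ht]

theorem smul_mem_perturbedBall {r : ℝ} {f : S2 → ℝ} {ω : S2} {t : ℝ} (ht : 0 < t) :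
    t • (ω : E3) ∈ perturbedBall r f ↔ t < r + f ω := by
  refine ⟨?_, fun h => ⟨ω, t, ht.le, h, rfl⟩⟩
  rintro ⟨ω', t', ht', h, e⟩
  have h1 := congrArg norm e
  rw [norm_smul_sphere ω ht.le, norm_smul_sphere ω' ht'] at h1
  obtain rfl : t = t' := h1
  obtain rfl : ω = ω' := Subtype.ext (smul_right_injective E3 ht.ne' e)
  exact h

theorem zero_mem_perturbedBall {r : ℝ} {f : S2 → ℝ} (hf : ∀ ω, 0 < r + f ω) :
    (0 : E3) ∈ perturbedBall r f :=
  ⟨⟨EuclideanSpace.single 0 1, by simp [PiLp.norm_single]⟩, 0, le_rfl, hf _, by simp⟩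

theorem mem_perturbedBall_iff {r : ℝ} (hr : 0 < r) {f : S2 → ℝ} (hf : ∀ ω, 0 < r + f ω) {x : E3} :
    x ∈ perturbedBall r f ↔ ‖x‖ < r + radialExt f x := by
  rcases eq_or_ne x 0 with rfl | hx
  · simp [radialExt, hr, zero_mem_perturbedBall hf]
  · obtain ⟨ω, t, ht, rfl⟩ := exists_polar hx
    rw [smul_mem_perturbedBall ht, radialExt_smul_sphere f ω ht, norm_smul_sphere ω ht.le]

theorem perturbedBall_zero {r : ℝ} (hr : 0 < r) : perturbedBall r 0 = ball (0 : E3) r := by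
  ext x
  rw [mem_perturbedBall_iff hr (fun _ => by rwa [Pi.zero_apply, add_zero]), mem_ball_zero_iff, radialExt]
  split_ifs <;> simp

theorem measurable_radialExt {f : S2 → ℝ} (hf : Continuous f) : Measurable (radialExt f) := by
  refine measurable_of_continuousOn_compl_singleton 0 ?_
  have hne : ∀ x : ({0}ᶜ : Set E3), (x : E3) ≠ 0 := fun x => x.2
  rw [continuousOn_iff_continuous_domRestrict]
  have e : ({0}ᶜ : Set E3).domRestrict (radialExt f) = fun x : ({0}ᶜ : Set E3) => f ⟨‖(x : E3)‖⁻¹ • (x : E3), by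
      rw [mem_sphere_zero_iff_norm, norm_smul, norm_inv, norm_norm,
        inv_mul_cancel₀ (norm_ne_zero_iff.mpr (hne x))]⟩ := by
    ext x
    rw [Set.domRestrict_apply, radialExt, dif_neg (hne x)]
  rw [e]
  refine hf.comp (Continuous.subtype_mk ?_ _)
  exact (continuous_subtype_val.norm.inv₀ fun x => norm_ne_zero_iff.mpr (hne x)).smul
    continuous_subtype_val

theorem measurableSet_perturbedBall {r : ℝ} (hr : 0 < r) {f : S2 → ℝ} (hf : ∀ ω, 0 < r + f ω)
    (hc : Continuous f) : MeasurableSet (perturbedBall r f) := by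
  have e : perturbedBall r f = {x | ‖x‖ < r + radialExt f x} :=
    Set.ext fun x => mem_perturbedBall_iff hr hf
  rw [e]
  exact measurableSet_lt measurable_norm ((measurable_radialExt hc).const_add r)

theorem perturbedBall_subset_ball {r R : ℝ} {f : S2 → ℝ} (hf : ∀ ω, r + f ω ≤ R) :
    perturbedBall r f ⊆ ball 0 R := by
  rintro _ ⟨ω, t, ht, h, rfl⟩
  rw [mem_ball_zero_iff, norm_smul_sphere ω ht]
  exact h.trans_le (hf ω)

theorem closedBall_subset_perturbedBall {r R : ℝ} (hR : 0 ≤ R) {f : S2 → ℝ}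
    (hf : ∀ ω, R < r + f ω) : closedBall 0 R ⊆ perturbedBall r f := by
  intro x hx
  rcases eq_or_ne x 0 with rfl | hx0
  · exact zero_mem_perturbedBall fun ω => hR.trans_lt (hf ω)
  · obtain ⟨ω, t, ht, rfl⟩ := exists_polar hx0
    rw [mem_closedBall_zero_iff, norm_smul_sphere ω ht.le] at hx
    exact (smul_mem_perturbedBall ht).mpr (hx.trans_lt (hf ω))

theorem closure_perturbedBall_subset {r r' R : ℝ} (hR : 0 ≤ R) {f b : S2 → ℝ}
    (hf : ∀ ω, r + f ω ≤ R) (hb : ∀ ω, R < r' + b ω) :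
    closure (perturbedBall r f) ⊆ perturbedBall r' b :=
  (closure_minimal ((perturbedBall_subset_ball hf).trans ball_subset_closedBall)
    isClosed_closedBall).trans (closedBall_subset_perturbedBall hR hb)

/-- Membership in one of two nearby star-shaped domains but not in the other confines a point to a
thin shell. -/
theorem mem_shell_of_mem_iff_ne {r c u : ℝ} {h k : S2 → ℝ} (hc : 0 < c) (hh : ∀ ω, c ≤ r + h ω)
    (hu : 0 < u) (hu1 : u < 1) (hk : ∀ ω, |k ω - h ω| ≤ c * u) {x : E3}
    (hx : ¬(x ∈ perturbedBall r k ↔ x ∈ perturbedBall r h)) :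
    x ∈ ((1 + u) • perturbedBall r h) \ ((1 - u) • perturbedBall r h) := by
  have hp : ∀ ω, 0 < r + h ω := fun ω => hc.trans_le (hh ω)
  have hp' : ∀ ω, 0 < r + k ω := fun ω => by
    have := (abs_le.mp (hk ω)).1
    have := mul_lt_of_lt_one_right hc hu1
    linarith [hh ω]
  rcases eq_or_ne x 0 with rfl | hx0
  · exact absurd (iff_of_true (zero_mem_perturbedBall hp') (zero_mem_perturbedBall hp)) hx
  obtain ⟨ω, t, ht, rfl⟩ := exists_polar hx0
  have h1 : 0 < 1 + u := by linarith
  have h2 : 0 < 1 - u := by linarith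
  rw [smul_mem_perturbedBall ht, smul_mem_perturbedBall ht] at hx
  rw [Set.mem_sdiff, Set.mem_smul_set_iff_inv_smul_mem₀ h1.ne',
    Set.mem_smul_set_iff_inv_smul_mem₀ h2.ne', smul_smul, smul_smul,
    smul_mem_perturbedBall (by positivity), smul_mem_perturbedBall (by positivity),
    inv_mul_lt_iff₀ h1, inv_mul_lt_iff₀ h2]
  have h3 := abs_le.mp (hk ω)
  have h4 : c * u ≤ (r + h ω) * u := by gcongr; exact hh ω
  constructor
  · by_contra hn
    refine hx (iff_of_false (fun h => ?_) fun h => ?_) <;> nlinarith [hp ω]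
  · intro hn
    refine hx (iff_of_true ?_ ?_) <;> nlinarith [hp ω]

/-- By scaling, the volume is `(1 + u)³ - (1 - u)³ = 6u + 2u³` times that of `D`. -/
theorem volume_real_shell_le {D : Set E3} (hD : MeasurableSet D) (hD' : volume D ≠ ∞) {u : ℝ}
    (hu : 0 < u) (hu1 : u < 1) (hsub : (1 - u) • D ⊆ (1 + u) • D) :
    volume.real (((1 + u) • D) \ ((1 - u) • D)) ≤ 8 * u * volume.real D := by
  have h1 : 0 < 1 + u := by linarith
  have h2 : 0 < 1 - u := by linarith
  have e : ∀ t : ℝ, 0 < t → volume.real (t • D) = t ^ 3 * volume.real D := fun t ht => by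
    rw [measureReal_def, Measure.addHaar_smul, ENNReal.toReal_mul, ENNReal.toReal_ofReal
      (abs_nonneg _), finrank_euclideanSpace_fin, abs_of_pos (by positivity), measureReal_def]
  have hfin : ∀ t : ℝ, volume (t • D) ≠ ∞ := fun t => by
    rw [Measure.addHaar_smul]
    exact ENNReal.mul_ne_top ENNReal.ofReal_ne_top hD'
  rw [measureReal_sdiff hsub (hD.const_smul_of_ne_zero h2.ne') (hfin _), e _ h1, e _ h2, ← sub_mul]
  gcongr
  nlinarith [pow_pos hu 2]

/-! ### The displaced outer boundary -/

theorem quad_smul (Q : E3 →L[ℝ] E3) (t : ℝ) (x : E3) : quad Q (t • x) = t ^ 2 * quad Q x := by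
  simp only [quad, map_smul, real_inner_smul_left, real_inner_smul_right]
  ring

theorem displacement_smul_sphere (g : ℝ → ℝ) (Q : E3 →L[ℝ] E3) (ω : S2) (t : ℝ) :
    t • (ω : E3) + displacement g Q (t • (ω : E3)) =
      (t + g (t ^ 2) * t ^ 3 * quad Q ω) • (ω : E3) := by
  rw [displacement, norm_smul, norm_eq_of_mem_sphere ω, mul_one, Real.norm_eq_abs, sq_abs,
    quad_smul, smul_smul, ← add_smul]
  congr 1
  ring

theorem abs_quad_sphere_le (Q : E3 →L[ℝ] E3) (ω : S2) : |quad Q ω| ≤ ‖Q‖ := by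
  have := abs_quad_le Q (ω : E3)
  rwa [norm_eq_of_mem_sphere ω, one_pow, mul_one] at this

/-- The displacement is Lipschitz with constant `1/2`, so along a ray the image moves outwards at no
less than half speed. Inside and outside can therefore be compared ray by ray. -/
theorem IsDisplacement.strictMono_radial {R : ℝ} {g : ℝ → ℝ} {Q : E3 →L[ℝ] E3}
    (h : IsDisplacement R (displacement g Q)) (ω : S2) :
    StrictMono fun t : ℝ => t + g (t ^ 2) * t ^ 3 * quad Q ω := by
  intro s t hst
  have h1 := h.lipschitz.dist_le_mul (t • (ω : E3)) (s • (ω : E3))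
  have h2 := displacement_smul_sphere g Q ω t
  have h3 := displacement_smul_sphere g Q ω s
  have e : displacement g Q (t • (ω : E3)) - displacement g Q (s • (ω : E3)) =
      (g (t ^ 2) * t ^ 3 * quad Q ω - g (s ^ 2) * s ^ 3 * quad Q ω) • (ω : E3) := by
    rw [← eq_sub_iff_add_eq'] at h2 h3
    rw [h2, h3]
    module
  rw [dist_eq_norm, dist_eq_norm, e, ← sub_smul, norm_smul, norm_smul, norm_eq_of_mem_sphere ω,
    mul_one, mul_one, Real.norm_eq_abs, Real.norm_eq_abs, abs_of_pos (sub_pos.mpr hst)] at h1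
  have h4 := (abs_le.mp h1).1
  norm_num at h4
  change s + g (s ^ 2) * s ^ 3 * quad Q ω < t + g (t ^ 2) * t ^ 3 * quad Q ω
  linarith

/-- On the unit sphere the trace part of `Q` is constant, by `|ω| = 1`, and the remainder is a
harmonic of degree two. The roots undo the normalization of the basis. -/
theorem quad_mem_W6 {Q : E3 →L[ℝ] E3} (hQ : adjoint Q = Q) : (fun ω : S2 => quad Q ω) ∈ W6 := by
  set m : Fin 3 → Fin 3 → ℝ := fun i j => Q (EuclideanSpace.single i 1) j with hm
  have hsymm : ∀ i j, m i j = m j i := fun i j => by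
    have h := adjoint_inner_left Q (EuclideanSpace.single j (1 : ℝ)) (EuclideanSpace.single i 1)
    rw [hQ] at h
    simpa [hm, EuclideanSpace.inner_single_left, EuclideanSpace.inner_single_right] using h
  have key : (fun ω : S2 => quad Q ω) = ((m 0 0 + m 1 1 + m 2 2) / 3 * √15) • Y 0 +
      (2 * m 0 1) • Y 1 + (2 * m 1 2) • Y 2 +
      ((m 2 2 - (m 0 0 + m 1 1 + m 2 2) / 3) * √3) • Y 3 + (2 * m 0 2) • Y 4 +
      (m 0 0 - m 1 1) • Y 5 := by
    ext ω
    have hω : (ω : E3) 0 ^ 2 + (ω : E3) 1 ^ 2 + (ω : E3) 2 ^ 2 = 1 := by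
      have := EuclideanSpace.norm_sq_eq (ω : E3)
      rw [norm_eq_of_mem_sphere ω] at this
      simpa [Fin.sum_univ_three] using this.symm
    have hb : (ω : E3) = (ω : E3) 0 • EuclideanSpace.single 0 (1 : ℝ) +
        (ω : E3) 1 • EuclideanSpace.single 1 (1 : ℝ) +
        (ω : E3) 2 • EuclideanSpace.single 2 (1 : ℝ) := by
      ext j
      fin_cases j <;> simp
    have hq : ∀ j, Q (ω : E3) j = (ω : E3) 0 * m 0 j + (ω : E3) 1 * m 1 j +
        (ω : E3) 2 * m 2 j := fun j => by
      conv_lhs => rw [hb]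
      simp [hm]
    have h15 : √15 * (√15)⁻¹ = 1 := mul_inv_cancel₀ (by positivity)
    have h3 : √3 * (√3)⁻¹ = 1 := mul_inv_cancel₀ (by positivity)
    simp only [quad, PiLp.inner_apply, Fin.sum_univ_three, hq, RCLike.inner_apply, conj_trivial,
      Y, Pi.add_apply, Pi.smul_apply, smul_eq_mul, Matrix.cons_val, one_div, mul_inv]
    rw [hsymm 1 0, hsymm 2 0, hsymm 2 1]
    linear_combination (-(m 0 0 + m 1 1 + m 2 2) / 3) * h15 - (m 2 2 - (m 0 0 + m 1 1 + m 2 2) / 3) * 2⁻¹ * (-(ω : E3) 0 ^ 2 - (ω : E3) 1 ^ 2 + 2 * (ω : E3) 2 ^ 2) * h3 + ((m 0 0 + m 1 1 + m 2 2) / 3) * hω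
  rw [key]
  have hY : ∀ i, Y i ∈ W6 := fun i => Submodule.subset_span ⟨i, rfl⟩
  exact W6.add_mem (W6.add_mem (W6.add_mem (W6.add_mem (W6.add_mem (W6.smul_mem _ (hY 0))
    (W6.smul_mem _ (hY 1))) (W6.smul_mem _ (hY 2))) (W6.smul_mem _ (hY 3)))
    (W6.smul_mem _ (hY 4))) (W6.smul_mem _ (hY 5))

/-! ### Functions of small norm -/

/-- The bound holds almost everywhere, hence on a dense set, because the surface measure charges
every open set; continuity extends it to all points. No other property of `normW2` enters the
theorem. -/
theorem abs_le_of_normW2_lt {f : S2 → ℝ} (hf : Continuous f) {ε : ℝ}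
    (h : normW2 f < ENNReal.ofReal ε) (ω : S2) : |f ω| ≤ ε := by
  have h1 : eLpNorm f ∞ surfaceMeasure ≤ normW2 f := by
    refine le_iInf fun g => le_iInf fun k => le_iInf fun _ => ?_
    rw [add_assoc]
    exact le_self_add
  have h2 : ∀ᵐ ω ∂surfaceMeasure, |f ω| ≤ ε := by
    have h3 := h1.trans_lt h
    rw [eLpNorm_exponent_top, eLpNormEssSup] at h3
    filter_upwards [ae_lt_of_essSup_lt h3] with ω hω
    rw [← ofReal_norm, ENNReal.ofReal_lt_ofReal_iff'] at hω
    exact hω.1.le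
  have h4 : (surfaceMeasure : Measure S2).IsOpenPosMeasure := by
    rw [surfaceMeasure]
    infer_instance
  have h5 := (Measure.dense_of_ae h2).closure_eq
  have h6 : IsClosed {ω : S2 | |f ω| ≤ ε} := isClosed_le hf.abs continuous_const
  rw [h6.closure_eq] at h5
  have h7 : ω ∈ {ω : S2 | |f ω| ≤ ε} := h5.symm ▸ Set.mem_univ ω
  exact h7

end

section


open Filter Topology ContinuousLinearMap
open scoped Pointwise

theorem conductivity_congr {D Ω D' Ω' : Set E3} {x y : E3} (h₁ : x ∈ D ↔ y ∈ D')
    (h₂ : x ∈ Ω ↔ y ∈ Ω') (σc σs σm : ℝ) :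
    conductivity D Ω σc σs σm x = conductivity D' Ω' σc σs σm y := by
  by_cases h : y ∈ D' <;> by_cases h' : y ∈ Ω' <;> simp [conductivity, h₁, h₂, h, h']

namespace ShellData

variable {S : ShellData}

/-! ### Dependence on the core -/

/-- Off `A` the two conductivities coincide, and on `A` they differ by at most `2 S.σ₁`. So only the
L² mass of the field on `A` matters. -/
theorem norm_op_sub_apply_le {D D' A : Set E3} (hD : S.IsCore D) (hD' : S.IsCore D')
    (hA : MeasurableSet A) (hDA : ∀ x, ¬(x ∈ D ↔ x ∈ D') → x ∈ A) (w : L2Field) {ε : ℝ}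
    (hε : 0 ≤ ε) (hw : eLpNorm (A.indicator w) 2 volume ≤ ENNReal.ofReal ε) :
    ‖(S.op D 0 - S.op D' 0) w‖ ≤ 2 * S.σ₁ * ε := by
  have hσ := S.σ₁_pos
  have hwA : MemLp (A.indicator w) 2 volume := (Lp.memLp w).indicator hA
  have h1 : ‖hwA.toLp _‖ ≤ ε := by
    rw [Lp.norm_toLp]
    exact ENNReal.toReal_le_of_le_ofReal hε hw
  have h2 : ‖(S.op D 0 - S.op D' 0) w‖ ≤ 2 * S.σ₁ * ‖hwA.toLp _‖ := by
    refine Lp.norm_le_mul_norm_of_ae_le_mul ?_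
    rw [op_eq (memLp_medium hD S.isSmall_zero), op_eq (memLp_medium hD' S.isSmall_zero), mulOp_sub]
    filter_upwards [coeFn_mulOp ((memLp_medium hD S.isSmall_zero).sub
      (memLp_medium hD' S.isSmall_zero)) w, hwA.coeFn_toLp] with x hx hx'
    rw [hx, hx', Pi.sub_apply, medium, medium, displacementDeriv_zero, pullbackMatrix_zero,
      sub_sub_sub_cancel_right, sub_apply, FunLike.coe_smul, FunLike.coe_smul, Pi.smul_apply,
      Pi.smul_apply, one_apply_eq_self, ← sub_smul, norm_smul, Real.norm_eq_abs]
    by_cases hxA : x ∈ A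
    · rw [Set.indicator_of_mem hxA]
      gcongr
      exact (abs_sub _ _).trans (by linarith [S.abs_cond_le D x, S.abs_cond_le D' x])
    · have h3 : x ∈ D ↔ x ∈ D' := not_not.mp fun h => hxA (hDA x h)
      have h4 : S.cond D x = S.cond D' x := conductivity_congr h3 Iff.rfl _ _ _
      rw [h4, sub_self, abs_zero, zero_mul]
      positivity
  exact h2.trans (by gcongr)

theorem isCore_perturbedBall {k : S2 → ℝ} (hk : Continuous k) (h0 : ∀ ω, 0 < S.ri + k ω)
    (h1 : ∀ ω, S.ri + k ω ≤ S.r₀) : S.IsCore (perturbedBall S.ri k) :=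
  ⟨measurableSet_perturbedBall S.ri_pos h0 hk, perturbedBall_subset_ball h1⟩

/-- The medium depends strongly continuously on the core. -/
theorem eventually_norm_op_sub_apply_le {c : ℝ} (hc : 0 < c) {h : S2 → ℝ} (hcont : Continuous h)
    (hch : ∀ ω, c ≤ S.ri + h ω) (hhr : ∀ ω, S.ri + h ω ≤ S.r₀) (w : L2Field) {τ : ℝ}
    (hτ : 0 < τ) : ∀ᶠ δ in 𝓝[>] (0 : ℝ), ∀ k : S2 → ℝ, (∀ ω, |k ω - h ω| ≤ δ) →
      S.IsCore (perturbedBall S.ri k) →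
      ‖(S.op (perturbedBall S.ri k) 0 - S.op (perturbedBall S.ri h) 0) w‖ ≤ τ := by
  have hσ := S.σ₁_pos
  set D := perturbedBall S.ri h
  have hp : ∀ ω, 0 < S.ri + h ω := fun ω => hc.trans_le (hch ω)
  have hD : S.IsCore D := isCore_perturbedBall hcont hp hhr
  have hDfin : volume D ≠ ∞ := (measure_mono hD.2).trans_lt measure_ball_lt_top |>.ne
  -- Absolute continuity of the integral of `|w|²`: a set of measure at most `m` carries little of
  -- it. The threshold depends on the field `w`, which is why the continuity in the core is only
  -- strong.
  obtain ⟨m, hm, hmw⟩ := MemLp.eLpNorm_indicator_le (p := 2) (by norm_num) (by norm_num)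
    (Lp.memLp w) (ε := τ / (2 * S.σ₁)) (by positivity)
  have hlim : ∀ᶠ δ in 𝓝[>] (0 : ℝ), δ / c < 1 ∧ 8 * (δ / c) * volume.real D ≤ m := by
    have h1 : Tendsto (fun δ : ℝ => δ / c) (𝓝[>] 0) (𝓝 0) := by
      have : ContinuousAt (fun δ : ℝ => δ / c) 0 := by fun_prop
      simpa [ContinuousAt] using this.tendsto.mono_left nhdsWithin_le_nhds
    have h2 : Tendsto (fun δ : ℝ => 8 * (δ / c) * volume.real D) (𝓝[>] 0) (𝓝 0) := by
      simpa using (h1.const_mul 8).mul_const (volume.real D)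
    exact (h1.eventually (gt_mem_nhds one_pos)).and
      ((h2.eventually (gt_mem_nhds hm)).mono fun _ h => h.le)
  filter_upwards [hlim, self_mem_nhdsWithin] with δ hδ hδ0 k hk hkD
  have hδ0 : 0 < δ := hδ0
  set u := δ / c
  have hu : 0 < u := by positivity
  have hcu : c * u = δ := mul_div_cancel₀ δ hc.ne'
  have h1u : 0 < 1 + u := by linarith
  have h2u : 0 < 1 - u := by linarith [hδ.1]
  have hsub : (1 - u) • D ⊆ (1 + u) • D := by
    intro x hx
    rw [Set.mem_smul_set_iff_inv_smul_mem₀ h2u.ne'] at hx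
    rw [Set.mem_smul_set_iff_inv_smul_mem₀ h1u.ne']
    rcases eq_or_ne x 0 with rfl | hx0
    · simpa using hx
    · obtain ⟨ω, t, ht, rfl⟩ := exists_polar hx0
      rw [smul_smul, smul_mem_perturbedBall (by positivity)] at hx ⊢
      refine lt_of_le_of_lt ?_ hx
      gcongr
      linarith
  have hA : MeasurableSet (((1 + u) • D) \ ((1 - u) • D)) :=
    (hD.1.const_smul_of_ne_zero h1u.ne').diff (hD.1.const_smul_of_ne_zero h2u.ne')
  have hvol : volume (((1 + u) • D) \ ((1 - u) • D)) ≤ ENNReal.ofReal m := by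
    have hfin : volume (((1 + u) • D) \ ((1 - u) • D)) ≠ ∞ :=
      ((measure_mono Set.sdiff_subset).trans_lt (by
        rw [Measure.addHaar_smul]
        exact ENNReal.mul_lt_top ENNReal.ofReal_lt_top hDfin.lt_top)).ne
    rw [← ENNReal.ofReal_toReal hfin]
    exact ENNReal.ofReal_le_ofReal ((volume_real_shell_le hD.1 hDfin hu hδ.1 hsub).trans hδ.2)
  refine (norm_op_sub_apply_le hkD hD hA (fun x hx => mem_shell_of_mem_iff_ne hc hch hu hδ.1
    (by rwa [hcu]) hx) w (by positivity) (hmw _ hA hvol)).trans (le_of_eq ?_)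
  field_simp

/-! ### The displaced medium -/

/-- The displacement fixes the ball of radius `r₀` pointwise, hence the core, and moves no outside
point into it. By `g(re²) re³ = 1` it carries the sphere of radius `re` to the graph of `re + ⟪Qω,
ω⟫`. Monotonicity along rays does the rest. -/
theorem conductivity_displacement {D : Set E3} {Q : E3 →L[ℝ] E3} (hD : S.IsCore D)
    (hQ : S.IsSmall Q) (x : E3) :
    conductivity D (perturbedBall S.re fun ω => quad Q ω) S.σc S.σs S.σm
      (x + displacement S.g Q x) = S.cond D x := by
  have hmono := hQ.isDisplacement.strictMono_radial
  have h1 : x + displacement S.g Q x ∈ D ↔ x ∈ D := by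
    by_cases hx : ‖x‖ ≤ S.r₀
    · have h0 : displacement S.g Q x = 0 := by
        rw [displacement, S.profile.eq_zero_of_le _ (by gcongr), zero_mul, zero_smul]
      rw [h0, add_zero]
    · rw [not_le] at hx
      have hr₀ : 0 < S.r₀ := S.ri_pos.trans S.ri_lt
      refine iff_of_false (fun h => ?_) fun h => ?_
      · have h2 := hD.2 h
        obtain ⟨ω, t, ht, rfl⟩ := exists_polar (norm_pos_iff.mp (hr₀.trans hx))
        rw [norm_smul_sphere ω ht.le] at hx
        have h3 := hmono ω hx
        simp only [S.profile.eq_zero_of_le _ le_rfl, zero_mul, add_zero] at h3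
        rw [displacement_smul_sphere, mem_ball_zero_iff, norm_smul_sphere ω (hr₀.trans h3).le] at h2
        exact h2.not_gt h3
      · exact hx.not_gt (mem_ball_zero_iff.mp (hD.2 h))
  have h2 : x + displacement S.g Q x ∈ perturbedBall S.re (fun ω => quad Q ω) ↔
      x ∈ ball (0 : E3) S.re := by
    have hre : ∀ ω : S2, S.re + S.g (S.re ^ 2) * S.re ^ 3 * quad Q ω = S.re + quad Q ω :=
      fun ω => by rw [S.profile_one, one_mul]
    rcases eq_or_ne x 0 with rfl | hx
    · refine iff_of_true ?_ (mem_ball_self S.re_pos)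
      have h0 : (0 : E3) + displacement S.g Q 0 = 0 := by simp [displacement]
      rw [h0]
      refine zero_mem_perturbedBall fun ω => ?_
      have := hmono ω S.re_pos
      simp only [hre] at this
      simpa using this
    · obtain ⟨ω, t, ht, rfl⟩ := exists_polar hx
      have h3 := hmono ω ht
      rw [displacement_smul_sphere, smul_mem_perturbedBall (by simpa using h3), ← hre,
        mem_ball_zero_iff, norm_smul_sphere ω ht.le]
      exact (hmono ω).lt_iff_lt
  exact conductivity_congr h1 h2 _ _ _

theorem isPolarizationTensor_zero {D : Set E3} {Q : E3 →L[ℝ] E3} (hD : S.IsCore D)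
    (hQ : S.IsSmall Q) (hQre : ‖Q‖ < S.re) (hQR : S.re + ‖Q‖ ≤ S.R)
    (hpol : ∀ a c, S.pol D Q a c = 0) :
    IsPolarizationTensor D (perturbedBall S.re fun ω => quad Q ω) S.σc S.σs S.σm 0 := by
  intro a _
  have hb := fun ω : S2 => abs_le.mp (abs_quad_sphere_le Q ω)
  have hc : Continuous fun ω : S2 => quad Q ω :=
    (contDiff_quad Q).continuous.comp continuous_subtype_val
  have hΩ := measurableSet_perturbedBall S.re_pos (f := fun ω : S2 => quad Q ω)
    (fun ω => by linarith [(hb ω).1]) hc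
  have hΩR : perturbedBall S.re (fun ω => quad Q ω) ⊆ ball 0 S.R :=
    perturbedBall_subset_ball fun ω => by linarith [(hb ω).2]
  have h := conductivity_solution_of_pol_eq_zero hD hQ hpol
    (measurable_conductivity hD.1 hΩ S.σc S.σs S.σm) (le_conductivity _ _ _ _ _)
    (abs_conductivity_le S.σc_pos S.σs_pos S.σm_pos)
    (fun x hx => by
      rw [conductivity, if_neg fun h => hx (ball_subset_ball
        (S.r₀_lt.trans S.re_lt).le (hD.2 h)), if_neg fun h => hx (hΩR h)])
    (conductivity_displacement hD hQ) a
  refine ⟨h.1, fun u hu => ?_⟩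
  simpa using h.2 u hu

end ShellData

/-! ### Existence of a profile, and the homogeneous medium -/

theorem exists_isProfile {r₀ re R : ℝ} (hr₀ : 0 < r₀) (h₁ : r₀ < re) (h₂ : re < R) :
    ∃ g, IsProfile r₀ R g ∧ g (re ^ 2) * re ^ 3 = 1 := by
  have hre := hr₀.trans h₁
  have e₁ : 0 < re ^ 2 - r₀ ^ 2 := by nlinarith
  have e₂ : 0 < R ^ 2 - re ^ 2 := by nlinarith
  have hm : 0 < min (re ^ 2 - r₀ ^ 2) (R ^ 2 - re ^ 2) := lt_min e₁ e₂
  let f : ContDiffBump (re ^ 2) := ⟨min (re ^ 2 - r₀ ^ 2) (R ^ 2 - re ^ 2) / 2,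
    min (re ^ 2 - r₀ ^ 2) (R ^ 2 - re ^ 2), half_pos hm, half_lt_self hm⟩
  refine ⟨fun t => (re ^ 3)⁻¹ * f t, ⟨contDiff_const.mul f.contDiff, fun t ht => ?_, fun t ht => ?_⟩,
    ?_⟩
  · rw [f.zero_of_le_dist, mul_zero]
    rw [Real.dist_eq, abs_sub_comm, abs_of_nonneg (by linarith)]
    exact (min_le_left _ _).trans (by linarith)
  · rw [f.zero_of_le_dist, mul_zero]
    rw [Real.dist_eq, abs_of_nonneg (by linarith)]
    exact (min_le_right _ _).trans (by linarith)
  · change (re ^ 3)⁻¹ * f (re ^ 2) * re ^ 3 = 1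
    rw [f.one_of_mem_closedBall (mem_closedBall_self f.rIn_pos.le)]
    field_simp

/-- A homogeneous medium has no dipole moment. -/
theorem isPolarizationTensor_homogeneous (D Ω : Set E3) {s : ℝ} (hs : 0 < s) :
    IsPolarizationTensor D Ω s s s 0 := by
  intro a _
  have hσ : conductivity D Ω s s s = fun _ => s := by
    ext x
    simp [conductivity]
  rw [hσ]
  have hb : ∀ _x : E3, |s| ≤ s := fun _ => (abs_of_pos hs).le
  have h0 : mulOp (memLp_contrast (s := s) (σ := fun _ : E3 => s) measurable_const hb) = 0 := by
    refine norm_le_zero_iff.mp (norm_mulOp_le _ le_rfl fun x => ?_)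
    rw [contrast, sub_self, norm_smul, norm_zero, zero_mul]
  have h := conductivity_solution_of_corrector (σ := fun _ : E3 => s) (s := s) (R := 1) (a := a)
    (p := 0) measurable_const hs (fun _ => le_rfl) hb hs one_pos (fun _ _ => rfl)
    (by rw [h0]; exact ⟨zero_mem _, fun q _ => by simp⟩) (fun c => by rw [h0]; simp)
  refine ⟨h.1, fun u hu => ?_⟩
  simpa using h.2 u hu

end

end CoreShell

end

/-! ### Choice of the boundary correction -/

open Filter Topology

theorem theorem1p1 (σc σs σm ri re : ℝ) (hσc : 0 < σc) (hσs : 0 < σs) (hσm : 0 < σm)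
    (hri : 0 < ri) (hre : ri < re)
    (hneutral : (2 * σs + σc) * (σm - σs) + (ri / re) ^ 3 * (σs - σc) * (2 * σs + σm) = 0) :
    ∃ ε : ℝ, 0 < ε ∧ ∃ b : (S2 → ℝ) → (S2 → ℝ),
      (∀ h : S2 → ℝ, MemW2 h → normW2 h < ENNReal.ofReal ε →
        b h ∈ W6 ∧
        (∀ ω, 0 < ri + h ω) ∧
        closure (perturbedBall ri h) ⊆ perturbedBall re (b h) ∧
        IsPolarizationTensor (perturbedBall ri h) (perturbedBall re (b h)) σc σs σm 0) ∧
      (∀ h : S2 → ℝ, MemW2 h → normW2 h < ENNReal.ofReal ε →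
        ∀ η : ℝ, 0 < η → ∃ δ : ℝ, 0 < δ ∧
          ∀ k : S2 → ℝ, MemW2 k → normW2 k < ENNReal.ofReal ε →
            normW2 (k - h) < ENNReal.ofReal δ → ∀ ω, |b k ω - b h ω| < η) := by
  -- If shell and matrix agree, moving the outer boundary has no effect and the linearization
  -- degenerates; but then neutrality makes the whole medium homogeneous.
  rcases eq_or_ne σs σm with rfl | hne
  · obtain rfl : σc = σs := by
      have h : (ri / re) ^ 3 * (2 * σs + σs) ≠ 0 := by
        have := hri.trans hre
        positivity
      have h' : (ri / re) ^ 3 * (2 * σs + σs) * (σs - σc) = 0 := by linear_combination hneutral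
      linarith [(mul_eq_zero.mp h').resolve_left h]
    refine ⟨min ri ((re - ri) / 2) / 2, by have := sub_pos.mpr hre; positivity, fun _ => 0,
      fun h hh hlt => ?_, fun h _ _ η hη => ⟨1, one_pos, fun k _ _ _ ω => by simpa using hη⟩⟩
    have hab := fun ω => abs_le.mp (abs_le_of_normW2_lt hh.1 hlt ω)
    have h1 : min ri ((re - ri) / 2) ≤ ri := min_le_left _ _
    have h2 : min ri ((re - ri) / 2) ≤ (re - ri) / 2 := min_le_right _ _
    refine ⟨zero_mem _, fun ω => by linarith [(hab ω).1],
      closure_perturbedBall_subset (R := (ri + re) / 2) (by linarith)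
        (fun ω => by linarith [(hab ω).2]) fun ω => ?_,
      isPolarizationTensor_homogeneous _ _ hσc⟩
    change (ri + re) / 2 < re + 0
    linarith
  obtain ⟨r₀, hr₀, hr₀'⟩ := exists_between hre
  obtain ⟨g, hg, hg1⟩ := exists_isProfile (hri.trans hr₀) hr₀' (lt_two_mul_self (hri.trans hre))
  let S : ShellData := ⟨σc, σs, σm, ri, r₀, re, 2 * re, g, hσc, hσs, hσm, hri, hr₀, hr₀',
    lt_two_mul_self (hri.trans hre), hg, hg1, hneutral⟩
  obtain ⟨ρ₁, τ₁, L, hρ₁, -, hL, hsmall, hcomp, hlip⟩ := S.exists_compensation hne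
  -- The second bound keeps the displaced outer boundary outside the ball of radius `r₀`, and hence
  -- around the core.
  have hρ : 0 < min ρ₁ ((re - r₀) / 2) := lt_min hρ₁ (by linarith)
  obtain ⟨τ, hτ, hττ, hQ⟩ := hcomp _ hρ (min_le_left _ _)
  have hbase : ∀ᶠ δ in 𝓝[>] (0 : ℝ), ∀ i : Fin 3, ∀ k : S2 → ℝ, (∀ ω, |k ω - 0| ≤ δ) →
      S.IsCore (perturbedBall ri k) →
      ‖(S.op (perturbedBall ri k) 0 - S.op (perturbedBall ri 0) 0)
        (S.baseField (EuclideanSpace.single i 1))‖ ≤ τ :=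
    eventually_all.mpr fun i => S.eventually_norm_op_sub_apply_le hri (h := 0) continuous_const
      (fun ω => (add_zero ri).ge) (fun ω => (add_zero ri).trans_le hr₀.le) _ hτ
  have hb' : ∀ᶠ δ in 𝓝[>] (0 : ℝ), δ < min (ri / 2) (r₀ - ri) :=
    nhdsWithin_le_nhds (gt_mem_nhds (lt_min (half_pos hri) (sub_pos.mpr hr₀)))
  obtain ⟨ε, ⟨hεb, hεr⟩, hε⟩ := ((hbase.and hb').and self_mem_nhdsWithin).exists
  have hε1 : ε < ri / 2 := hεr.trans_le (min_le_left _ _)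
  have hε2 : ε < r₀ - ri := hεr.trans_le (min_le_right _ _)
  have hlow : ∀ k : S2 → ℝ, (∀ ω, |k ω| ≤ ε) → ∀ ω, ri / 2 ≤ ri + k ω := fun k hk ω => by
    linarith [(abs_le.mp (hk ω)).1]
  have hupp : ∀ k : S2 → ℝ, (∀ ω, |k ω| ≤ ε) → ∀ ω, ri + k ω ≤ r₀ := fun k hk ω => by
    linarith [(abs_le.mp (hk ω)).2]
  have hclose : ∀ k : S2 → ℝ, Continuous k → (∀ ω, |k ω| ≤ ε) →
      S.IsClose τ (perturbedBall ri k) := fun k hk hkε => by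
    have hcore : S.IsCore (perturbedBall ri k) :=
      S.isCore_perturbedBall hk (fun ω => (half_pos hri).trans_le (hlow k hkε ω)) (hupp k hkε)
    refine ⟨hcore, fun i => ?_⟩
    have := hεb i k (by simpa using hkε) hcore
    rwa [perturbedBall_zero hri] at this
  -- The correction must be defined for all functions. The value `0` is used where nothing is
  -- claimed.
  have hex : ∀ k : S2 → ℝ, ∃ Q : E3 →L[ℝ] E3, Continuous k → (∀ ω, |k ω| ≤ ε) →
      ContinuousLinearMap.adjoint Q = Q ∧ ‖Q‖ ≤ min ρ₁ ((re - r₀) / 2) ∧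
        ∀ a c, S.pol (perturbedBall ri k) Q a c = 0 := fun k => by
    by_cases hk : Continuous k ∧ ∀ ω, |k ω| ≤ ε
    · obtain ⟨Q, h⟩ := hQ _ (hclose k hk.1 hk.2)
      exact ⟨Q, fun _ _ => h⟩
    · exact ⟨0, fun h h' => absurd ⟨h, h'⟩ hk⟩
  choose Q hQ using hex
  refine ⟨ε, hε, fun k ω => quad (Q k) ω, fun h hh hlt => ?_, fun h hh hlt η hη => ?_⟩
  · have hhε := abs_le_of_normW2_lt hh.1 hlt
    obtain ⟨hsym, hnorm, hpol⟩ := hQ h hh.1 hhε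
    have hn : ‖Q h‖ ≤ (re - r₀) / 2 := hnorm.trans (min_le_right _ _)
    refine ⟨quad_mem_W6 hsym, fun ω => (half_pos hri).trans_le (hlow h hhε ω),
      closure_perturbedBall_subset (hri.trans hr₀).le (hupp h hhε) fun ω => ?_,
      S.isPolarizationTensor_zero (hclose h hh.1 hhε).1 (hsmall _ (hnorm.trans (min_le_left _ _)))
        ?_ ?_ hpol⟩
    · linarith [(abs_le.mp (abs_quad_sphere_le (Q h) ω)).1]
    · change ‖Q h‖ < re
      linarith
    · change re + ‖Q h‖ ≤ 2 * re
      linarith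
  · have hhε := abs_le_of_normW2_lt hh.1 hlt
    obtain ⟨hsym, hnorm, hpol⟩ := hQ h hh.1 hhε
    -- The fields belong to the fixed function `h` and its own correction, so strong continuity in
    -- the core applies to them. By the Lipschitz estimate the tolerance `η / (2 L)` leaves `η / 2 <
    -- η`.
    have hev : ∀ᶠ δ in 𝓝[>] (0 : ℝ), ∀ i : Fin 3, ∀ k : S2 → ℝ, (∀ ω, |k ω - h ω| ≤ δ) →
        S.IsCore (perturbedBall ri k) →
        ‖(S.op (perturbedBall ri k) 0 - S.op (perturbedBall ri h) 0)
          (ballField S.R (EuclideanSpace.single i 1) +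
            S.corr (perturbedBall ri h) (Q h) (EuclideanSpace.single i 1))‖ ≤ η / (2 * L) :=
      eventually_all.mpr fun i => S.eventually_norm_op_sub_apply_le (half_pos hri) hh.1
        (hlow h hhε) (hupp h hhε) _ (by positivity)
    obtain ⟨δ, hδ, hδ0⟩ := (hev.and self_mem_nhdsWithin).exists
    refine ⟨δ, hδ0, fun k hk hklt hkh ω => ?_⟩
    have hkε := abs_le_of_normW2_lt hk.1 hklt
    obtain ⟨hsym', hnorm', hpol'⟩ := hQ k hk.1 hkε
    have hmono : ∀ D, S.IsClose τ D → S.IsClose τ₁ D := fun D hD =>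
      ⟨hD.1, fun i => (hD.2 i).trans hττ⟩
    have h1 := hlip _ _ (Q h) (Q k) (hmono _ (hclose h hh.1 hhε)) (hmono _ (hclose k hk.1 hkε))
      hsym hsym' (hnorm.trans (min_le_left _ _)) (hnorm'.trans (min_le_left _ _)) hpol hpol' _
      fun i => hδ i k (abs_le_of_normW2_lt (hk.1.sub hh.1) hkh) (hclose k hk.1 hkε).1
    have h2 := abs_quad_sphere_le (Q k - Q h) ω
    rw [quad_sub, norm_sub_rev] at h2
    have h3 : L * (η / (2 * L)) = η / 2 := by field_simp
    linarith
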